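/- Let $n\ge 1$, and let $\mathbf H^n=\mathbf C^n\times\mathbf R$ be the Heisenberg group with group law $(z_1,t_1)\cdot(z_2,t_2)=(z_1+z_2,\;t_1+t_2+2\,\mathrm{Im}(z_1\cdot\overline{z_2}))$ and Haar (Lebesgue) measure. Let $Q=2n+2$ be the homogeneous dimension, $2^*=\frac{2Q}{Q-2}$, $|(z,t)|=(|z|^4+t^2)^{1/4}$ the Koranyi norm, and $\delta_\lambda(z,t)=(\lambda z,\lambda^2t)$. With $z_\alpha=x_\alpha+iy_\alpha$, let $X_\alpha=\partial_{x_\alpha}+2y_\alpha\partial_t$ and $Y_\alpha=\partial_{y_\alpha}-2x_\alpha\partial_t$ be the standard left invariant horizontal fields, and put $|\nabla u|^2=\sum_\alpha\big((X_\alpha u)^2+(Y_\alpha u)^2\big)$ and $\Delta=\sum_\alpha(X_\alpha^2+Y_\alpha^2)$. Let $\Psi$ be a positive solution, of class $C^2$ on $\mathbf H^n\setminus\{0\}$, of $-\Delta\Psi=\Psi^{\frac{Q+2}{Q-2}}$ that is homogeneous, i.e. $\Psi\circ\delta_\lambda=\lambda^{-\frac{Q-2}{2}}\Psi$ for all $\lambda>0$.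 For $T>1$ let $\Omega_T=\{x\in\mathbf H^n: 1\le|x|\le T\}$, let $X_T$ be the space of real functions $u\in S^1_{\rm loc}(\mathbf H^n\setminus\{0\})$ (that is, $u$ and its weak horizontal derivatives belong to $L^2_{\rm loc}(\mathbf H^n\setminus\{0\})$) with $u\circ\delta_T=T^{-\frac{Q-2}{2}}u$ almost everywhere, and let $$J_T(u)=\int_{\Omega_T}\Big(\tfrac12|\nabla u|^2-\tfrac1{2^*}|u|^{2^*}\Big),\qquad u\in X_T.$$ The Morse index of $J_T$ at $\Psi$ is the supremum of the dimensions of the finite-dimensional subspaces of $X_T$ on which the second variation $d^2J_T(\Psi)[u,u]=\frac{d^2}{ds^2}J_T(\Psi+su)\big|_{s=0}$ is negative definite. Then, for every $T>1$, $\Psi\in X_T$ and the Morse index of $J_T$ at $\Psi$ is finite; and the Morse index of $J_T$ at $\Psi$ tends to infinity as $T\to\infty$. -/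

import Mathlib

open MeasureTheory Filter
open scoped Topology ContDiff

noncomputable section

namespace Heisenberg

/-- The underlying space `ℂⁿ × ℝ` of the Heisenberg group, with points `(z, t)`. The group law is
`(z₁, t₁) · (z₂, t₂) = (z₁ + z₂, t₁ + t₂ + 2 Im (z₁ · conj z₂))`; its Haar measure is the
Lebesgue measure `volume`. -/
abbrev Heis (n : ℕ) : Type := (Fin n → ℂ) × ℝ

/-- The homogeneous dimension `Q = 2n + 2`. -/
def homDim (n : ℕ) : ℝ := 2 * (n : ℝ) + 2

/-- The critical exponent `2* = 2Q / (Q - 2)`. -/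
def critExp (n : ℕ) : ℝ := 2 * homDim n / (homDim n - 2)

/-- The dilation `δ_r (z, t) = (r z, r² t)`. -/
def dilation {n : ℕ} (r : ℝ) (x : Heis n) : Heis n := (fun α => (r : ℂ) * x.1 α, r ^ 2 * x.2)

/-- The Koranyi norm `(|z|⁴ + t²)^{1/4}`, where `|z|² = ∑ |z_α|²`. -/
def koranyi {n : ℕ} (x : Heis n) : ℝ := ((∑ α, ‖x.1 α‖ ^ 2) ^ 2 + x.2 ^ 2) ^ (1 / 4 : ℝ)

/-- The cylinder `Ω_T = {1 ≤ |x| ≤ T}`. -/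
def annulus (n : ℕ) (T : ℝ) : Set (Heis n) := {x | 1 ≤ koranyi x ∧ koranyi x ≤ T}

/-- The standard left invariant horizontal frame, with `z_α = x_α + i y_α`:
`inl α` is `X_α = ∂/∂x_α + 2 y_α ∂/∂t` and `inr α` is `Y_α = ∂/∂y_α - 2 x_α ∂/∂t`. -/
def frame {n : ℕ} : Fin n ⊕ Fin n → Heis n → Heis n
  | Sum.inl α, p => (Pi.single α 1, 2 * (p.1 α).im)
  | Sum.inr α, p => (Pi.single α Complex.I, -2 * (p.1 α).re)

/-- The classical derivative of `f` along the horizontal field `j`. -/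
def hDeriv {n : ℕ} (j : Fin n ⊕ Fin n) (f : Heis n → ℝ) (x : Heis n) : ℝ :=
  fderiv ℝ f x (frame j x)

/-- The sublaplacian `Δ = ∑ (X_α² + Y_α²)`, which is `2 ∑ (Z_α Z̄_α + Z̄_α Z_α)`
with `Z_α = (X_α - i Y_α) / 2`. -/
def subLaplacian {n : ℕ} (f : Heis n → ℝ) (x : Heis n) : ℝ :=
  ∑ j : Fin n ⊕ Fin n, hDeriv j (hDeriv j f) x

/-- A positive classical solution of `-Δ Ψ = Ψ^{(Q+2)/(Q-2)}` on the punctured Heisenberg group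
that is homogeneous of degree `-(Q-2)/2`. -/
structure IsHomogeneousSolution {n : ℕ} (Ψ : Heis n → ℝ) : Prop where
  contDiffOn : ContDiffOn ℝ 2 Ψ {0}ᶜ
  pos : ∀ x, x ≠ 0 → 0 < Ψ x
  equation : ∀ x, x ≠ 0 → -subLaplacian Ψ x = Ψ x ^ ((homDim n + 2) / (homDim n - 2))
  homogeneous : ∀ r : ℝ, 0 < r → ∀ x, x ≠ 0 →
    Ψ (dilation r x) = r ^ (-((homDim n - 2) / 2)) * Ψ x

/-- `L²_loc` of the punctured Heisenberg group. -/
def MemL2Loc {n : ℕ} (f : Heis n → ℝ) : Prop :=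
  ∀ K : Set (Heis n), IsCompact K → K ⊆ {0}ᶜ → MemLp f 2 (volume.restrict K)

/-- `g` is the derivative of `u` along the horizontal field `j` in the sense of distributions on
the punctured Heisenberg group (the horizontal fields are divergence free). -/
def IsWeakDeriv {n : ℕ} (j : Fin n ⊕ Fin n) (u g : Heis n → ℝ) : Prop :=
  ∀ φ : Heis n → ℝ, ContDiff ℝ ∞ φ → HasCompactSupport φ → tsupport φ ⊆ {0}ᶜ →
    ∫ x, u x * hDeriv j φ x = -∫ x, g x * φ x

/-- The local Folland-Stein space `S¹_loc` of the punctured Heisenberg group. -/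
def MemS1Loc {n : ℕ} (u : Heis n → ℝ) : Prop :=
  MemL2Loc u ∧ ∀ j, ∃ g, MemL2Loc g ∧ IsWeakDeriv j u g

open Classical in
/-- The weak derivative of `u` along the horizontal field `j` (unique up to null sets). -/
def weakDeriv {n : ℕ} (j : Fin n ⊕ Fin n) (u : Heis n → ℝ) : Heis n → ℝ :=
  if h : ∃ g, MemL2Loc g ∧ IsWeakDeriv j u g then h.choose else 0

/-- The functional `J_T(u) = ∫_{Ω_T} (|∇u|² / 2 - |u|^{2*} / 2*)`. -/
def energy (n : ℕ) (T : ℝ) (u : Heis n → ℝ) : ℝ :=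
  ∫ x in annulus n T, ((1 / 2) * ∑ j, (weakDeriv j u x) ^ 2
    - (1 / critExp n) * |u x| ^ critExp n)

theorem MemL2Loc.integrable_mul {n : ℕ} {f : Heis n → ℝ} (hf : MemL2Loc f) {ψ : Heis n → ℝ}
    (hψ : Continuous ψ) (hc : HasCompactSupport ψ) (h0 : tsupport ψ ⊆ {0}ᶜ) :
    Integrable (fun x => f x * ψ x) := by
  have h1 : MemLp f 2 (volume.restrict (tsupport ψ)) := hf _ hc h0
  have h2 : MemLp ψ 2 (volume.restrict (tsupport ψ)) :=
    (hψ.memLp_of_hasCompactSupport hc).restrict _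
  have h3 : IntegrableOn (fun x => f x * ψ x) (tsupport ψ) := h1.integrable_mul h2
  refine (integrableOn_iff_integrable_of_support_subset ?_).1 h3
  exact (Function.support_mul_subset_right f ψ).trans (subset_tsupport ψ)

theorem continuous_frame {n : ℕ} (j : Fin n ⊕ Fin n) :
    Continuous (frame j : Heis n → Heis n) := by
  cases j with
  | inl α =>
    show Continuous fun p : Heis n => ((Pi.single α 1, 2 * (p.1 α).im) : Heis n)
    fun_prop
  | inr α =>
    show Continuous fun p : Heis n => ((Pi.single α Complex.I, -2 * (p.1 α).re) : Heis n)
    fun_prop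

theorem tsupport_hDeriv_subset {n : ℕ} (j : Fin n ⊕ Fin n) (φ : Heis n → ℝ) :
    tsupport (hDeriv j φ) ⊆ tsupport φ := by
  refine closure_minimal ?_ (isClosed_tsupport φ)
  intro x hx
  by_contra hx'
  apply hx
  have : fderiv ℝ φ x = 0 := by
    by_contra h
    exact hx' (support_fderiv_subset ℝ h)
  simp [hDeriv, this]

theorem MemL2Loc.integrable_mul_hDeriv {n : ℕ} {f : Heis n → ℝ} (hf : MemL2Loc f)
    (j : Fin n ⊕ Fin n) {φ : Heis n → ℝ}
    (hφ : ContDiff ℝ ∞ φ) (hc : HasCompactSupport φ) (h0 : tsupport φ ⊆ {0}ᶜ) :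
    Integrable (fun x => f x * hDeriv j φ x) := by
  refine hf.integrable_mul ?_ ?_ ((tsupport_hDeriv_subset j φ).trans h0)
  · exact (hφ.continuous_fderiv (by simp)).clm_apply (continuous_frame j)
  · exact hc.of_isClosed_subset (isClosed_tsupport _) (tsupport_hDeriv_subset j φ)

/-- The space `X_T` of all `u ∈ S¹_loc` of the punctured Heisenberg group such that
`u ∘ δ_T = T^{-(Q-2)/2} u` almost everywhere. -/
def periodicSpace (n : ℕ) (T : ℝ) : Submodule ℝ (Heis n → ℝ) where
  carrier := {u | MemS1Loc u ∧
    ∀ᵐ x : Heis n, u (dilation T x) = T ^ (-((homDim n - 2) / 2)) * u x}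
  zero_mem' := by
    refine ⟨⟨fun K _ _ => MemLp.zero, fun j => ⟨0, fun K _ _ => MemLp.zero, ?_⟩⟩, ?_⟩
    · intro φ _ _ _; simp
    · simp
  add_mem' := by
    rintro u v ⟨⟨hu, hu'⟩, hup⟩ ⟨⟨hv, hv'⟩, hvp⟩
    refine ⟨⟨fun K h1 h2 => (hu K h1 h2).add (hv K h1 h2), fun j => ?_⟩, ?_⟩
    · obtain ⟨g, hg, hgw⟩ := hu' j
      obtain ⟨k, hk, hkw⟩ := hv' j
      refine ⟨g + k, fun K h1 h2 => (hg K h1 h2).add (hk K h1 h2), ?_⟩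
      intro φ h1 h2 h3
      have e1 := integral_add (hu.integrable_mul_hDeriv j h1 h2 h3)
        (hv.integrable_mul_hDeriv j h1 h2 h3)
      have e2 := integral_add (hg.integrable_mul h1.continuous h2 h3)
        (hk.integrable_mul h1.continuous h2 h3)
      simp only [Pi.add_apply, add_mul]
      rw [e1, e2, hgw φ h1 h2 h3, hkw φ h1 h2 h3]
      ring
    · filter_upwards [hup, hvp] with x hx hy
      simp only [Pi.add_apply, hx, hy]
      ring
  smul_mem' := by
    rintro c u ⟨⟨hu, hu'⟩, hup⟩
    refine ⟨⟨fun K h1 h2 => (hu K h1 h2).const_smul c, fun j => ?_⟩, ?_⟩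
    · obtain ⟨g, hg, hgw⟩ := hu' j
      refine ⟨c • g, fun K h1 h2 => (hg K h1 h2).const_smul c, ?_⟩
      intro φ h1 h2 h3
      simp only [Pi.smul_apply, smul_eq_mul, mul_assoc]
      rw [integral_const_mul, integral_const_mul, hgw φ h1 h2 h3]
      ring
    · filter_upwards [hup] with x hx
      simp only [Pi.smul_apply, smul_eq_mul, hx]
      ring

/-- The second variation `d²J(p)[u, u]`, the second derivative at `s = 0` of `s ↦ J(p + s u)`. -/
def secondVariation {E : Type*} [AddCommGroup E] [Module ℝ E] (J : E → ℝ) (p u : E) : ℝ :=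
  iteratedDeriv 2 (fun s : ℝ => J (p + s • u)) 0

/-- The Morse index at `p` of the functional `J` on the space `X`: the supremum, possibly infinite,
of the dimensions of the finite dimensional subspaces of `X` on which the second variation of `J`
at `p` is negative definite. Identifying functions that agree almost everywhere would not change
it, for functionals that do not see null sets. -/
def morseIndex {E : Type*} [AddCommGroup E] [Module ℝ E] (X : Submodule ℝ E) (J : E → ℝ)
    (p : E) : ℕ∞ :=
  ⨆ V ∈ {V : Submodule ℝ E | V ≤ X ∧ FiniteDimensional ℝ V ∧
    ∀ u ∈ V, u ≠ 0 → secondVariation J p u < 0}, (Module.finrank ℝ V : ℕ∞)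

end Heisenberg

end

/-!
The second variation of `J_T` at `Ψ` in a direction `u ∈ X_T` is
`∫_{Ω_T} |∇u|² - (2* - 1) ∫_{Ω_T} Ψ^{2* - 2} u²` (`secondVariation_eq`).

*Finiteness.* Since `Ψ` is bounded on `Ω_T`, it is enough that finitely many linear functionals on
`X_T` have the following property: if they vanish at `u`, then `∫_{Ω_T} u² ≤ θ ∫_{Ω_T} |∇u|²`, with
`θ` as small as desired (`exists_finset_poincare`). A negative definite subspace then has at most as
many dimensions as there are functionals. The functionals are the values, at a finite set of points,
of the convolution of `u` with a bump of small radius. Indeed `u` is close to its convolution,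
because `u(x v) - u(x)` is controlled by the gradient: for horizontal `v` the increment is the
integral of the weak derivative along the segment from `x` to `x v`
(`ae_increment_eq_integral`, obtained by testing with smooth functions), and every group element is a
product of five horizontal ones that are not longer, as vertical elements are commutators
(`exists_horizProd_eq`). The convolution in turn is determined up to a small error by finitely many
of its values, because the translates of the bump form a compact family (`exists_finset_bump`).
Convolution needs a domain larger than `Ω_T`; periodicity under `δ_T` brings the integrals back to
`Ω_T` (`exists_lintegral_shell_le`).

*Growth.* For directions `u = h(log |x|) Ψ` with `h` periodic of period `log T`, everything reduces to
one dimension: a density homogeneous of degree `-Q` is pushed forward by `log |x|` to a translation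
invariant measure on `ℝ`, hence to a multiple of Lebesgue measure
(`IsCritHomogeneous.exists_map_eq`). Testing the equation of `Ψ` with a radial multiple of `Ψ` shows
that `|∇Ψ|²` and `Ψ^{2*}` give the same multiple (`IsHomogeneousSolution.grad_const_eq`), so that the
second variation equals `B ∫ h'² - A ∫ h²` over a period, with `A > 0` and with `A`, `B` independent
of `T`. On sine polynomials of a fixed degree `∫ h'²` is at most a multiple of
`(log T)⁻² ∫ h²`, so for `T` large the form is negative definite on a space whose dimension is that
degree (`IsHomogeneousSolution.le_morseIndex`).
-/

noncomputable section

namespace Heisenberg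

variable {n : ℕ}

/-! ### The group law, the Koranyi norm and the dilations -/

/-- The group law of the Heisenberg group. -/
def hmul (x y : Heis n) : Heis n :=
  (x.1 + y.1, x.2 + y.2 + 2 * (∑ α, x.1 α * (starRingEnd ℂ) (y.1 α)).im)

/-- The left invariant horizontal vector field `∑ (Re w_α X_α + Im w_α Y_α)`. -/
def hDir (w : Fin n → ℂ) (x : Heis n) : Heis n :=
  (w, 2 * (∑ α, x.1 α * (starRingEnd ℂ) (w α)).im)

/-- The polynomial `|x|⁴`, the fourth power of the Koranyi norm. -/
def gauge4 (x : Heis n) : ℝ := (∑ α, ‖x.1 α‖ ^ 2) ^ 2 + x.2 ^ 2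

/-- The closed shell `{a ≤ |x| ≤ b}` for the Koranyi norm. -/
def shell (n : ℕ) (a b : ℝ) : Set (Heis n) := {x | a ≤ koranyi x ∧ koranyi x ≤ b}

theorem gauge4_nonneg (x : Heis n) : 0 ≤ gauge4 x := by unfold gauge4; positivity

theorem koranyi_eq (x : Heis n) : koranyi x = gauge4 x ^ (1 / 4 : ℝ) := rfl

theorem koranyi_nonneg (x : Heis n) : 0 ≤ koranyi x := Real.rpow_nonneg (gauge4_nonneg x) _

theorem koranyi_pow_four (x : Heis n) : koranyi x ^ 4 = gauge4 x := by
  rw [koranyi_eq, ← Real.rpow_natCast, ← Real.rpow_mul (gauge4_nonneg x)]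
  norm_num

theorem gauge4_eq_zero_iff (x : Heis n) : gauge4 x = 0 ↔ x = 0 := by
  constructor
  · intro h
    unfold gauge4 at h
    have h1 : (∑ α, ‖x.1 α‖ ^ 2) ^ 2 = 0 := by nlinarith [sq_nonneg (∑ α, ‖x.1 α‖ ^ 2), sq_nonneg x.2]
    have h2 : x.2 ^ 2 = 0 := by nlinarith
    have h3 : ∑ α, ‖x.1 α‖ ^ 2 = 0 := by simpa using h1
    rw [Finset.sum_eq_zero_iff_of_nonneg (fun i _ => by positivity)] at h3
    refine Prod.ext (funext fun α => ?_) (by simpa using h2)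
    simpa using h3 α (Finset.mem_univ _)
  · rintro rfl
    simp [gauge4]

theorem gauge4_pos {x : Heis n} (hx : x ≠ 0) : 0 < gauge4 x :=
  lt_of_le_of_ne (gauge4_nonneg x) fun h => hx ((gauge4_eq_zero_iff x).1 h.symm)

theorem koranyi_pos {x : Heis n} (hx : x ≠ 0) : 0 < koranyi x :=
  Real.rpow_pos_of_pos (gauge4_pos hx) _

@[simp] theorem koranyi_zero : koranyi (0 : Heis n) = 0 := by
  rw [koranyi_eq, (gauge4_eq_zero_iff 0).2 rfl]; norm_num

theorem contDiff_gauge4 : ContDiff ℝ ∞ (gauge4 : Heis n → ℝ) := by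
  have h : (gauge4 : Heis n → ℝ) = fun x => (∑ α, ‖x.1 α‖ ^ 2) ^ 2 + x.2 ^ 2 := rfl
  rw [h]
  refine ContDiff.add (ContDiff.pow (ContDiff.sum fun α _ => ?_) 2) (by fun_prop)
  exact ContDiff.norm_sq ℝ ((contDiff_apply ℝ ℂ α).comp contDiff_fst)

theorem continuous_koranyi : Continuous (koranyi : Heis n → ℝ) :=
  contDiff_gauge4.continuous.rpow_const fun _ => Or.inr (by norm_num)

theorem sum_sq_le_koranyi_sq (x : Heis n) : ∑ α, ‖x.1 α‖ ^ 2 ≤ koranyi x ^ 2 := by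
  have h := koranyi_pow_four x
  unfold gauge4 at h
  refine le_of_sq_le_sq ?_ (by positivity)
  nlinarith [sq_nonneg x.2]

theorem abs_snd_le_koranyi_sq (x : Heis n) : |x.2| ≤ koranyi x ^ 2 := by
  have h := koranyi_pow_four x
  unfold gauge4 at h
  refine abs_le_of_sq_le_sq ?_ (by positivity)
  nlinarith [sq_nonneg (∑ α, ‖x.1 α‖ ^ 2)]

theorem norm_fst_le_koranyi (x : Heis n) : ‖x.1‖ ≤ koranyi x := by
  refine (pi_norm_le_iff_of_nonneg (koranyi_nonneg x)).2 fun α => ?_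
  refine le_of_sq_le_sq ?_ (koranyi_nonneg x)
  exact (Finset.single_le_sum (f := fun α => ‖x.1 α‖ ^ 2) (fun i _ => by positivity)
    (Finset.mem_univ α)).trans (sum_sq_le_koranyi_sq x)

theorem isCompact_shell (a b : ℝ) : IsCompact (shell n a b) := by
  refine Metric.isCompact_of_isClosed_isBounded ?_ ?_
  · exact (isClosed_le continuous_const continuous_koranyi).inter
      (isClosed_le continuous_koranyi continuous_const)
  · refine (Metric.isBounded_iff_subset_closedBall 0).2 ⟨max |b| (|b| ^ 2), fun x hx => ?_⟩
    have hb : koranyi x ≤ |b| := hx.2.trans (le_abs_self b)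
    rw [mem_closedBall_zero_iff, Prod.norm_def]
    refine max_le_max ((norm_fst_le_koranyi x).trans hb) ((abs_snd_le_koranyi_sq x).trans ?_)
    exact pow_le_pow_left₀ (koranyi_nonneg x) hb 2

theorem shell_subset {a b : ℝ} (ha : 0 < a) : shell n a b ⊆ {0}ᶜ := by
  rintro x ⟨h1, -⟩ (rfl : x = 0)
  rw [koranyi_zero] at h1
  exact absurd h1 (not_le.2 ha)

/-- The triangle inequality for the Koranyi norm. -/
theorem koranyi_hmul_le (x y : Heis n) : koranyi (hmul x y) ≤ koranyi x + koranyi y := by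
  -- With `A(z, t) = |z|² + i t` one has `|A(x)| = |x|²` and `A(x y) = A(x) + A(y) + 2 z · z̄'`.
  let A : Heis n → ℂ := fun x => ⟨∑ α, ‖x.1 α‖ ^ 2, x.2⟩
  have hA : ∀ x : Heis n, ‖A x‖ = koranyi x ^ 2 := by
    intro x
    refine (sq_eq_sq₀ (norm_nonneg _) (by positivity)).1 ?_
    rw [← pow_mul, koranyi_pow_four, Complex.sq_norm, Complex.normSq_mk, gauge4]
    ring
  set S : ℂ := ∑ α, x.1 α * (starRingEnd ℂ) (y.1 α) with hS
  have hmulA : A (hmul x y) = A x + A y + 2 * S := by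
    apply Complex.ext
    · simp only [A, hmul, Complex.add_re, Complex.mul_re, hS, Complex.re_sum, Complex.re_ofNat,
        Complex.im_ofNat, zero_mul, sub_zero, Finset.mul_sum, ← Finset.sum_add_distrib]
      refine Finset.sum_congr rfl fun α _ => ?_
      simp only [Pi.add_apply, Complex.sq_norm, Complex.normSq_apply, Complex.add_re,
        Complex.add_im, Complex.conj_re, Complex.conj_im]
      ring
    · simp [A, hmul, hS]
  have hSn : ‖S‖ ≤ koranyi x * koranyi y := by
    have h1 : ‖S‖ ≤ ∑ α, ‖x.1 α‖ * ‖y.1 α‖ := by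
      refine (norm_sum_le _ _).trans (Finset.sum_le_sum fun α _ => ?_)
      simp
    refine h1.trans (le_of_sq_le_sq ?_ (mul_nonneg (koranyi_nonneg x) (koranyi_nonneg y)))
    refine (Finset.sum_mul_sq_le_sq_mul_sq _ _ _).trans ?_
    rw [mul_pow]
    exact mul_le_mul (sum_sq_le_koranyi_sq x) (sum_sq_le_koranyi_sq y) (by positivity)
      (by positivity)
  refine le_of_sq_le_sq ?_ (add_nonneg (koranyi_nonneg x) (koranyi_nonneg y))
  rw [← hA, hmulA]
  calc ‖A x + A y + 2 * S‖ ≤ ‖A x‖ + ‖A y‖ + ‖2 * S‖ := norm_add₃_le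
    _ ≤ koranyi x ^ 2 + koranyi y ^ 2 + 2 * (koranyi x * koranyi y) := by
        rw [hA, hA, norm_mul]; norm_num; exact hSn
    _ = _ := by ring

theorem hmul_assoc (x y z : Heis n) : hmul (hmul x y) z = hmul x (hmul y z) := by
  refine Prod.ext (by simp [hmul, add_assoc]) ?_
  simp only [hmul, Pi.add_apply, map_add, mul_add, add_mul, Finset.sum_add_distrib, Complex.add_im]
  ring

theorem im_mul_conj_self (z : Fin n → ℂ) : (∑ α, z α * (starRingEnd ℂ) (z α)).im = 0 := by
  simp [Complex.mul_conj]

@[simp] theorem hmul_zero (x : Heis n) : hmul x 0 = x := by simp [hmul]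

@[simp] theorem zero_hmul (x : Heis n) : hmul 0 x = x := by simp [hmul]

theorem neg_hmul_self (x : Heis n) : hmul (-x) x = 0 := by
  refine Prod.ext (by simp [hmul]) ?_
  have := im_mul_conj_self x.1
  simp only [hmul, Prod.fst_neg, Pi.neg_apply, neg_mul, Finset.sum_neg_distrib, Complex.neg_im,
    this]
  simp

theorem hmul_neg_self (x : Heis n) : hmul x (-x) = 0 := by
  simpa using neg_hmul_self (-x)

theorem neg_hmul_cancel (x y : Heis n) : hmul (-x) (hmul x y) = y := by
  rw [← hmul_assoc, neg_hmul_self, zero_hmul]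

theorem hmul_neg_cancel (x y : Heis n) : hmul x (hmul (-x) y) = y := by
  rw [← hmul_assoc, hmul_neg_self, zero_hmul]

theorem koranyi_neg (x : Heis n) : koranyi (-x) = koranyi x := by simp [koranyi]

theorem koranyi_le_hmul_add (x y : Heis n) : koranyi x ≤ koranyi (hmul x y) + koranyi y := by
  have h := koranyi_hmul_le (hmul x y) (-y)
  rwa [hmul_assoc, hmul_neg_self, hmul_zero, koranyi_neg] at h

theorem hmul_mem_shell {a b : ℝ} {x v : Heis n} (hx : x ∈ shell n a b) {s : ℝ}
    (hv : koranyi v ≤ s) : hmul x v ∈ shell n (a - s) (b + s) := by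
  have h1 := koranyi_hmul_le x v
  have h2 := koranyi_le_hmul_add x v
  exact ⟨by linarith [hx.1], by linarith [hx.2]⟩

theorem continuous_hmul : Continuous fun p : Heis n × Heis n => hmul p.1 p.2 := by
  unfold hmul
  refine Continuous.prodMk (by fun_prop) ?_
  refine Continuous.add (by fun_prop) (continuous_const.mul (Complex.continuous_im.comp ?_))
  refine continuous_finsetSum _ fun α _ => ?_
  exact ((continuous_apply α).comp (continuous_fst.comp continuous_fst)).mul
    (Complex.continuous_conj.comp ((continuous_apply α).comp (continuous_fst.comp continuous_snd)))

/-- The Lebesgue measure is right invariant: right translations are shears composed with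
translations. -/
theorem measurePreserving_hmul_right (v : Heis n) :
    MeasurePreserving (fun x : Heis n => hmul x v) := by
  have h1 : MeasurePreserving (fun z : Fin n → ℂ => z + v.1) := measurePreserving_add_right _ _
  refine h1.skew_product
    (g := fun z t => t + v.2 + 2 * (∑ α, z α * (starRingEnd ℂ) (v.1 α)).im) ?_ ?_
  · refine Continuous.measurable ?_
    refine Continuous.add (by fun_prop) (continuous_const.mul (Complex.continuous_im.comp ?_))
    refine continuous_finsetSum _ fun α _ => ?_
    exact ((continuous_apply α).comp continuous_fst).mul continuous_const
  · refine Eventually.of_forall fun z => ?_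
    have := (measurePreserving_add_right (volume : Measure ℝ)
      (v.2 + 2 * (∑ α, z α * (starRingEnd ℂ) (v.1 α)).im)).map_eq
    simpa only [add_assoc] using this

theorem measurePreserving_hmul_left (v : Heis n) :
    MeasurePreserving (fun x : Heis n => hmul v x) := by
  have h1 : MeasurePreserving (fun z : Fin n → ℂ => v.1 + z) := measurePreserving_add_left _ _
  refine h1.skew_product
    (g := fun z t => v.2 + t + 2 * (∑ α, v.1 α * (starRingEnd ℂ) (z α)).im) ?_ ?_
  · refine Continuous.measurable ?_
    refine Continuous.add (by fun_prop) (continuous_const.mul (Complex.continuous_im.comp ?_))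
    refine continuous_finsetSum _ fun α _ => ?_
    exact continuous_const.mul (Complex.continuous_conj.comp ((continuous_apply α).comp continuous_fst))
  · refine Eventually.of_forall fun z => ?_
    have := (measurePreserving_add_left (volume : Measure ℝ)
      (v.2 + 2 * (∑ α, v.1 α * (starRingEnd ℂ) (z α)).im)).map_eq
    have e : (fun t => v.2 + t + 2 * (∑ α, v.1 α * (starRingEnd ℂ) (z α)).im) =
        fun t => v.2 + 2 * (∑ α, v.1 α * (starRingEnd ℂ) (z α)).im + t := by
      ext t; ring
    rw [e]; exact this

theorem continuous_hDir (w : Fin n → ℂ) : Continuous (hDir w : Heis n → Heis n) := by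
  unfold hDir
  refine Continuous.prodMk (by fun_prop) (continuous_const.mul (Complex.continuous_im.comp ?_))
  refine continuous_finsetSum _ fun α _ => ?_
  exact ((continuous_apply α).comp continuous_fst).mul continuous_const

/-- The integral curves of a left invariant horizontal field are the straight lines
`τ ↦ x + τ hDir w x`, which are right translations. -/
theorem hmul_horizontal (x : Heis n) (w : Fin n → ℂ) (τ : ℝ) :
    hmul x ((τ • w, 0) : Heis n) = x + τ • hDir w x := by
  refine Prod.ext (by simp [hmul, hDir]) ?_
  simp only [hmul, hDir, Pi.smul_apply, Complex.real_smul, map_mul, Complex.conj_ofReal,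
    Prod.snd_add, Prod.smul_snd, smul_eq_mul, add_zero]
  have : ∀ α, x.1 α * ((τ : ℂ) * (starRingEnd ℂ) (w α)) =
    (τ : ℂ) * (x.1 α * (starRingEnd ℂ) (w α)) := fun α => by ring
  simp only [this, ← Finset.mul_sum, Complex.im_ofReal_mul]
  ring

theorem hDir_hmul_horizontal (x : Heis n) (w : Fin n → ℂ) (τ : ℝ) :
    hDir w (hmul x ((τ • w, 0) : Heis n)) = hDir w x := by
  refine Prod.ext rfl ?_
  have h := im_mul_conj_self w
  have h2 : ∀ α, ((τ:ℂ) * w α) * (starRingEnd ℂ) (w α) = (τ : ℂ) * (w α * (starRingEnd ℂ) (w α)) :=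
    fun α => by ring
  simp only [hDir, hmul, Pi.add_apply, Pi.smul_apply, Complex.real_smul, add_mul,
    Finset.sum_add_distrib, Complex.add_im, h2, ← Finset.mul_sum, Complex.im_ofReal_mul, h]
  ring

theorem hDir_eq_sum_frame (w : Fin n → ℂ) (x : Heis n) :
    hDir w x = ∑ α, ((w α).re • frame (Sum.inl α) x + (w α).im • frame (Sum.inr α) x) := by
  refine Prod.ext ?_ ?_
  · ext β
    simp only [hDir, frame, Prod.fst_sum, Prod.fst_add, Prod.smul_fst, Finset.sum_apply,
      Pi.add_apply, Pi.smul_apply, Pi.single_apply]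
    simp only [Complex.real_smul, Finset.sum_add_distrib]
    simp
  · simp only [hDir, frame, Prod.snd_sum, Prod.snd_add, Prod.smul_snd, smul_eq_mul, Complex.im_sum,
      Finset.mul_sum]
    refine Finset.sum_congr rfl fun α _ => ?_
    simp
    ring

theorem koranyi_dilation {r : ℝ} (hr : 0 < r) (x : Heis n) :
    koranyi (dilation r x) = r * koranyi x := by
  refine (pow_left_inj₀ (koranyi_nonneg _) (mul_nonneg hr.le (koranyi_nonneg x))
    (by norm_num : (4:ℕ) ≠ 0)).1 ?_
  rw [mul_pow, koranyi_pow_four, koranyi_pow_four]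
  simp only [gauge4, dilation, norm_mul, mul_pow, ← Finset.mul_sum, Complex.norm_real,
    Real.norm_eq_abs, sq_abs]
  ring

theorem dilation_dilation (r s : ℝ) (x : Heis n) :
    dilation r (dilation s x) = dilation (r * s) x := by
  refine Prod.ext ?_ ?_
  · ext α; simp [dilation, mul_assoc]
  · simp [dilation]; ring

@[simp] theorem dilation_one (x : Heis n) : dilation 1 x = x := by simp [dilation]

theorem dilation_inv_cancel {r : ℝ} (hr : 0 < r) (x : Heis n) :
    dilation r⁻¹ (dilation r x) = x := by
  rw [dilation_dilation, inv_mul_cancel₀ hr.ne', dilation_one]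

theorem dilation_cancel_inv {r : ℝ} (hr : 0 < r) (x : Heis n) :
    dilation r (dilation r⁻¹ x) = x := by
  rw [dilation_dilation, mul_inv_cancel₀ hr.ne', dilation_one]

/-- The dilation as a continuous linear map. -/
def dilationL (n : ℕ) (r : ℝ) : Heis n →L[ℝ] Heis n :=
  (r • ContinuousLinearMap.fst ℝ (Fin n → ℂ) ℝ).prod (r ^ 2 • ContinuousLinearMap.snd ℝ (Fin n → ℂ) ℝ)

theorem dilationL_apply (r : ℝ) (x : Heis n) : dilationL n r x = dilation r x := by
  refine Prod.ext ?_ ?_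
  · ext α; simp [dilationL, dilation]
  · simp [dilationL, dilation]

theorem dilation_ne_zero {r : ℝ} (hr : 0 < r) {x : Heis n} (hx : x ≠ 0) : dilation r x ≠ 0 := by
  intro h
  apply hx
  rw [← dilation_inv_cancel hr x, h, ← dilationL_apply, map_zero]

theorem contDiff_dilation (r : ℝ) : ContDiff ℝ ∞ (dilation r : Heis n → Heis n) := by
  have : (dilation r : Heis n → Heis n) = dilationL n r := by
    ext1 x; exact (dilationL_apply r x).symm
  rw [this]
  exact (dilationL n r).contDiff

/-- The dilation as a homeomorphism. -/
def dilationHomeo (n : ℕ) {r : ℝ} (hr : 0 < r) : Heis n ≃ₜ Heis n where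
  toFun := dilation r
  invFun := dilation r⁻¹
  left_inv := dilation_inv_cancel hr
  right_inv := dilation_cancel_inv hr
  continuous_toFun := (contDiff_dilation r).continuous
  continuous_invFun := (contDiff_dilation r⁻¹).continuous

/-- The horizontal fields are homogeneous of degree one under dilations. -/
theorem dilation_frame (r : ℝ) (j : Fin n ⊕ Fin n) (x : Heis n) :
    dilationL n r (frame j x) = r • frame j (dilation r x) := by
  cases j with
  | inl α =>
    refine Prod.ext (by simp [dilationL, frame]) ?_
    simp [dilationL, dilation, frame]; ring
  | inr α =>
    refine Prod.ext (by simp [dilationL, frame]) ?_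
    simp [dilationL, dilation, frame]; ring

theorem map_dilation_volume {r : ℝ} (hr : 0 < r) :
    Measure.map (dilation r) (volume : Measure (Heis n)) =
      ENNReal.ofReal (r ^ (-homDim n)) • volume := by
  have e : (dilation r : Heis n → Heis n) =
      Prod.map (fun z : Fin n → ℂ => r • z) (fun t : ℝ => r ^ 2 • t) := by
    ext1 x; rw [← dilationL_apply]; rfl
  rw [e, Measure.volume_eq_prod, ← Measure.map_prod_map _ _ (by fun_prop) (by fun_prop),
    Measure.map_addHaar_smul _ hr.ne', Measure.map_addHaar_smul _ (by positivity : r ^ 2 ≠ 0)]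
  rw [Measure.prod_smul_left, Measure.prod_smul_right, smul_smul]
  congr 1
  rw [← ENNReal.ofReal_mul (by positivity)]
  congr 1
  have : Module.finrank ℝ (Fin n → ℂ) = 2 * n := by
    simp [Module.finrank_pi_fintype, Complex.finrank_real_complex, mul_comm]
  rw [this, Module.finrank_self, abs_of_pos (by positivity), abs_of_pos (by positivity),
    Real.rpow_neg hr.le, homDim]
  rw [show (2 * (n : ℝ) + 2) = ((2 * n + 2 : ℕ) : ℝ) by push_cast; ring, Real.rpow_natCast,
    ← mul_inv]
  congr 1
  ring

theorem lintegral_dilation {r : ℝ} (hr : 0 < r) (f : Heis n → ENNReal) :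
    ∫⁻ x, f (dilation r x) = ENNReal.ofReal (r ^ (-homDim n)) * ∫⁻ x, f x := by
  have h := lintegral_map_equiv (μ := volume) f (dilationHomeo n hr).toMeasurableEquiv
  have h2 : Measure.map (⇑(dilationHomeo n hr).toMeasurableEquiv) (volume : Measure (Heis n)) =
    Measure.map (dilation r) volume := rfl
  rw [h2, map_dilation_volume hr, lintegral_smul_measure] at h
  exact h.symm

theorem integral_dilation {r : ℝ} (hr : 0 < r) (f : Heis n → ℝ) :
    ∫ x, f (dilation r x) = r ^ (-homDim n) * ∫ x, f x := by
  have h := (dilationHomeo n hr).toMeasurableEquiv.measurableEmbedding.integral_map (μ := volume) f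
  have h2 : Measure.map (⇑(dilationHomeo n hr).toMeasurableEquiv) (volume : Measure (Heis n)) =
    Measure.map (dilation r) volume := rfl
  rw [h2, map_dilation_volume hr, integral_smul_measure,
    ENNReal.toReal_ofReal (by positivity)] at h
  exact h.symm

/-! ### Integration by parts and weak derivatives -/

instance instNullSingletonClassHeis : NullSingletonClass (volume : Measure (Heis n)) :=
  Measure.prod.instNullSingletonClass_snd

instance instIsAddHaarMeasureHeis : Measure.IsAddHaarMeasure (volume : Measure (Heis n)) :=
  Measure.prod.instIsAddHaarMeasure _ _

theorem ae_ne_zero : ∀ᵐ x : Heis n, x ≠ 0 := by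
  have : ({0}ᶜ : Set (Heis n)) ∈ ae volume := by
    rw [mem_ae_iff, compl_compl]; exact measure_singleton 0
  exact this

theorem isOpen_punctured : IsOpen ({0}ᶜ : Set (Heis n)) := isOpen_compl_singleton

theorem hDeriv_dilation {f : Heis n → ℝ} {r : ℝ} {x : Heis n}
    (hf : DifferentiableAt ℝ f (dilation r x)) (j : Fin n ⊕ Fin n) :
    hDeriv j (fun y => f (dilation r y)) x = r * hDeriv j f (dilation r x) := by
  have h1 : HasFDerivAt (fun y : Heis n => dilation r y) (dilationL n r) x := by
    have : (fun y : Heis n => dilation r y) = dilationL n r := by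
      ext1 y; exact (dilationL_apply r y).symm
    rw [this]; exact (dilationL n r).hasFDerivAt
  have h2 := hf.hasFDerivAt.comp x h1
  have h3 : fderiv ℝ (fun y => f (dilation r y)) x = _ := h2.fderiv
  rw [hDeriv, h3, ContinuousLinearMap.comp_apply, dilation_frame, map_smul, smul_eq_mul, hDeriv]

theorem hDeriv_mul {f g : Heis n → ℝ} {x : Heis n} (hf : DifferentiableAt ℝ f x)
    (hg : DifferentiableAt ℝ g x) (j : Fin n ⊕ Fin n) :
    hDeriv j (fun y => f y * g y) x = f x * hDeriv j g x + g x * hDeriv j f x := by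
  have h : fderiv ℝ (fun y => f y * g y) x = _ := fderiv_mul hf hg
  simp [hDeriv, h]

theorem contDiffOn_hDeriv {f : Heis n → ℝ} {m k : WithTop ℕ∞} (hf : ContDiffOn ℝ k f {0}ᶜ)
    (hmk : m + 1 ≤ k) (j : Fin n ⊕ Fin n) : ContDiffOn ℝ m (hDeriv j f) {0}ᶜ := by
  have h1 : ContDiffOn ℝ m (fderiv ℝ f) {0}ᶜ := hf.fderiv_of_isOpen isOpen_punctured hmk
  refine h1.clm_apply (ContDiff.contDiffOn ?_)
  cases j with
  | inl α =>
    show ContDiff ℝ m fun p : Heis n => ((Pi.single α 1, 2 * (p.1 α).im) : Heis n)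
    refine contDiff_const.prodMk (contDiff_const.mul ?_)
    exact Complex.imCLM.contDiff.comp ((contDiff_apply ℝ ℂ α).comp contDiff_fst)
  | inr α =>
    show ContDiff ℝ m fun p : Heis n => ((Pi.single α Complex.I, -2 * (p.1 α).re) : Heis n)
    refine contDiff_const.prodMk (contDiff_const.mul ?_)
    exact Complex.reCLM.contDiff.comp ((contDiff_apply ℝ ℂ α).comp contDiff_fst)

theorem continuous_hDeriv {F : Heis n → ℝ} (hF : ContDiff ℝ 1 F) (j : Fin n ⊕ Fin n) :
    Continuous (hDeriv j F) :=
  (hF.continuous_fderiv (by simp)).clm_apply (continuous_frame j)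

/-- Horizontal fields are divergence free. -/
theorem integral_hDeriv_eq_zero {F : Heis n → ℝ} (hF : ContDiff ℝ 1 F) (hc : HasCompactSupport F)
    (j : Fin n ⊕ Fin n) : ∫ x, hDeriv j F x = 0 := by
  -- The field is `e + c ∂_t`, where `e` and `∂_t` have constant coefficients and `∂_t c = 0`.
  obtain ⟨e, c, hcd, hct, hfr⟩ : ∃ (e : Heis n) (c : Heis n → ℝ), ContDiff ℝ 1 c ∧
      (∀ x, HasLineDerivAt ℝ c 0 x ((0, 1) : Heis n)) ∧
      ∀ x, frame j x = e + c x • ((0, 1) : Heis n) := by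
    cases j with
    | inl α =>
      refine ⟨(Pi.single α 1, 0), fun x => 2 * (x.1 α).im, contDiff_const.mul
        (Complex.imCLM.contDiff.comp ((contDiff_apply ℝ ℂ α).comp contDiff_fst)), fun x => ?_,
        fun x => ?_⟩
      · simp [HasLineDerivAt, hasDerivAt_const]
      · refine Prod.ext ?_ ?_ <;> simp [frame]
    | inr α =>
      refine ⟨(Pi.single α Complex.I, 0), fun x => -2 * (x.1 α).re, contDiff_const.mul
        (Complex.reCLM.contDiff.comp ((contDiff_apply ℝ ℂ α).comp contDiff_fst)), fun x => ?_,
        fun x => ?_⟩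
      · simp [HasLineDerivAt, hasDerivAt_const]
      · refine Prod.ext ?_ ?_ <;> simp [frame]
  have hcont : ∀ v : Heis n, Continuous fun x => fderiv ℝ F x v := fun v =>
    (hF.continuous_fderiv (by simp)).clm_apply continuous_const
  have hsupp : ∀ v : Heis n, HasCompactSupport fun x => fderiv ℝ F x v := fun v =>
    (hc.fderiv ℝ).comp_left (g := fun L : Heis n →L[ℝ] ℝ => L v) (by simp)
  have hline : ∀ (v x : Heis n), HasLineDerivAt ℝ F (fderiv ℝ F x v) x v := fun v x =>
    ((hF.differentiable (by simp)) x).hasFDerivAt.hasLineDerivAt v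
  have key : ∀ (v : Heis n) (f : Heis n → ℝ), ContDiff ℝ 1 f →
      (∀ x, HasLineDerivAt ℝ f 0 x v) → ∫ x, f x * fderiv ℝ F x v = 0 := by
    intro v f hf hfl
    have h := integral_bilinear_hasLineDerivAt_right_eq_neg_left_of_integrable
      (μ := (volume : Measure (Heis n))) (f := f) (f' := fun _ => (0:ℝ)) (g := F)
      (g' := fun x => fderiv ℝ F x v) (v := v) (B := ContinuousLinearMap.mul ℝ ℝ)
      (by simp) ?_ ?_ (fun x _ => hfl x) (fun x _ => hline v x)
    · simpa using h
    · exact (hf.continuous.mul (hcont v)).integrable_of_hasCompactSupport ((hsupp v).mul_left)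
    · exact (hf.continuous.mul hF.continuous).integrable_of_hasCompactSupport (hc.mul_left)
  have h1 := key e (fun _ => 1) contDiff_const
    (fun x => by simp [HasLineDerivAt, hasDerivAt_const])
  have h2 := key (0, 1) c hcd hct
  have hsum : ∀ x, hDeriv j F x = 1 * fderiv ℝ F x e + c x * fderiv ℝ F x (0, 1) := by
    intro x
    rw [hDeriv, hfr, map_add, map_smul, smul_eq_mul, one_mul]
  simp_rw [hsum]
  rw [integral_add, h1, h2, add_zero]
  · exact (continuous_const.mul (hcont e)).integrable_of_hasCompactSupport ((hsupp e).mul_left)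
  · exact (hcd.continuous.mul (hcont _)).integrable_of_hasCompactSupport ((hsupp _).mul_left)

/-- A `C¹` function on the punctured group times a test function extends by zero to a `C¹`
function. -/
theorem contDiff_mul_of_tsupport_subset {f φ : Heis n → ℝ} (hf : ContDiffOn ℝ 1 f {0}ᶜ)
    (hφ : ContDiff ℝ 1 φ) (h0 : tsupport φ ⊆ {0}ᶜ) : ContDiff ℝ 1 fun x => f x * φ x := by
  refine contDiff_iff_contDiffAt.2 fun x => ?_
  by_cases hx : x ∈ tsupport φ
  · exact (hf.contDiffAt (isOpen_punctured.mem_nhds (h0 hx))).mul hφ.contDiffAt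
  · refine (contDiffAt_const (c := (0:ℝ))).congr_of_eventuallyEq ?_
    filter_upwards [(isClosed_tsupport φ).isOpen_compl.mem_nhds hx] with y hy
    rw [image_eq_zero_of_notMem_tsupport hy, mul_zero]

theorem memLp_restrict_of_continuousOn {f : Heis n → ℝ} (hf : ContinuousOn f {0}ᶜ) (q : ENNReal)
    {K : Set (Heis n)} (hK : IsCompact K) (hK0 : K ⊆ {0}ᶜ) : MemLp f q (volume.restrict K) := by
  have h1 := hf.mono hK0
  obtain ⟨C, hC⟩ := hK.exists_bound_of_continuousOn h1
  have : IsFiniteMeasure (volume.restrict K : Measure (Heis n)) :=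
    ⟨by rw [Measure.restrict_apply_univ]; exact hK.measure_lt_top⟩
  refine MemLp.of_bound (h1.aestronglyMeasurable hK.measurableSet) C ?_
  exact (ae_restrict_iff' hK.measurableSet).2 (Eventually.of_forall hC)

theorem memL2Loc_of_continuousOn {f : Heis n → ℝ} (hf : ContinuousOn f {0}ᶜ) : MemL2Loc f :=
  fun _ hK hK0 => memLp_restrict_of_continuousOn hf 2 hK hK0

/-- Integration by parts on the punctured group. -/
theorem integral_mul_hDeriv_eq_neg {f φ : Heis n → ℝ} (hf : ContDiffOn ℝ 1 f {0}ᶜ)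
    (hφ : ContDiff ℝ 1 φ) (hc : HasCompactSupport φ) (h0 : tsupport φ ⊆ {0}ᶜ)
    (j : Fin n ⊕ Fin n) : ∫ x, f x * hDeriv j φ x = -∫ x, hDeriv j f x * φ x := by
  have hF := contDiff_mul_of_tsupport_subset hf hφ h0
  have h1 := integral_hDeriv_eq_zero hF hc.mul_left j
  have h2 : ∫ x, hDeriv j (fun x => f x * φ x) x =
      ∫ x, (f x * hDeriv j φ x + hDeriv j f x * φ x) := by
    refine integral_congr_ae ?_
    filter_upwards [ae_ne_zero] with x hx
    rw [hDeriv_mul ((hf.differentiableOn (by simp)).differentiableAt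
      (isOpen_punctured.mem_nhds hx)) (hφ.differentiable (by simp) x)]
    ring
  have i1 : Integrable fun x => f x * hDeriv j φ x :=
    (memL2Loc_of_continuousOn hf.continuousOn).integrable_mul (continuous_hDeriv hφ j)
      (hc.of_isClosed_subset (isClosed_tsupport _) (tsupport_hDeriv_subset j φ))
      ((tsupport_hDeriv_subset j φ).trans h0)
  have i2 : Integrable fun x => hDeriv j f x * φ x :=
    (memL2Loc_of_continuousOn (contDiffOn_hDeriv (m := 0) hf (by simp) j).continuousOn).integrable_mul
      hφ.continuous hc h0
  rw [h2, integral_add i1 i2] at h1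
  linarith

/-- A `C¹` function has its classical derivatives as weak derivatives. -/
theorem memS1Loc_of_contDiffOn {f : Heis n → ℝ} (hf : ContDiffOn ℝ 1 f {0}ᶜ) : MemS1Loc f :=
  ⟨memL2Loc_of_continuousOn hf.continuousOn, fun j => ⟨hDeriv j f,
    memL2Loc_of_continuousOn (contDiffOn_hDeriv (m := 0) hf (by simp) j).continuousOn,
    fun _ h1 h2 h3 => integral_mul_hDeriv_eq_neg hf (h1.of_le (by simp)) h2 h3 j⟩⟩

theorem MemL2Loc.locallyIntegrableOn {f : Heis n → ℝ} (hf : MemL2Loc f) :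
    LocallyIntegrableOn f {0}ᶜ := by
  refine (locallyIntegrableOn_iff isOpen_punctured.isLocallyClosed).2 fun K hK0 hK => ?_
  have : IsFiniteMeasure (volume.restrict K : Measure (Heis n)) :=
    ⟨by rw [Measure.restrict_apply_univ]; exact hK.measure_lt_top⟩
  exact (hf K hK hK0).integrable (by norm_num)

theorem MemL2Loc.aestronglyMeasurable {f : Heis n → ℝ} (hf : MemL2Loc f) :
    AEStronglyMeasurable f volume := by
  have h := hf.locallyIntegrableOn.aestronglyMeasurable
  rwa [Measure.restrict_eq_self_of_ae_mem] at h
  exact ae_ne_zero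

theorem MemL2Loc.sub {f g : Heis n → ℝ} (hf : MemL2Loc f) (hg : MemL2Loc g) :
    MemL2Loc (fun x => f x - g x) := fun K h1 h2 => (hf K h1 h2).sub (hg K h1 h2)

/-- Weak derivatives are unique up to null sets. -/
theorem IsWeakDeriv.ae_eq {u g g' : Heis n → ℝ} {j : Fin n ⊕ Fin n} (hg : MemL2Loc g)
    (hg' : MemL2Loc g') (h : IsWeakDeriv j u g) (h' : IsWeakDeriv j u g') : g =ᵐ[volume] g' := by
  have key := isOpen_punctured.ae_eq_zero_of_integral_contDiff_smul_eq_zero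
    (hg.sub hg').locallyIntegrableOn (fun φ h1 h2 h3 => by
      have e1 := h φ h1 h2 h3
      have e2 := h' φ h1 h2 h3
      have e3 := integral_sub (hg.integrable_mul h1.continuous h2 h3)
        (hg'.integrable_mul h1.continuous h2 h3)
      have : ∀ x, φ x • (g x - g' x) = g x * φ x - g' x * φ x := fun x => by
        rw [smul_eq_mul]; ring
      simp_rw [this]
      rw [e3]; linarith)
  filter_upwards [key, ae_ne_zero] with x h1 h2
  exact sub_eq_zero.1 (h1 h2)

theorem MemS1Loc.weakDeriv_spec {u : Heis n → ℝ} (hu : MemS1Loc u) (j : Fin n ⊕ Fin n) :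
    MemL2Loc (weakDeriv j u) ∧ IsWeakDeriv j u (weakDeriv j u) := by
  have h := hu.2 j
  rw [weakDeriv, dif_pos h]
  exact h.choose_spec

theorem MemS1Loc.weakDeriv_ae_eq {u g : Heis n → ℝ} (hu : MemS1Loc u) {j : Fin n ⊕ Fin n}
    (hg : MemL2Loc g) (h : IsWeakDeriv j u g) : weakDeriv j u =ᵐ[volume] g :=
  IsWeakDeriv.ae_eq (hu.weakDeriv_spec j).1 hg (hu.weakDeriv_spec j).2 h

theorem weakDeriv_ae_eq_hDeriv {f : Heis n → ℝ} (hf : ContDiffOn ℝ 1 f {0}ᶜ)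
    (j : Fin n ⊕ Fin n) : weakDeriv j f =ᵐ[volume] hDeriv j f :=
  (memS1Loc_of_contDiffOn hf).weakDeriv_ae_eq
    (memL2Loc_of_continuousOn (contDiffOn_hDeriv (m := 0) hf (by simp) j).continuousOn)
    fun _ h1 h2 h3 => integral_mul_hDeriv_eq_neg hf (h1.of_le (by simp)) h2 h3 j

theorem weakDeriv_add_smul {u v : Heis n → ℝ} (hu : MemS1Loc u) (hv : MemS1Loc v) (s : ℝ)
    (j : Fin n ⊕ Fin n) :
    weakDeriv j (u + s • v) =ᵐ[volume] fun x => weakDeriv j u x + s * weakDeriv j v x := by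
  obtain ⟨a1, a2⟩ := hu.weakDeriv_spec j
  obtain ⟨b1, b2⟩ := hv.weakDeriv_spec j
  have hm : MemL2Loc fun x => weakDeriv j u x + s * weakDeriv j v x := fun K h1 h2 =>
    (a1 K h1 h2).add ((b1 K h1 h2).const_smul s)
  have hw : IsWeakDeriv j (u + s • v) fun x => weakDeriv j u x + s * weakDeriv j v x := by
    intro φ h1 h2 h3
    have e1 := integral_add (hu.1.integrable_mul_hDeriv j h1 h2 h3)
      ((hv.1.integrable_mul_hDeriv j h1 h2 h3).const_mul s)
    have e2 := integral_add (a1.integrable_mul h1.continuous h2 h3)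
      ((b1.integrable_mul h1.continuous h2 h3).const_mul s)
    simp only [Pi.add_apply, Pi.smul_apply, smul_eq_mul, add_mul, mul_assoc]
    rw [e1, e2, integral_const_mul, integral_const_mul, a2 φ h1 h2 h3, b2 φ h1 h2 h3]
    ring
  have hex : ∃ g, MemL2Loc g ∧ IsWeakDeriv j (u + s • v) g := ⟨_, hm, hw⟩
  have hs : MemL2Loc (weakDeriv j (u + s • v)) ∧
      IsWeakDeriv j (u + s • v) (weakDeriv j (u + s • v)) := by
    rw [weakDeriv, dif_pos hex]; exact hex.choose_spec
  exact IsWeakDeriv.ae_eq hs.1 hm hs.2 hw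

/-- The weak derivative of a periodic function is periodic, with one more power of `T`. -/
theorem weakDeriv_dilation {T : ℝ} (hT : 0 < T) {u : Heis n → ℝ} (hu : u ∈ periodicSpace n T)
    (j : Fin n ⊕ Fin n) : ∀ᵐ x, weakDeriv j u (dilation T x) =
      T ^ (-((homDim n - 2) / 2)) * T⁻¹ * weakDeriv j u x := by
  obtain ⟨hS, hp⟩ := hu
  obtain ⟨g1, g2⟩ := hS.weakDeriv_spec j
  set g := weakDeriv j u with hg
  set c := T ^ (-((homDim n - 2) / 2)) with hcdef
  have hc0 : c ≠ 0 := (Real.rpow_pos_of_pos hT _).ne'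
  -- `c⁻¹ T (g ∘ δ_T)` is a weak derivative of `c⁻¹ (u ∘ δ_T) = u`.
  have hm : MemL2Loc fun x => c⁻¹ * T * g (dilation T x) := by
    intro K hK hK0
    refine MemLp.const_mul ?_ _
    have hK' : IsCompact (dilation T '' K) := hK.image (contDiff_dilation T).continuous
    have hK0' : dilation T '' K ⊆ {0}ᶜ := by
      rintro _ ⟨x, hx, rfl⟩
      exact dilation_ne_zero hT (hK0 hx)
    have h1 := g1 _ hK' hK0'
    have hpre : dilation T ⁻¹' (dilation T '' K) = K :=
      Set.preimage_image_eq K (dilationHomeo n hT).injective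
    have h2 : Measure.map (dilation T) (volume.restrict K) =
        ENNReal.ofReal (T ^ (-homDim n)) • volume.restrict (dilation T '' K) := by
      have := Measure.restrict_map (μ := (volume : Measure (Heis n)))
        (contDiff_dilation T).continuous.measurable hK'.measurableSet
      rw [hpre, map_dilation_volume hT, Measure.restrict_smul] at this
      exact this.symm
    have h3 : MemLp g 2 (Measure.map (dilation T) (volume.restrict K)) := by
      rw [h2]; exact h1.smul_measure ENNReal.ofReal_ne_top
    exact h3.comp_of_map (contDiff_dilation T).continuous.aemeasurable
  have hw : IsWeakDeriv j u fun x => c⁻¹ * T * g (dilation T x) := by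
    intro φ h1 h2 h3
    set ψ : Heis n → ℝ := fun y => φ (dilation T⁻¹ y) with hψ
    have hTi : 0 < T⁻¹ := inv_pos.2 hT
    have hψ1 : ContDiff ℝ ∞ ψ := h1.comp (contDiff_dilation _)
    have hψ2 : HasCompactSupport ψ := h2.comp_homeomorph (dilationHomeo n hTi)
    have hψ3 : tsupport ψ ⊆ {0}ᶜ := by
      have : tsupport ψ = (dilationHomeo n hTi) ⁻¹' tsupport φ :=
        tsupport_comp_eq_preimage φ (dilationHomeo n hTi)
      rw [this]
      rintro x hx (rfl : x = 0)
      have h4 : dilation T⁻¹ (0 : Heis n) = 0 := by rw [← dilationL_apply, map_zero]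
      exact h3 hx h4
    have e := g2 ψ hψ1 hψ2 hψ3
    have hd : ∀ x, hDeriv j φ x = T * hDeriv j ψ (dilation T x) := by
      intro x
      have h5 := hDeriv_dilation (f := ψ) (r := T) (x := x)
        (hψ1.differentiable (by simp) _) j
      rw [← h5]
      congr 1
      ext y
      simp [hψ, dilation_inv_cancel hT]
    have hφψ : ∀ x, φ x = ψ (dilation T x) := fun x => by simp [hψ, dilation_inv_cancel hT]
    have l1 : ∫ x, u x * hDeriv j φ x =
        ∫ x, c⁻¹ * T * (u (dilation T x) * hDeriv j ψ (dilation T x)) := by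
      refine integral_congr_ae ?_
      filter_upwards [hp] with x hx
      rw [hx, hd]
      field_simp
    have l2 : ∫ x, c⁻¹ * T * g (dilation T x) * φ x =
        ∫ x, c⁻¹ * T * (g (dilation T x) * ψ (dilation T x)) := by
      refine integral_congr_ae (Eventually.of_forall fun x => ?_)
      simp only [hφψ x]; ring
    rw [l1, l2, integral_const_mul, integral_const_mul,
      integral_dilation hT (fun x => u x * hDeriv j ψ x),
      integral_dilation hT (fun x => g x * ψ x), e]
    ring
  filter_upwards [hS.weakDeriv_ae_eq hm hw] with x hx
  rw [← hg] at hx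
  rw [hx]
  field_simp

/-- The weak derivative along the horizontal field of direction `w`. -/
def weakDir (w : Fin n → ℂ) (u : Heis n → ℝ) (x : Heis n) : ℝ :=
  ∑ α, ((w α).re * weakDeriv (Sum.inl α) u x + (w α).im * weakDeriv (Sum.inr α) u x)

theorem MemS1Loc.memL2Loc_weakDir {u : Heis n → ℝ} (hu : MemS1Loc u) (w : Fin n → ℂ) :
    MemL2Loc (weakDir w u) := fun K h1 h2 =>
  memLp_finsetSum _ fun α _ =>
    (((hu.weakDeriv_spec (Sum.inl α)).1 K h1 h2).const_mul _).add
      (((hu.weakDeriv_spec (Sum.inr α)).1 K h1 h2).const_mul _)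

/-- The defining identity of the weak derivative in the horizontal direction `w`. -/
theorem MemS1Loc.integral_hDir {u : Heis n → ℝ} (hu : MemS1Loc u) (w : Fin n → ℂ) {φ : Heis n → ℝ}
    (h1 : ContDiff ℝ ∞ φ) (h2 : HasCompactSupport φ) (h3 : tsupport φ ⊆ {0}ᶜ) :
    ∫ x, u x * fderiv ℝ φ x (hDir w x) = -∫ x, weakDir w u x * φ x := by
  have hi : ∀ j, Integrable fun x => u x * hDeriv j φ x :=
    fun j => hu.1.integrable_mul_hDeriv j h1 h2 h3
  have hg : ∀ j, Integrable fun x => weakDeriv j u x * φ x :=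
    fun j => (hu.weakDeriv_spec j).1.integrable_mul h1.continuous h2 h3
  have e1 : ∀ x, u x * fderiv ℝ φ x (hDir w x) = ∑ α, ((w α).re * (u x * hDeriv (Sum.inl α) φ x) +
      (w α).im * (u x * hDeriv (Sum.inr α) φ x)) := by
    intro x
    rw [hDir_eq_sum_frame, map_sum, Finset.mul_sum]
    refine Finset.sum_congr rfl fun α _ => ?_
    rw [map_add, map_smul, map_smul, smul_eq_mul, smul_eq_mul, hDeriv, hDeriv]; ring
  have e2 : ∀ x, weakDir w u x * φ x = ∑ α, ((w α).re * (weakDeriv (Sum.inl α) u x * φ x) +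
      (w α).im * (weakDeriv (Sum.inr α) u x * φ x)) := by
    intro x
    rw [weakDir, Finset.sum_mul]
    refine Finset.sum_congr rfl fun α _ => ?_
    ring
  simp_rw [e1, e2]
  have s1 : ∀ α ∈ Finset.univ, Integrable (fun x => (w α).re * (u x * hDeriv (Sum.inl α) φ x) +
      (w α).im * (u x * hDeriv (Sum.inr α) φ x)) := fun α _ =>
    ((hi _).const_mul _).add ((hi _).const_mul _)
  have s2 : ∀ α ∈ Finset.univ, Integrable (fun x => (w α).re * (weakDeriv (Sum.inl α) u x * φ x) +
      (w α).im * (weakDeriv (Sum.inr α) u x * φ x)) := fun α _ =>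
    ((hg _).const_mul _).add ((hg _).const_mul _)
  rw [integral_finsetSum _ s1, integral_finsetSum _ s2, ← Finset.sum_neg_distrib]
  refine Finset.sum_congr rfl fun α _ => ?_
  rw [integral_add ((hi _).const_mul _) ((hi _).const_mul _),
    integral_add ((hg _).const_mul _) ((hg _).const_mul _), integral_const_mul, integral_const_mul,
    integral_const_mul, integral_const_mul, (hu.weakDeriv_spec _).2 φ h1 h2 h3,
    (hu.weakDeriv_spec _).2 φ h1 h2 h3]
  ring

/-! ### Right translations of functions with weak horizontal derivatives -/

/-- The Cauchy-Schwarz inequality against the constant function `1`. -/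
theorem sq_lintegral_le {X : Type*} [MeasurableSpace X] (ν : Measure X) {f : X → ENNReal}
    (hf : AEMeasurable f ν) : (∫⁻ x, f x ∂ν) ^ 2 ≤ ν Set.univ * ∫⁻ x, f x ^ 2 ∂ν := by
  have h := ENNReal.lintegral_mul_le_Lp_mul_Lq ν Real.HolderConjugate.two_two
    (f := fun _ => 1) (g := f) aemeasurable_const hf
  simp only [Pi.mul_apply, one_mul, one_pow, lintegral_const, ENNReal.rpow_two] at h
  calc (∫⁻ x, f x ∂ν) ^ 2 ≤ (ν Set.univ ^ (1 / 2 : ℝ) * (∫⁻ x, f x ^ 2 ∂ν) ^ (1 / 2 : ℝ)) ^ 2 :=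
        pow_le_pow_left' h 2
    _ = _ := by
        rw [mul_pow, ← ENNReal.rpow_natCast, ← ENNReal.rpow_natCast, ← ENNReal.rpow_mul,
          ← ENNReal.rpow_mul]
        norm_num

/-- The horizontal element `(τ w, 0)` of the group. -/
def horiz (w : Fin n → ℂ) (τ : ℝ) : Heis n := (τ • w, 0)

theorem hmul_horiz (x : Heis n) (w : Fin n → ℂ) (τ : ℝ) :
    hmul x (horiz w τ) = x + τ • hDir w x := hmul_horizontal x w τ

theorem hmul_horiz_hmul_horiz (x : Heis n) (w : Fin n → ℂ) (σ τ : ℝ) :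
    hmul (hmul x (horiz w σ)) (horiz w τ) = hmul x (horiz w (σ + τ)) := by
  have h := hDir_hmul_horizontal x w σ
  rw [hmul_horiz (hmul x (horiz w σ)), horiz, h, ← horiz, hmul_horiz, hmul_horiz, add_smul, add_assoc]

@[simp] theorem horiz_zero (w : Fin n → ℂ) : horiz w 0 = 0 := by simp [horiz]

theorem hmul_horiz_cancel (x : Heis n) (w : Fin n → ℂ) (τ : ℝ) :
    hmul (hmul x (horiz w τ)) (horiz w (-τ)) = x := by
  rw [hmul_horiz_hmul_horiz]; simp

theorem hmul_horiz_cancel' (x : Heis n) (w : Fin n → ℂ) (τ : ℝ) :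
    hmul (hmul x (horiz w (-τ))) (horiz w τ) = x := by
  rw [hmul_horiz_hmul_horiz]; simp

theorem continuous_horiz (w : Fin n → ℂ) : Continuous (horiz w) := by
  unfold horiz; fun_prop

theorem contDiff_hDir (w : Fin n → ℂ) : ContDiff ℝ ∞ (hDir w : Heis n → Heis n) := by
  unfold hDir
  refine contDiff_const.prodMk (contDiff_const.mul (Complex.imCLM.contDiff.comp ?_))
  exact ContDiff.sum fun α _ => ((contDiff_apply ℝ ℂ α).comp contDiff_fst).mul contDiff_const

theorem contDiff_hmul_horiz (w : Fin n → ℂ) (τ : ℝ) :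
    ContDiff ℝ ∞ fun x : Heis n => hmul x (horiz w τ) := by
  simp_rw [hmul_horiz]
  exact contDiff_id.add ((contDiff_hDir w).const_smul τ)

/-- Right translation as a homeomorphism. -/
def hmulRightHomeo (v : Heis n) : Heis n ≃ₜ Heis n where
  toFun x := hmul x v
  invFun x := hmul x (-v)
  left_inv x := by simp only; rw [hmul_assoc, hmul_neg_self, hmul_zero]
  right_inv x := by simp only; rw [hmul_assoc, neg_hmul_self, hmul_zero]
  continuous_toFun := continuous_hmul.comp (continuous_id.prodMk continuous_const)
  continuous_invFun := continuous_hmul.comp (continuous_id.prodMk continuous_const)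

theorem integral_hmul_right (v : Heis n) (f : Heis n → ℝ) : ∫ x, f (hmul x v) = ∫ x, f x :=
  (measurePreserving_hmul_right v).integral_comp
    (hmulRightHomeo v).toMeasurableEquiv.measurableEmbedding f

theorem lintegral_hmul_right (v : Heis n) (f : Heis n → ENNReal) :
    ∫⁻ x, f (hmul x v) = ∫⁻ x, f x :=
  (measurePreserving_hmul_right v).lintegral_comp_emb
    (hmulRightHomeo v).toMeasurableEquiv.measurableEmbedding f

theorem hasDerivAt_comp_hmul_horiz {φ : Heis n → ℝ} (hφ : Differentiable ℝ φ) (w : Fin n → ℂ)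
    (x : Heis n) (τ : ℝ) : HasDerivAt (fun τ => φ (hmul x (horiz w τ)))
      (fderiv ℝ φ (hmul x (horiz w τ)) (hDir w (hmul x (horiz w τ)))) τ := by
  have h1 : HasDerivAt (fun τ : ℝ => hmul x (horiz w τ)) (hDir w x) τ := by
    simp_rw [hmul_horiz]
    simpa using ((hasDerivAt_id τ).smul_const (hDir w x)).const_add x
  have h2 := (hφ (hmul x (horiz w τ))).hasFDerivAt.comp_hasDerivAt τ h1
  have h3 : hDir w (hmul x (horiz w τ)) = hDir w x := hDir_hmul_horizontal x w τ
  rw [h3]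
  exact h2

/-- Left invariance of the horizontal fields in the direction of their own flow. -/
theorem fderiv_comp_hmul_horiz {φ : Heis n → ℝ} (hφ : ContDiff ℝ ∞ φ) (w : Fin n → ℂ)
    (x : Heis n) (τ : ℝ) : fderiv ℝ (fun y => φ (hmul y (horiz w τ))) x (hDir w x) =
      fderiv ℝ φ (hmul x (horiz w τ)) (hDir w (hmul x (horiz w τ))) := by
  have hψ : Differentiable ℝ fun y => φ (hmul y (horiz w τ)) :=
    (hφ.comp (contDiff_hmul_horiz w τ)).differentiable (by simp)
  have h1 := hasDerivAt_comp_hmul_horiz hψ w x 0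
  have h2 := hasDerivAt_comp_hmul_horiz (hφ.differentiable (by simp)) w (hmul x (horiz w τ)) 0
  have e : (fun σ => φ (hmul (hmul x (horiz w σ)) (horiz w τ))) =
      fun σ => φ (hmul (hmul x (horiz w τ)) (horiz w σ)) := by
    ext σ; rw [hmul_horiz_hmul_horiz, hmul_horiz_hmul_horiz, add_comm]
  rw [e] at h1
  have := h1.unique h2
  simpa using this

/-- Flowing each point along `w` for the time recorded in the first coordinate preserves the product
measure; this gives joint measurability and integrability along the flow. -/
theorem measurePreserving_flow (w : Fin n → ℂ) (ν : Measure ℝ) [SFinite ν] :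
    MeasurePreserving (fun p : ℝ × Heis n => (p.1, hmul p.2 (horiz w p.1)))
      (ν.prod volume) (ν.prod volume) :=
  (MeasurePreserving.id ν).skew_product (g := fun τ x => hmul x (horiz w τ))
    (continuous_hmul.comp
      (continuous_snd.prodMk ((continuous_horiz w).comp continuous_fst))).measurable
    (Eventually.of_forall fun τ => (measurePreserving_hmul_right (horiz w τ)).map_eq)

/-- Points from which the flow of the horizontal direction `w` does not reach the origin for
times in `[0, 1]`. -/
def flowDomain (w : Fin n → ℂ) : Set (Heis n) := ((fun τ => horiz w (-τ)) '' Set.Icc 0 1)ᶜ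

theorem isOpen_flowDomain (w : Fin n → ℂ) : IsOpen (flowDomain w) :=
  (isCompact_Icc.image ((continuous_horiz w).comp continuous_neg)).isClosed.isOpen_compl

theorem mem_flowDomain {w : Fin n → ℂ} {x : Heis n} :
    x ∈ flowDomain w ↔ ∀ τ ∈ Set.Icc (0 : ℝ) 1, hmul x (horiz w τ) ≠ 0 := by
  constructor
  · intro h τ hτ h0
    refine h ⟨τ, hτ, ?_⟩
    simp only
    rw [← hmul_horiz_cancel x w τ, h0, zero_hmul]
  · rintro h ⟨τ, hτ, rfl⟩
    refine h τ hτ ?_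
    have := hmul_horiz_cancel' 0 w τ
    simpa using this

/-- The set swept out by `K` under the flow of the direction `w` in times `[0, 1]`. -/
def sweep (w : Fin n → ℂ) (K : Set (Heis n)) : Set (Heis n) :=
  (fun p : ℝ × Heis n => hmul p.2 (horiz w p.1)) '' (Set.Icc 0 1 ×ˢ K)

theorem isCompact_sweep (w : Fin n → ℂ) {K : Set (Heis n)} (hK : IsCompact K) :
    IsCompact (sweep w K) :=
  (isCompact_Icc.prod hK).image (continuous_hmul.comp
      (continuous_snd.prodMk ((continuous_horiz w).comp continuous_fst)))

theorem mem_sweep {w : Fin n → ℂ} {K : Set (Heis n)} {τ : ℝ} (hτ : τ ∈ Set.Icc (0 : ℝ) 1)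
    {x : Heis n} (hx : x ∈ K) : hmul x (horiz w τ) ∈ sweep w K := ⟨(τ, x), ⟨hτ, hx⟩, rfl⟩

theorem sweep_subset {w : Fin n → ℂ} {K : Set (Heis n)} (hK : K ⊆ flowDomain w) :
    sweep w K ⊆ {0}ᶜ := by
  rintro _ ⟨⟨τ, x⟩, ⟨hτ, hx⟩, rfl⟩
  exact mem_flowDomain.1 (hK hx) τ hτ

theorem integrable_prod_of_bounded {f : Heis n → ℝ} (hf : MemL2Loc f) {K : Set (Heis n)}
    (hK : IsCompact K) (hK0 : K ⊆ {0}ᶜ) {H : ℝ × Heis n → ℝ} {ν : Measure ℝ} [IsFiniteMeasure ν]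
    (hH : AEStronglyMeasurable H (ν.prod volume)) {C : ℝ}
    (hC : ∀ᵐ p ∂(ν.prod volume), ‖H p‖ ≤ C) (hHK : ∀ᵐ p ∂(ν.prod volume), p.2 ∉ K → H p = 0) :
    Integrable (fun p : ℝ × Heis n => f p.2 * H p) (ν.prod volume) := by
  have h1 : IntegrableOn f K volume :=
    (locallyIntegrableOn_iff isOpen_punctured.isLocallyClosed).1 hf.locallyIntegrableOn K hK0 hK
  have h2 : Integrable (fun p : ℝ × Heis n => C * K.indicator f p.2) (ν.prod volume) :=
    (((integrable_indicator_iff hK.measurableSet).2 h1).comp_snd ν).const_mul C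
  refine h2.mono ((hf.aestronglyMeasurable.comp_snd).mul hH) ?_
  filter_upwards [hC, hHK] with p hp1 hp2
  by_cases hp : p.2 ∈ K
  · rw [Set.indicator_of_mem hp, norm_mul, norm_mul, mul_comm]
    exact mul_le_mul_of_nonneg_right (hp1.trans (le_abs_self C)) (norm_nonneg _)
  · rw [hp2 hp, mul_zero, norm_zero]; exact norm_nonneg _

/-- For a weakly differentiable function, the increment along a horizontal segment is the integral
of the derivative along that segment. -/
theorem ae_increment_eq_integral {u : Heis n → ℝ} (hu : MemS1Loc u) (w : Fin n → ℂ) :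
    ∀ᵐ x, x ∈ flowDomain w → u (hmul x (horiz w 1)) - u x =
      ∫ τ in Set.Icc (0 : ℝ) 1, weakDir w u (hmul x (horiz w τ)) := by
  set ν : Measure ℝ := volume.restrict (Set.Icc 0 1) with hν
  set g := weakDir w u with hgdef
  have hg : MemL2Loc g := hu.memL2Loc_weakDir w
  have hae : ∀ᵐ p : ℝ × Heis n ∂(ν.prod volume), p.1 ∈ Set.Icc (0:ℝ) 1 :=
    Measure.quasiMeasurePreserving_fst.ae (ae_restrict_mem measurableSet_Icc)
  -- `(τ, x) ↦ g(x · τw) ξ(x)` is integrable since the flow carries it to `g(y) ξ(y · (-τw))`,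
  -- which is supported in the sweep of `K`.
  have hint : ∀ (ξ : Heis n → ℝ) (K : Set (Heis n)) (C : ℝ), AEStronglyMeasurable ξ volume →
      IsCompact K → K ⊆ flowDomain w → (∀ x, ‖ξ x‖ ≤ C) → (∀ x ∉ K, ξ x = 0) →
      Integrable (fun p : ℝ × Heis n => g (hmul p.2 (horiz w p.1)) * ξ p.2) (ν.prod volume) := by
    intro ξ K C hξ hK hKU hC h0
    have hΦ := measurePreserving_flow w ν
    have hΦ' : MeasurePreserving (fun p : ℝ × Heis n => (p.1, hmul p.2 (horiz w (-p.1))))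
        (ν.prod volume) (ν.prod volume) :=
      (MeasurePreserving.id ν).skew_product (g := fun τ x => hmul x (horiz w (-τ)))
        (continuous_hmul.comp (continuous_snd.prodMk
          ((continuous_horiz w).comp (continuous_neg.comp continuous_fst)))).measurable
        (Eventually.of_forall fun τ => (measurePreserving_hmul_right (horiz w (-τ))).map_eq)
    have hH : AEStronglyMeasurable (fun p : ℝ × Heis n => ξ (hmul p.2 (horiz w (-p.1))))
        (ν.prod volume) :=
      (hξ.comp_snd (μ := ν)).comp_quasiMeasurePreserving hΦ'.quasiMeasurePreserving
    have h1 := integrable_prod_of_bounded hg (isCompact_sweep w hK) (sweep_subset hKU) hH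
      (C := C) (Eventually.of_forall fun p => hC _) (by
        filter_upwards [hae] with p hp hpn
        refine h0 _ fun hmem => hpn ?_
        have := mem_sweep (w := w) hp hmem
        rwa [hmul_horiz_cancel'] at this)
    have h2 := (hΦ.integrable_comp h1.aestronglyMeasurable).2 h1
    refine h2.congr (Eventually.of_forall fun p => ?_)
    simp only [Function.comp, hmul_horiz_cancel]
  have hloc : LocallyIntegrableOn (fun x => u (hmul x (horiz w 1)) - u x -
      ∫ τ, g (hmul x (horiz w τ)) ∂ν) (flowDomain w) := by
    refine (locallyIntegrableOn_iff (isOpen_flowDomain w).isLocallyClosed).2 fun K hKU hK => ?_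
    have hU0 : K ⊆ {0}ᶜ := fun x hx => by
      have := mem_flowDomain.1 (hKU hx) 0 (by simp)
      simpa using this
    have huloc := fun K hK0 hK =>
      (locallyIntegrableOn_iff isOpen_punctured.isLocallyClosed).1 hu.1.locallyIntegrableOn K hK0 hK
    have h1 : IntegrableOn u K := huloc K hU0 hK
    have h2 : IntegrableOn (fun x => u (hmul x (horiz w 1))) K := by
      have h3 : IntegrableOn u ((fun x => hmul x (horiz w 1)) '' K) :=
        huloc _ (by
          rintro _ ⟨x, hx, rfl⟩
          exact mem_flowDomain.1 (hKU hx) 1 (by simp))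
          (hK.image (hmulRightHomeo (horiz w 1)).continuous)
      exact ((measurePreserving_hmul_right (horiz w 1)).integrableOn_image
        (hmulRightHomeo (horiz w 1)).toMeasurableEquiv.measurableEmbedding).1 h3
    have h4 : IntegrableOn (fun x => ∫ τ, g (hmul x (horiz w τ)) ∂ν) K := by
      have h5 := (hint (K.indicator 1) K 1
        (aestronglyMeasurable_one.indicator hK.measurableSet) hK hKU (fun x => by
          by_cases hx : x ∈ K <;> simp [hx]) (fun x hx => by simp [hx])).integral_prod_right
      rw [← integrable_indicator_iff hK.measurableSet]
      refine h5.congr (Eventually.of_forall fun x => ?_)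
      by_cases hx : x ∈ K <;> simp [hx]
    exact (h2.sub h1).sub h4
  have key := (isOpen_flowDomain w).ae_eq_zero_of_integral_contDiff_smul_eq_zero hloc ?_
  · filter_upwards [key] with x hx hxU
    exact sub_eq_zero.1 (hx hxU)
  intro φ h1 h2 h3
  have hK : IsCompact (tsupport φ) := h2
  set S := sweep w (tsupport φ) with hS
  have hSc : IsCompact S := isCompact_sweep w hK
  have hS0 : S ⊆ {0}ᶜ := sweep_subset h3
  have hdiff : Differentiable ℝ φ := h1.differentiable (by simp)
  set W : Heis n → ℝ := fun x => fderiv ℝ φ x (hDir w x) with hW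
  have hWc : Continuous W := (h1.continuous_fderiv (by simp)).clm_apply (continuous_hDir w)
  have hWs : ∀ x ∉ tsupport φ, W x = 0 := by
    intro x hx
    have : fderiv ℝ φ x = 0 := by
      by_contra h
      exact hx (support_fderiv_subset ℝ h)
    simp [hW, this]
  have hWcs : HasCompactSupport W := HasCompactSupport.intro hK hWs
  obtain ⟨C, hC⟩ := hWcs.exists_bound_of_continuous hWc
  obtain ⟨C', hC'⟩ := h2.exists_bound_of_continuous h1.continuous
  have hback : ∀ τ ∈ Set.Icc (0:ℝ) 1, ∀ y, hmul y (horiz w (-τ)) ∈ tsupport φ → y ∈ S := by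
    intro τ hτ y hy
    have := mem_sweep (w := w) hτ hy
    rwa [hmul_horiz_cancel'] at this
  -- After a change of variables the increment falls on the test function, along the backward flow.
  have hinc : ∀ y, φ (hmul y (horiz w (-1))) - φ y = -∫ τ, W (hmul y (horiz w (-τ))) ∂ν := by
    intro y
    have hd : ∀ τ ∈ Set.uIcc (0:ℝ) 1, HasDerivAt (fun τ => φ (hmul y (horiz w (-τ))))
        (-W (hmul y (horiz w (-τ)))) τ := by
      intro τ _
      have := (hasDerivAt_comp_hmul_horiz hdiff w y (-τ)).scomp τ (hasDerivAt_neg τ)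
      simpa [hW, Function.comp_def] using this
    have hcont : Continuous fun τ => -W (hmul y (horiz w (-τ))) :=
      (hWc.comp (continuous_hmul.comp (continuous_const.prodMk
        ((continuous_horiz w).comp continuous_neg)))).neg
    have h := intervalIntegral.integral_eq_sub_of_hasDerivAt hd (hcont.intervalIntegrable 0 1)
    rw [intervalIntegral.integral_of_le zero_le_one, ← integral_Icc_eq_integral_Ioc,
      integral_neg] at h
    simpa using h.symm
  -- The test function translated along the flow is again a test function, with the same field
  -- applied to it, so the definition of the weak derivative moves the derivative to `u`.
  have hψ : ∀ τ ∈ Set.Icc (0:ℝ) 1, ∫ y, u y * W (hmul y (horiz w (-τ))) =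
      -∫ x, g (hmul x (horiz w τ)) * φ x := by
    intro τ hτ
    set ψ : Heis n → ℝ := fun y => φ (hmul y (horiz w (-τ))) with hψdef
    have hts : tsupport ψ ⊆ S :=
      closure_minimal (fun y hy => hback τ hτ y (subset_tsupport _ hy)) hSc.isClosed
    have e := hu.integral_hDir (φ := ψ) w (h1.comp (contDiff_hmul_horiz w (-τ)))
      (hSc.of_isClosed_subset (isClosed_tsupport _) hts) (hts.trans hS0)
    have e1 : ∀ y, fderiv ℝ ψ y (hDir w y) = W (hmul y (horiz w (-τ))) :=
      fun y => fderiv_comp_hmul_horiz h1 w y (-τ)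
    simp_rw [e1] at e
    rw [e, ← integral_hmul_right (horiz w τ)]
    simp only [hψdef, hmul_horiz_cancel, hgdef]
  have hi1 : Integrable (fun p : ℝ × Heis n => u p.2 * W (hmul p.2 (horiz w (-p.1))))
      (ν.prod volume) := by
    refine integrable_prod_of_bounded hu.1 hSc hS0 ?_ (C := C) (Eventually.of_forall fun p => hC _) ?_
    · exact (hWc.comp (continuous_hmul.comp (continuous_snd.prodMk
        ((continuous_horiz w).comp (continuous_neg.comp continuous_fst))))).aestronglyMeasurable
    · filter_upwards [hae] with p hp hpn
      exact hWs _ fun hmem => hpn (hback _ hp _ hmem)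
  have hi2 := hint φ (tsupport φ) C' h1.continuous.aestronglyMeasurable hK h3 hC'
    (fun x hx => image_eq_zero_of_notMem_tsupport hx)
  have hU0 : tsupport φ ⊆ {0}ᶜ := fun x hx => by
    have := mem_flowDomain.1 (h3 hx) 0 (by simp)
    simpa using this
  have j1 : Integrable fun y => u y * φ y := hu.1.integrable_mul h1.continuous h2 hU0
  have hts1 : tsupport (fun y => φ (hmul y (horiz w (-1)))) ⊆ S :=
    closure_minimal (fun y hy => hback 1 (by simp) y (subset_tsupport _ hy)) hSc.isClosed
  have j2 : Integrable fun y => u y * φ (hmul y (horiz w (-1))) :=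
    hu.1.integrable_mul (h1.comp (contDiff_hmul_horiz w (-1))).continuous
      (hSc.of_isClosed_subset (isClosed_tsupport _) hts1) (hts1.trans hS0)
  have j3 : Integrable fun x => u (hmul x (horiz w 1)) * φ x := by
    have := ((measurePreserving_hmul_right (horiz w 1)).integrable_comp
      j2.aestronglyMeasurable).2 j2
    refine this.congr (Eventually.of_forall fun x => ?_)
    simp only [Function.comp, hmul_horiz_cancel]
  have hi2' : Integrable fun x => ∫ τ, g (hmul x (horiz w τ)) * φ x ∂ν := hi2.integral_prod_right
  have lhs : ∫ x, (u (hmul x (horiz w 1)) * φ x - u x * φ x) =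
      ∫ x, ∫ τ, g (hmul x (horiz w τ)) * φ x ∂ν := by
    rw [integral_sub j3 j1]
    have e1 : ∫ x, u (hmul x (horiz w 1)) * φ x = ∫ y, u y * φ (hmul y (horiz w (-1))) := by
      rw [← integral_hmul_right (horiz w 1) (fun y => u y * φ (hmul y (horiz w (-1))))]
      simp only [hmul_horiz_cancel]
    rw [e1, ← integral_sub j2 j1]
    have e2 : ∀ y, u y * φ (hmul y (horiz w (-1))) - u y * φ y =
        -∫ τ, u y * W (hmul y (horiz w (-τ))) ∂ν := by
      intro y
      rw [← mul_sub, hinc y, integral_const_mul]; ring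
    simp_rw [e2]
    rw [integral_neg, ← integral_integral_swap
      (f := fun τ y => u y * W (hmul y (horiz w (-τ)))) hi1,
      ← integral_integral_swap (f := fun τ x => g (hmul x (horiz w τ)) * φ x) hi2, ← integral_neg]
    refine integral_congr_ae ?_
    filter_upwards [ae_restrict_mem measurableSet_Icc] with τ hτ
    rw [hψ τ hτ, neg_neg]
  have fin : ∀ x, φ x • (u (hmul x (horiz w 1)) - u x - ∫ τ, g (hmul x (horiz w τ)) ∂ν) =
      (u (hmul x (horiz w 1)) * φ x - u x * φ x) - ∫ τ, g (hmul x (horiz w τ)) * φ x ∂ν := by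
    intro x
    rw [integral_mul_const, smul_eq_mul]; ring
  simp_rw [fin]
  have j4 : Integrable fun x => u (hmul x (horiz w 1)) * φ x - u x * φ x := j3.sub j1
  rw [integral_sub j4 hi2', lhs, sub_self]

/-- The squared length of the weak horizontal gradient. -/
def gradSq (u : Heis n → ℝ) (x : Heis n) : ENNReal := ∑ j, ‖weakDeriv j u x‖ₑ ^ 2

theorem enorm_weakDir_sq_le (w : Fin n → ℂ) (u : Heis n → ℝ) (x : Heis n) :
    ‖weakDir w u x‖ₑ ^ 2 ≤ ENNReal.ofReal (koranyi ((w, 0) : Heis n) ^ 2) * gradSq u x := by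
  have h : weakDir w u x ^ 2 ≤ koranyi ((w, 0) : Heis n) ^ 2 * ∑ j, weakDeriv j u x ^ 2 := by
    have e : weakDir w u x = ∑ j : Fin n ⊕ Fin n,
        (Sum.elim (fun α => (w α).re) (fun α => (w α).im) j) * weakDeriv j u x := by
      simp [weakDir, Finset.sum_add_distrib]
    rw [e]
    refine (Finset.sum_mul_sq_le_sq_mul_sq _ _ _).trans ?_
    refine mul_le_mul_of_nonneg_right ?_ (Finset.sum_nonneg fun j _ => sq_nonneg _)
    refine le_trans (le_of_eq ?_) (sum_sq_le_koranyi_sq ((w, 0) : Heis n))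
    simp only [Fintype.sum_sum_type, Sum.elim_inl, Sum.elim_inr, ← Finset.sum_add_distrib]
    refine Finset.sum_congr rfl fun α _ => ?_
    rw [Complex.sq_norm, Complex.normSq_apply]; ring
  have h' := ENNReal.ofReal_le_ofReal h
  have e1 : ∀ r : ℝ, ‖r‖ₑ ^ 2 = ENNReal.ofReal (r ^ 2) := fun r => by
    rw [← ofReal_norm, ← ENNReal.ofReal_pow (norm_nonneg _), Real.norm_eq_abs, sq_abs]
  rw [gradSq]
  simp_rw [e1]
  rw [← ENNReal.ofReal_sum_of_nonneg fun j _ => sq_nonneg _, ← ENNReal.ofReal_mul (by positivity)]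
  exact h'

theorem koranyi_horiz_le (w : Fin n → ℂ) {τ : ℝ} (hτ : τ ∈ Set.Icc (0 : ℝ) 1) :
    koranyi (horiz w τ) ≤ koranyi ((w, 0) : Heis n) := by
  refine (pow_le_pow_iff_left₀ (koranyi_nonneg _) (koranyi_nonneg _) (by norm_num : (4:ℕ) ≠ 0)).1 ?_
  rw [koranyi_pow_four, koranyi_pow_four, gauge4, gauge4, horiz]
  simp only [Pi.smul_apply, norm_smul, mul_pow, ← Finset.mul_sum, Real.norm_eq_abs, sq_abs]
  have : τ ^ 2 ≤ 1 := by nlinarith [hτ.1, hτ.2]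
  have h4 : (τ ^ 2) ^ 2 ≤ 1 := by nlinarith [sq_nonneg τ]
  nlinarith [sq_nonneg (∑ α, ‖w α‖ ^ 2)]

theorem setLIntegral_hmul_right_le {A B : Set (Heis n)} (hA : MeasurableSet A)
    (hB : MeasurableSet B) {v : Heis n} (h : ∀ x ∈ A, hmul x v ∈ B) (f : Heis n → ENNReal) :
    ∫⁻ x in A, f (hmul x v) ≤ ∫⁻ y in B, f y := by
  rw [← lintegral_indicator hA, ← lintegral_indicator hB,
    ← lintegral_hmul_right v (B.indicator f)]
  refine lintegral_mono fun x => ?_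
  by_cases hx : x ∈ A
  · rw [Set.indicator_of_mem hx, Set.indicator_of_mem (h x hx)]
  · rw [Set.indicator_of_notMem hx]; exact zero_le

/-- Averaging a function along the flow does not increase its square integral, apart from the
enlargement of the domain. -/
theorem lintegral_lintegral_flow_le {g : Heis n → ℝ} (hg : AEStronglyMeasurable g volume)
    (w : Fin n → ℂ) {A B : Set (Heis n)} (hA : MeasurableSet A) (hB : MeasurableSet B)
    (h : ∀ x ∈ A, ∀ τ ∈ Set.Icc (0 : ℝ) 1, hmul x (horiz w τ) ∈ B) :
    ∫⁻ x in A, ‖∫ τ in Set.Icc (0 : ℝ) 1, g (hmul x (horiz w τ))‖ₑ ^ 2 ≤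
      ∫⁻ y in B, ‖g y‖ₑ ^ 2 := by
  set ν : Measure ℝ := volume.restrict (Set.Icc 0 1) with hν
  have hν1 : ν Set.univ = 1 := by simp [hν]
  have hgm : AEStronglyMeasurable (fun p : ℝ × Heis n => g (hmul p.2 (horiz w p.1)))
      (ν.prod volume) :=
    (hg.comp_snd (μ := ν)).comp_quasiMeasurePreserving
      (measurePreserving_flow w ν).quasiMeasurePreserving
  have hgm' : AEStronglyMeasurable (fun p : Heis n × ℝ => g (hmul p.1 (horiz w p.2)))
      ((volume : Measure (Heis n)).prod ν) := hgm.prod_swap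
  have hslice : ∀ᵐ x, AEStronglyMeasurable (fun τ => g (hmul x (horiz w τ))) ν :=
    hgm'.prodMk_left
  have hac : (volume.restrict A).prod ν ≪ (volume : Measure (Heis n)).prod ν :=
    (Measure.absolutelyContinuous_of_le Measure.restrict_le_self).prod
      Measure.AbsolutelyContinuous.rfl
  calc ∫⁻ x in A, ‖∫ τ, g (hmul x (horiz w τ)) ∂ν‖ₑ ^ 2
      ≤ ∫⁻ x in A, ∫⁻ τ, ‖g (hmul x (horiz w τ))‖ₑ ^ 2 ∂ν := by
        refine lintegral_mono_ae (ae_restrict_of_ae ?_)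
        filter_upwards [hslice] with x hsl
        have h1 : ‖∫ τ, g (hmul x (horiz w τ)) ∂ν‖ₑ ≤ ∫⁻ τ, ‖g (hmul x (horiz w τ))‖ₑ ∂ν :=
          enorm_integral_le_lintegral_enorm _
        refine (pow_le_pow_left' h1 2).trans ?_
        have h2 := sq_lintegral_le ν hsl.enorm
        rwa [hν1, one_mul] at h2
    _ = ∫⁻ τ, (∫⁻ x in A, ‖g (hmul x (horiz w τ))‖ₑ ^ 2) ∂ν :=
        lintegral_lintegral_swap (f := fun x τ => ‖g (hmul x (horiz w τ))‖ₑ ^ 2)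
          ((hgm'.mono_ac hac).enorm.pow_const 2)
    _ ≤ ∫⁻ _τ, (∫⁻ y in B, ‖g y‖ₑ ^ 2) ∂ν := by
        refine lintegral_mono_ae ?_
        filter_upwards [ae_restrict_mem measurableSet_Icc] with τ hτ
        exact setLIntegral_hmul_right_le hA hB (fun x hx => h x hx τ hτ) fun y => ‖g y‖ₑ ^ 2
    _ = ∫⁻ y in B, ‖g y‖ₑ ^ 2 := by rw [lintegral_const, hν1, mul_one]

/-- Horizontal increments are controlled in `L²` by the gradient on a slightly larger shell. -/
theorem lintegral_horizontal_increment_le {u : Heis n → ℝ} (hu : MemS1Loc u) (w : Fin n → ℂ)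
    {a b s : ℝ} (hs : koranyi ((w, 0) : Heis n) ≤ s) (hsa : s < a) :
    ∫⁻ x in shell n a b, ‖u (hmul x (w, 0)) - u x‖ₑ ^ 2 ≤
      ENNReal.ofReal (koranyi ((w, 0) : Heis n) ^ 2) * ∫⁻ x in shell n (a - s) (b + s), gradSq u x := by
  have hmem : ∀ x ∈ shell n a b, ∀ τ ∈ Set.Icc (0:ℝ) 1,
      hmul x (horiz w τ) ∈ shell n (a - s) (b + s) := fun x hx τ hτ =>
    hmul_mem_shell hx ((koranyi_horiz_le w hτ).trans hs)
  have hdom : shell n a b ⊆ flowDomain w := fun x hx => mem_flowDomain.2 fun τ hτ =>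
    shell_subset (by linarith) (hmem x hx τ hτ)
  have hmeas : MeasurableSet (shell n a b) := (isCompact_shell a b).measurableSet
  have e : horiz w 1 = ((w, 0) : Heis n) := by simp [horiz]
  have h1 : ∫⁻ x in shell n a b, ‖u (hmul x (w, 0)) - u x‖ₑ ^ 2 =
      ∫⁻ x in shell n a b, ‖∫ τ in Set.Icc (0 : ℝ) 1, weakDir w u (hmul x (horiz w τ))‖ₑ ^ 2 := by
    refine lintegral_congr_ae ((ae_restrict_iff' hmeas).2 ?_)
    filter_upwards [ae_increment_eq_integral hu w] with x hx hxs
    rw [← hx (hdom hxs), e]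
  rw [h1, ← lintegral_const_mul' _ _ ENNReal.ofReal_ne_top]
  refine (lintegral_lintegral_flow_le (hu.memL2Loc_weakDir w).aestronglyMeasurable w hmeas
    (isCompact_shell _ _).measurableSet hmem).trans ?_
  exact lintegral_mono fun y => enorm_weakDir_sq_le w u y

theorem enorm_sq_eq_ofReal (r : ℝ) : ‖r‖ₑ ^ 2 = ENNReal.ofReal (r ^ 2) := by
  rw [← ofReal_norm, ← ENNReal.ofReal_pow (norm_nonneg _), Real.norm_eq_abs, sq_abs]

theorem enorm_add_sq_le (a b : ℝ) : ‖a + b‖ₑ ^ 2 ≤ 2 * ‖a‖ₑ ^ 2 + 2 * ‖b‖ₑ ^ 2 := by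
  rw [enorm_sq_eq_ofReal, enorm_sq_eq_ofReal, enorm_sq_eq_ofReal,
    show (2 : ENNReal) = ENNReal.ofReal 2 by norm_num, ← ENNReal.ofReal_mul (by norm_num),
    ← ENNReal.ofReal_mul (by norm_num), ← ENNReal.ofReal_add (by positivity) (by positivity)]
  exact ENNReal.ofReal_le_ofReal (by nlinarith [sq_nonneg (a - b)])

theorem shell_mono {a b a' b' : ℝ} (ha : a' ≤ a) (hb : b ≤ b') : shell n a b ⊆ shell n a' b' :=
  fun _ hx => ⟨ha.trans hx.1, hx.2.trans hb⟩

/-- The product of a list of horizontal elements of the group. -/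
def horizProd (l : List (Fin n → ℂ)) : Heis n := l.foldr (fun w y => hmul (w, 0) y) 0

/-- Increments along a product of horizontal elements of length at most `σ`; each factor costs an
enlargement of the shell by `σ`. -/
theorem lintegral_horizProd_increment_le {u : Heis n → ℝ} (hu : MemS1Loc u) {σ : ℝ} (hσ : 0 ≤ σ)
    (l : List (Fin n → ℂ)) (hl : ∀ w ∈ l, koranyi ((w, 0) : Heis n) ≤ σ) :
    ∀ a b : ℝ, l.length * σ < a →
    ∫⁻ x in shell n a b, ‖u (hmul x (horizProd l)) - u x‖ₑ ^ 2 ≤ 4 ^ l.length *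
      (ENNReal.ofReal (σ ^ 2) * ∫⁻ x in shell n (a - l.length * σ) (b + l.length * σ), gradSq u x) := by
  have hum := hu.1.aestronglyMeasurable
  have hqmp : ∀ v : Heis n, AEStronglyMeasurable (fun x => u (hmul x v)) volume := fun v =>
    hum.comp_quasiMeasurePreserving (measurePreserving_hmul_right v).quasiMeasurePreserving
  induction l with
  | nil => intro a b _; simp [horizProd]
  | cons w l ih =>
    intro a b hab
    have hw : koranyi ((w, 0) : Heis n) ≤ σ := hl w (by simp)
    have hlen : ((w :: l).length : ℝ) = l.length + 1 := by simp
    rw [hlen] at hab ⊢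
    have hlσ : 0 ≤ (l.length : ℝ) * σ := by positivity
    set p := horizProd l with hp
    have hprod : horizProd (w :: l) = hmul (w, 0) p := rfl
    set R := ENNReal.ofReal (σ ^ 2) *
      ∫⁻ x in shell n (a - (l.length + 1) * σ) (b + (l.length + 1) * σ), gradSq u x with hR
    have h1 : ∫⁻ x in shell n a b, ‖u (hmul (hmul x (w, 0)) p) - u (hmul x (w, 0))‖ₑ ^ 2 ≤
        4 ^ l.length * R := by
      refine (setLIntegral_hmul_right_le (isCompact_shell a b).measurableSet
        (isCompact_shell (a - σ) (b + σ)).measurableSet (fun x hx => hmul_mem_shell hx hw)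
        fun y => ‖u (hmul y p) - u y‖ₑ ^ 2).trans ?_
      refine (ih (fun w' h => hl w' (by simp [h])) (a - σ) (b + σ) (by linarith)).trans
        (le_of_eq ?_)
      rw [hR]
      congr 4
      congr 1 <;> ring
    have h2 : ∫⁻ x in shell n a b, ‖u (hmul x (w, 0)) - u x‖ₑ ^ 2 ≤ R := by
      refine (lintegral_horizontal_increment_le hu w hw (by linarith)).trans ?_
      refine mul_le_mul' (ENNReal.ofReal_le_ofReal
        (pow_le_pow_left₀ (koranyi_nonneg _) hw 2)) (lintegral_mono_set (shell_mono ?_ ?_))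
      · linarith
      · linarith
    calc ∫⁻ x in shell n a b, ‖u (hmul x (horizProd (w :: l))) - u x‖ₑ ^ 2
        ≤ ∫⁻ x in shell n a b, (2 * ‖u (hmul (hmul x (w, 0)) p) - u (hmul x (w, 0))‖ₑ ^ 2 +
            2 * ‖u (hmul x (w, 0)) - u x‖ₑ ^ 2) := by
          refine lintegral_mono fun x => ?_
          rw [hprod, ← hmul_assoc]
          refine le_trans (le_of_eq ?_) (enorm_add_sq_le _ _)
          congr 2; ring
      _ = 2 * (∫⁻ x in shell n a b, ‖u (hmul (hmul x (w, 0)) p) - u (hmul x (w, 0))‖ₑ ^ 2) +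
            2 * ∫⁻ x in shell n a b, ‖u (hmul x (w, 0)) - u x‖ₑ ^ 2 := by
          rw [lintegral_add_right', lintegral_const_mul' _ _ (by simp),
            lintegral_const_mul' _ _ (by simp)]
          exact ((((hqmp (w, 0)).sub hum).enorm.pow_const 2).const_mul 2).restrict
      _ ≤ 2 * (4 ^ l.length * R) + 2 * R := by gcongr
      _ ≤ 4 ^ (w :: l).length * R := by
          rw [List.length_cons, pow_succ]
          have h4 : (1 : ENNReal) ≤ 4 ^ l.length := one_le_pow_of_one_le' (by norm_num) _
          calc 2 * (4 ^ l.length * R) + 2 * R ≤ 2 * (4 ^ l.length * R) + 2 * (4 ^ l.length * R) := by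
                gcongr
                exact le_mul_of_one_le_left' h4
            _ = 4 ^ l.length * 4 * R := by ring

/-- Every group element is a product of five horizontal elements that are not longer: vertical
elements are commutators of horizontal ones. -/
theorem exists_horizProd_eq (hn : 1 ≤ n) (v : Heis n) : ∃ l : List (Fin n → ℂ), l.length = 5 ∧
    (∀ w ∈ l, koranyi ((w, 0) : Heis n) ≤ koranyi v) ∧ horizProd l = v := by
  -- The commutator of `(a, 0)` and `(b i, 0)` in one complex coordinate is `(0, -4 a b)`.
  obtain ⟨a, b, ha, hb, hab⟩ : ∃ a b : ℝ, |a| ≤ koranyi v ∧ |b| ≤ koranyi v ∧ -4 * (a * b) = v.2 := by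
    have h1 : Real.sqrt |v.2| ≤ koranyi v :=
      Real.sqrt_le_iff.2 ⟨koranyi_nonneg v, abs_snd_le_koranyi_sq v⟩
    have h0 := Real.sqrt_nonneg |v.2|
    have hsq := Real.mul_self_sqrt (abs_nonneg v.2)
    rcases le_total 0 v.2 with h | h
    · refine ⟨Real.sqrt |v.2| / 2, -(Real.sqrt |v.2| / 2), ?_, ?_, ?_⟩
      · rw [abs_of_nonneg (by positivity)]; linarith
      · rw [abs_neg, abs_of_nonneg (by positivity)]; linarith
      · rw [abs_of_nonneg h] at hsq ⊢; linarith
    · refine ⟨Real.sqrt |v.2| / 2, Real.sqrt |v.2| / 2, ?_, ?_, ?_⟩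
      · rw [abs_of_nonneg (by positivity)]; linarith
      · rw [abs_of_nonneg (by positivity)]; linarith
      · rw [abs_of_nonpos h] at hsq ⊢; linarith
  set i : Fin n := ⟨0, hn⟩
  have hsingle : ∀ c : ℂ, koranyi ((Pi.single i c, 0) : Heis n) = ‖c‖ := by
    intro c
    refine (pow_left_inj₀ (koranyi_nonneg _) (norm_nonneg c) (by norm_num : (4:ℕ) ≠ 0)).1 ?_
    rw [koranyi_pow_four, gauge4]
    have : ∑ α, ‖(Pi.single i c : Fin n → ℂ) α‖ ^ 2 = ‖c‖ ^ 2 := by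
      rw [Finset.sum_eq_single i]
      · simp
      · intro j _ hj; simp [hj]
      · simp
    simp only [this]; ring
  refine ⟨[v.1, Pi.single i (a : ℂ), Pi.single i (b * Complex.I), Pi.single i (-a : ℂ),
    Pi.single i (-(b * Complex.I))], rfl, ?_, ?_⟩
  · intro w hw
    simp only [List.mem_cons, List.not_mem_nil, or_false] at hw
    rcases hw with rfl | rfl | rfl | rfl | rfl
    · refine (pow_le_pow_iff_left₀ (koranyi_nonneg _) (koranyi_nonneg _)
        (by norm_num : (4:ℕ) ≠ 0)).1 ?_
      rw [koranyi_pow_four, koranyi_pow_four, gauge4, gauge4]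
      nlinarith [sq_nonneg v.2]
    all_goals
      rw [hsingle]
      simpa using (by assumption)
  · refine Prod.ext ?_ ?_
    · simp only [horizProd, List.foldr, hmul, Prod.fst_zero, add_zero]
      rw [← Pi.single_add, ← Pi.single_add, ← Pi.single_add]
      simp
    · have hs : ∀ (f : Fin n → ℂ) (c : ℂ), ∑ α, (Pi.single i c : Fin n → ℂ) α * f α = c * f i := by
        intro f c
        rw [Finset.sum_eq_single i]
        · simp
        · intro j _ hj; simp [hj]
        · simp
      simp only [horizProd, List.foldr, hmul, Prod.fst_zero, Prod.snd_zero, hs]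
      have e0 : (Pi.single i (a : ℂ) + (Pi.single i (b * Complex.I) + (Pi.single i (-a : ℂ) +
          (Pi.single i (-(b * Complex.I)) + 0))) : Fin n → ℂ) = 0 := by
        rw [add_zero, ← Pi.single_add, ← Pi.single_add, ← Pi.single_add]
        simp
      rw [e0]
      simp
      linarith

/-- Increments in arbitrary directions are controlled in `L²` by the horizontal gradient. -/
theorem lintegral_increment_le (hn : 1 ≤ n) {u : Heis n → ℝ} (hu : MemS1Loc u) {v : Heis n}
    {a b s : ℝ} (hv : koranyi v ≤ s) (hs : 5 * s < a) :
    ∫⁻ x in shell n a b, ‖u (hmul x v) - u x‖ₑ ^ 2 ≤ 4 ^ 5 * (ENNReal.ofReal (s ^ 2) *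
      ∫⁻ x in shell n (a - 5 * s) (b + 5 * s), gradSq u x) := by
  obtain ⟨l, hl5, hl, rfl⟩ := exists_horizProd_eq hn v
  have h := lintegral_horizProd_increment_le hu ((koranyi_nonneg _).trans hv) l
    (fun w hw => (hl w hw).trans hv) a b (by rw [hl5]; exact_mod_cast hs)
  rw [hl5] at h
  exact_mod_cast h

/-! ### Finitely many functionals control the `L²` norm by the gradient -/

theorem sq_lintegral_mul_le {X : Type*} [MeasurableSpace X] (μ : Measure X) {w f : X → ENNReal}
    (hw : Measurable w) (hf : AEMeasurable f μ) :
    (∫⁻ x, w x * f x ∂μ) ^ 2 ≤ (∫⁻ x, w x ∂μ) * ∫⁻ x, w x * f x ^ 2 ∂μ := by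
  have h := sq_lintegral_le (μ.withDensity w) (f := f)
    (hf.mono_ac (withDensity_absolutelyContinuous μ w))
  rw [lintegral_withDensity_eq_lintegral_mul₀ hw.aemeasurable hf,
    lintegral_withDensity_eq_lintegral_mul₀ hw.aemeasurable (hf.pow_const 2),
    withDensity_apply _ MeasurableSet.univ, Measure.restrict_univ] at h
  exact h

/-- The mollifier, supported in the Koranyi ball of radius `s`. -/
def bump (s : ℝ) (v : Heis n) : ℝ := max 0 (s - koranyi v)

theorem bump_nonneg (s : ℝ) (v : Heis n) : 0 ≤ bump s v := le_max_left _ _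

theorem continuous_bump (s : ℝ) : Continuous (bump s : Heis n → ℝ) :=
  continuous_const.max (continuous_const.sub continuous_koranyi)

theorem koranyi_lt_of_bump_ne_zero {s : ℝ} {v : Heis n} (h : bump s v ≠ 0) : koranyi v < s := by
  by_contra hc
  exact h (max_eq_left (by linarith))

theorem hasCompactSupport_bump (s : ℝ) : HasCompactSupport (bump s : Heis n → ℝ) :=
  HasCompactSupport.intro (isCompact_shell 0 s) fun v hv => by
    by_contra h
    exact hv ⟨koranyi_nonneg v, (koranyi_lt_of_bump_ne_zero h).le⟩

theorem integrable_bump (s : ℝ) : Integrable (bump s : Heis n → ℝ) :=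
  (continuous_bump s).integrable_of_hasCompactSupport (hasCompactSupport_bump s)

theorem integral_bump_pos {s : ℝ} (hs : 0 < s) : 0 < ∫ v : Heis n, bump s v :=
  (continuous_bump s).integral_pos_of_hasCompactSupport_nonneg_nonzero (hasCompactSupport_bump s)
    (bump_nonneg s) (x := 0) (by simp [bump, hs.ne', max_eq_right hs.le])

theorem lintegral_bump (s : ℝ) : ∫⁻ v : Heis n, ENNReal.ofReal (bump s v) =
    ENNReal.ofReal (∫ v : Heis n, bump s v) :=
  (ofReal_integral_eq_lintegral_ofReal (integrable_bump s)
    (Eventually.of_forall (bump_nonneg s))).symm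

/-- Left translation as a homeomorphism. -/
def hmulLeftHomeo (v : Heis n) : Heis n ≃ₜ Heis n where
  toFun x := hmul v x
  invFun x := hmul (-v) x
  left_inv x := neg_hmul_cancel v x
  right_inv x := hmul_neg_cancel v x
  continuous_toFun := continuous_hmul.comp (continuous_const.prodMk continuous_id)
  continuous_invFun := continuous_hmul.comp (continuous_const.prodMk continuous_id)

theorem integral_hmul_left (v : Heis n) (f : Heis n → ℝ) : ∫ x, f (hmul v x) = ∫ x, f x := by
  exact (measurePreserving_hmul_left v).integral_comp
    (hmulLeftHomeo v).toMeasurableEquiv.measurableEmbedding f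

theorem lintegral_hmul_left (v : Heis n) (f : Heis n → ENNReal) :
    ∫⁻ x, f (hmul v x) = ∫⁻ x, f x := by
  exact (measurePreserving_hmul_left v).lintegral_comp_emb
    (hmulLeftHomeo v).toMeasurableEquiv.measurableEmbedding f

theorem aestronglyMeasurable_hmul_prod {u : Heis n → ℝ} (hu : AEStronglyMeasurable u volume) :
    AEStronglyMeasurable (fun p : Heis n × Heis n => u (hmul p.2 p.1)) (volume.prod volume) := by
  have h : MeasurePreserving (fun p : Heis n × Heis n => (p.1, hmul p.2 p.1))
      (volume.prod volume) (volume.prod volume) :=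
    (MeasurePreserving.id volume).skew_product (g := fun v x => hmul x v)
      (continuous_hmul.comp (continuous_snd.prodMk continuous_fst)).measurable
      (Eventually.of_forall fun v => (measurePreserving_hmul_right v).map_eq)
  exact (hu.comp_snd (μ := (volume : Measure (Heis n)))).comp_quasiMeasurePreserving
    h.quasiMeasurePreserving

/-- The integral of a function against a translated mollifier, over a set `S` that is meant to contain
the support of the mollifier. The mollifier is not normalized to have integral one. -/
def mollify (s : ℝ) (u : Heis n → ℝ) (S : Set (Heis n)) (x : Heis n) : ℝ :=
  ∫ y in S, bump s (hmul (-x) y) * u y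

theorem lintegral_bump_increment_le (hn : 1 ≤ n) {u : Heis n → ℝ} (hu : MemS1Loc u)
    {a b s : ℝ} (hs : 5 * s < a) :
    ∫⁻ x in shell n a b, (∫⁻ v, ENNReal.ofReal (bump s v) * ‖u (hmul x v) - u x‖ₑ ^ 2) ≤
      ENNReal.ofReal (∫ v : Heis n, bump s v) * (4 ^ 5 * (ENNReal.ofReal (s ^ 2) *
      ∫⁻ x in shell n (a - 5 * s) (b + 5 * s), gradSq u x)) := by
  have hum := hu.1.aestronglyMeasurable
  have hb : Measurable fun v : Heis n => ENNReal.ofReal (bump s v) :=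
    (continuous_bump s).measurable.ennreal_ofReal
  have hm : AEStronglyMeasurable (fun p : Heis n × Heis n => u (hmul p.2 p.1) - u p.2)
      (volume.prod volume) :=
    (aestronglyMeasurable_hmul_prod hum).sub (hum.comp_snd (μ := (volume : Measure (Heis n))))
  have hm' : AEStronglyMeasurable (fun p : Heis n × Heis n => u (hmul p.1 p.2) - u p.1)
      (volume.prod volume) := hm.prod_swap
  have hac : (volume.restrict (shell n a b)).prod volume ≪
      (volume : Measure (Heis n)).prod (volume : Measure (Heis n)) :=
    (Measure.absolutelyContinuous_of_le Measure.restrict_le_self).prod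
      Measure.AbsolutelyContinuous.rfl
  have hF : AEMeasurable (fun p : Heis n × Heis n =>
      ENNReal.ofReal (bump s p.2) * ‖u (hmul p.1 p.2) - u p.1‖ₑ ^ 2)
      ((volume.restrict (shell n a b)).prod volume) :=
    (hb.comp measurable_snd).aemeasurable.mul ((hm'.mono_ac hac).enorm.pow_const 2)
  rw [lintegral_lintegral_swap
    (f := fun x v => ENNReal.ofReal (bump s v) * ‖u (hmul x v) - u x‖ₑ ^ 2) hF,
    ← lintegral_bump, ← lintegral_mul_const _ hb]
  refine lintegral_mono fun v => ?_
  rw [lintegral_const_mul' _ _ ENNReal.ofReal_ne_top]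
  by_cases hv : bump s v = 0
  · simp [hv]
  · gcongr
    exact lintegral_increment_le hn hu (koranyi_lt_of_bump_ne_zero hv).le hs

theorem integrableOn_bump_mul {u : Heis n → ℝ} (hu : MemL2Loc u) (s : ℝ) {S : Set (Heis n)}
    (hS : IsCompact S) (hS0 : S ⊆ {0}ᶜ) (x : Heis n) :
    IntegrableOn (fun y => bump s (hmul (-x) y) * u y) S := by
  have h1 : IntegrableOn u S :=
    (locallyIntegrableOn_iff isOpen_punctured.isLocallyClosed).1 hu.locallyIntegrableOn S hS0 hS
  exact h1.continuousOn_mul ((continuous_bump s).comp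
    (continuous_hmul.comp (continuous_const.prodMk continuous_id))).continuousOn hS

/-- A function differs from its mollification by an average of increments. -/
theorem enorm_sub_mollify_sq_le {u : Heis n → ℝ} (hu : MemL2Loc u) {s : ℝ}
    {S : Set (Heis n)} (hS : IsCompact S) (hS0 : S ⊆ {0}ᶜ) {x : Heis n}
    (hx : ∀ v, koranyi v < s → hmul x v ∈ S)
    (hsl : AEStronglyMeasurable (fun v => u (hmul x v) - u x) volume) :
    ‖(∫ v : Heis n, bump s v) * u x - mollify s u S x‖ₑ ^ 2 ≤
      ENNReal.ofReal (∫ v : Heis n, bump s v) *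
        ∫⁻ v, ENNReal.ofReal (bump s v) * ‖u (hmul x v) - u x‖ₑ ^ 2 := by
  have hout : ∀ y ∉ S, bump s (hmul (-x) y) = 0 := by
    intro y hy
    by_contra h
    refine hy ?_
    have := hx _ (koranyi_lt_of_bump_ne_zero h)
    rwa [hmul_neg_cancel] at this
  have hI := integrableOn_bump_mul hu s hS hS0 x
  have hI' : Integrable fun y => bump s (hmul (-x) y) * u y :=
    (integrableOn_iff_integrable_of_support_subset fun y hy => by
      by_contra h
      exact hy (by simp [hout y h])).1 hI
  have e1 : mollify s u S x = ∫ y, bump s (hmul (-x) y) * u y := by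
    rw [mollify]
    exact setIntegral_eq_integral_of_forall_compl_eq_zero fun y hy => by simp [hout y hy]
  have e2 : (∫ v : Heis n, bump s v) = ∫ y : Heis n, bump s (hmul (-x) y) :=
    (integral_hmul_left (-x) _).symm
  have hb : Integrable fun y : Heis n => bump s (hmul (-x) y) :=
    (measurePreserving_hmul_left (-x)).integrable_comp_of_integrable (integrable_bump s)
  have e3 : (∫ v : Heis n, bump s v) * u x - mollify s u S x =
      ∫ y, bump s (hmul (-x) y) * (u x - u y) := by
    rw [e1, e2, ← integral_mul_const, ← integral_sub (hb.mul_const _) hI']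
    exact integral_congr_ae (Eventually.of_forall fun y => by ring)
  have e4 : ‖∫ y, bump s (hmul (-x) y) * (u x - u y)‖ₑ ≤
      ∫⁻ v, ENNReal.ofReal (bump s v) * ‖u (hmul x v) - u x‖ₑ := by
    refine (enorm_integral_le_lintegral_enorm _).trans (le_of_eq ?_)
    rw [← lintegral_hmul_left x]
    refine lintegral_congr fun v => ?_
    rw [neg_hmul_cancel, enorm_mul, ← enorm_neg (u x - u (hmul x v)), neg_sub,
      Real.enorm_of_nonneg (bump_nonneg s v)]
  rw [e3, ← lintegral_bump]
  refine (pow_le_pow_left' e4 2).trans ?_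
  exact sq_lintegral_mul_le volume (continuous_bump s).measurable.ennreal_ofReal hsl.enorm

/-- Translated mollifiers depend continuously on the translation, so finitely many of them are
uniformly close to all. -/
theorem exists_finset_bump (s : ℝ) {A S : Set (Heis n)} (hA : IsCompact A) (hS : IsCompact S)
    {η : ℝ} (hη : 0 < η) : ∃ t : Finset (Heis n), ∀ x ∈ A, ∃ x' ∈ t, ∀ y ∈ S,
      |bump s (hmul (-x) y) - bump s (hmul (-x') y)| ≤ η := by
  have : CompactSpace S := isCompact_iff_compactSpace.1 hS
  let k : C(Heis n × S, ℝ) := ⟨fun p => bump s (hmul (-p.1) p.2.1), (continuous_bump s).comp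
    (continuous_hmul.comp ((continuous_neg.comp continuous_fst).prodMk
      (continuous_subtype_val.comp continuous_snd)))⟩
  let F : Heis n → C(S, ℝ) := fun x => k.curry x
  have hF : Continuous F := k.curry.continuous
  obtain ⟨t, -, ht⟩ := hA.elim_nhds_subcover (fun x' => F ⁻¹' Metric.ball (F x') η)
    fun x' _ => hF.continuousAt.preimage_mem_nhds (Metric.ball_mem_nhds _ hη)
  refine ⟨t, fun x hx => ?_⟩
  obtain ⟨x', hx', h⟩ := Set.mem_iUnion₂.1 (ht hx)
  refine ⟨x', hx', fun y hy => ?_⟩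
  have h1 : dist (F x) (F x') < η := h
  exact ((ContinuousMap.dist_apply_le_dist (⟨y, hy⟩ : S)).trans h1.le)

theorem setLIntegral_dilate {r : ℝ} (hr : 0 < r) (a b : ℝ) (f : Heis n → ENNReal) :
    ∫⁻ x in shell n (r * a) (r * b), f x =
      ENNReal.ofReal (r ^ homDim n) * ∫⁻ x in shell n a b, f (dilation r x) := by
  rw [← lintegral_indicator (isCompact_shell _ _).measurableSet,
    ← lintegral_indicator (isCompact_shell _ _).measurableSet]
  have h := lintegral_dilation hr ((shell n (r * a) (r * b)).indicator f)
  have e : ∀ x, (shell n (r * a) (r * b)).indicator f (dilation r x) =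
      (shell n a b).indicator (fun x => f (dilation r x)) x := by
    intro x
    have : dilation r x ∈ shell n (r * a) (r * b) ↔ x ∈ shell n a b := by
      simp only [shell, Set.mem_ofPred_eq, koranyi_dilation hr, mul_le_mul_iff_right₀ hr]
    by_cases hx : x ∈ shell n a b
    · rw [Set.indicator_of_mem hx, Set.indicator_of_mem (this.2 hx)]
    · rw [Set.indicator_of_notMem hx, Set.indicator_of_notMem (fun h => hx (this.1 h))]
  simp_rw [e] at h
  rw [h, ← mul_assoc, ← ENNReal.ofReal_mul (by positivity), Real.rpow_neg hr.le,
    mul_inv_cancel₀ (by positivity), ENNReal.ofReal_one, one_mul]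

/-- Integrals of a periodic density over the shell `1 / T ≤ |x| ≤ T²` are controlled by those over
the fundamental domain `1 ≤ |x| ≤ T`. -/
theorem exists_lintegral_shell_le {T : ℝ} (hT : 1 < T) {c : ℝ} (hc : 0 < c) :
    ∃ C : ℝ, 0 < C ∧ ∀ f : Heis n → ENNReal,
      (∀ᵐ x, f (dilation T x) = ENNReal.ofReal c * f x) →
      ∫⁻ x in shell n T⁻¹ (T ^ 2), f x ≤ ENNReal.ofReal C * ∫⁻ x in shell n 1 T, f x := by
  have hT0 : 0 < T := by linarith
  set q := T ^ homDim n * c with hq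
  have hq0 : 0 < q := by positivity
  refine ⟨q⁻¹ + 1 + q, by positivity, fun f hf => ?_⟩
  have key : ∀ a b : ℝ, ∫⁻ x in shell n (T * a) (T * b), f x =
      ENNReal.ofReal q * ∫⁻ x in shell n a b, f x := by
    intro a b
    rw [setLIntegral_dilate hT0, lintegral_congr_ae (ae_restrict_of_ae hf),
      lintegral_const_mul' _ _ ENNReal.ofReal_ne_top, ← mul_assoc, hq,
      ENNReal.ofReal_mul (by positivity)]
  have k1 := key 1 T
  have k2 := key T⁻¹ 1
  rw [mul_inv_cancel₀ hT0.ne', mul_one] at k2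
  rw [mul_one] at k1
  have k3 : ∫⁻ x in shell n T⁻¹ 1, f x = ENNReal.ofReal q⁻¹ * ∫⁻ x in shell n 1 T, f x := by
    rw [k2, ← mul_assoc, ← ENNReal.ofReal_mul (by positivity), inv_mul_cancel₀ hq0.ne',
      ENNReal.ofReal_one, one_mul]
  have hsub : shell n T⁻¹ (T ^ 2) ⊆ (shell n T⁻¹ 1 ∪ shell n 1 T) ∪ shell n T (T * T) := by
    rintro x ⟨h1, h2⟩
    rw [sq] at h2
    rcases le_total (koranyi x) 1 with h | h
    · exact Or.inl (Or.inl ⟨h1, h⟩)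
    rcases le_total (koranyi x) T with h' | h'
    · exact Or.inl (Or.inr ⟨h, h'⟩)
    · exact Or.inr ⟨h', h2⟩
  calc ∫⁻ x in shell n T⁻¹ (T ^ 2), f x
      ≤ ∫⁻ x in (shell n T⁻¹ 1 ∪ shell n 1 T) ∪ shell n T (T * T), f x := lintegral_mono_set hsub
    _ ≤ (∫⁻ x in shell n T⁻¹ 1, f x) + (∫⁻ x in shell n 1 T, f x) +
          ∫⁻ x in shell n T (T * T), f x := by
        refine (lintegral_union_le _ _ _).trans (add_le_add_left (lintegral_union_le _ _ _) _)
    _ = _ := by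
        rw [k1, k3, ENNReal.ofReal_add (by positivity) (by positivity),
          ENNReal.ofReal_add (by positivity) (by positivity), ENNReal.ofReal_one]
        ring

theorem exists_pos_mul_sq_le (K : ℝ) {ε δ : ℝ} (hε : 0 < ε) (hδ : 0 < δ) :
    ∃ s : ℝ, 0 < s ∧ s ≤ δ ∧ K * s ^ 2 ≤ ε := by
  have hK : 0 < |K| + 1 := by positivity
  refine ⟨min δ (min 1 (ε / (|K| + 1))), by positivity, min_le_left _ _, ?_⟩
  set s := min δ (min 1 (ε / (|K| + 1))) with hs
  have h0 : 0 < s := by positivity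
  have h1 : s ≤ 1 := (min_le_right _ _).trans (min_le_left _ _)
  have h2 : s ≤ ε / (|K| + 1) := (min_le_right _ _).trans (min_le_right _ _)
  rw [le_div_iff₀ hK] at h2
  have h3 : K ≤ |K| := le_abs_self K
  nlinarith [mul_nonneg h0.le h0.le, abs_nonneg K]

theorem MemL2Loc.lintegral_lt_top {f : Heis n → ℝ} (hf : MemL2Loc f) {K : Set (Heis n)}
    (hK : IsCompact K) (hK0 : K ⊆ {0}ᶜ) : ∫⁻ x in K, ‖f x‖ₑ ^ 2 < ⊤ := by
  have h := (hf K hK hK0).eLpNorm_lt_top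
  rw [eLpNorm_lt_top_iff_lintegral_rpow_enorm_lt_top (by norm_num) (by norm_num)] at h
  simpa using h

theorem MemS1Loc.lintegral_gradSq_lt_top {u : Heis n → ℝ} (hu : MemS1Loc u) {K : Set (Heis n)}
    (hK : IsCompact K) (hK0 : K ⊆ {0}ᶜ) : ∫⁻ x in K, gradSq u x < ⊤ := by
  unfold gradSq
  rw [lintegral_finsetSum' _ fun j _ =>
    (((hu.weakDeriv_spec j).1.aestronglyMeasurable.enorm.pow_const 2).restrict)]
  exact ENNReal.sum_lt_top.2 fun j _ => (hu.weakDeriv_spec j).1.lintegral_lt_top hK hK0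

/-- Away from the common zero set of finitely many mollified evaluations, a Poincaré inequality
holds on `X_T` with an arbitrarily small constant. This expresses the compactness of the embedding
of `X_T` into `L²`. -/
theorem exists_finset_poincare (hn : 1 ≤ n) {T : ℝ} (hT : 1 < T) {θ : ℝ} (hθ : 0 < θ) :
    ∃ (s : ℝ) (t : Finset (Heis n)), ∀ u ∈ periodicSpace n T,
      (∀ x ∈ t, mollify s u (shell n T⁻¹ (T ^ 2)) x = 0) →
      ∫⁻ x in shell n 1 T, ‖u x‖ₑ ^ 2 ≤ ENNReal.ofReal θ * ∫⁻ x in shell n 1 T, gradSq u x := by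
  have hT0 : 0 < T := by linarith
  have hTi : T⁻¹ < 1 := inv_lt_one_of_one_lt₀ hT
  have hTi0 : 0 < T⁻¹ := inv_pos.2 hT0
  set S := shell n T⁻¹ (T ^ 2) with hSdef
  set Ω := shell n 1 T with hΩdef
  have hS : IsCompact S := isCompact_shell _ _
  have hS0 : S ⊆ {0}ᶜ := shell_subset hTi0
  have hΩ : IsCompact Ω := isCompact_shell _ _
  have hΩ0 : Ω ⊆ {0}ᶜ := shell_subset one_pos
  set c := T ^ (-((homDim n - 2) / 2)) with hc
  have hc0 : 0 < c := Real.rpow_pos_of_pos hT0 _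
  obtain ⟨C₁, hC₁, hper₁⟩ := exists_lintegral_shell_le (n := n) hT (c := c ^ 2) (by positivity)
  obtain ⟨C₂, hC₂, hper₂⟩ :=
    exists_lintegral_shell_le (n := n) hT (c := (c * T⁻¹) ^ 2) (by positivity)
  obtain ⟨s, hs0, hsδ, hsθ⟩ := exists_pos_mul_sq_le (2 * 4 ^ 5 * C₂) (ε := θ / 2)
    (δ := (1 - T⁻¹) / 5) (by positivity) (by linarith)
  have hs1 : 5 * s < 1 := by linarith
  -- `5 s ≤ 1 - 1 / T` keeps five steps of length `s` from `Ω_T` inside the shell `1 / T ≤ |x| ≤ T²`.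
  have hs2 : T + 5 * s ≤ T ^ 2 := by
    have h1 : 1 - T⁻¹ ≤ T - 1 := by
      have : 1 - T⁻¹ = (T - 1) * T⁻¹ := by field_simp
      rw [this]
      exact mul_le_of_le_one_right (by linarith) hTi.le
    nlinarith
  set m := ∫ v : Heis n, bump s v with hm
  have hm0 : 0 < m := integral_bump_pos hs0
  set VS := (volume S).toReal with hVS
  set VΩ := (volume Ω).toReal with hVΩ
  have hVS' : volume S = ENNReal.ofReal VS := (ENNReal.ofReal_toReal hS.measure_lt_top.ne).symm
  have hVΩ' : volume Ω = ENNReal.ofReal VΩ := (ENNReal.ofReal_toReal hΩ.measure_lt_top.ne).symm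
  have hVS0 : 0 ≤ VS := ENNReal.toReal_nonneg
  have hVΩ0 : 0 ≤ VΩ := ENNReal.toReal_nonneg
  -- `η` is chosen after `s`, since the mass `m` of the mollifier depends on `s`.
  obtain ⟨η, hη0, -, hη⟩ := exists_pos_mul_sq_le (2 * VS * VΩ * C₁) (ε := m ^ 2 / 2) (δ := 1)
    (by positivity) one_pos
  obtain ⟨t, ht⟩ := exists_finset_bump s hΩ hS hη0
  refine ⟨s, t, fun u hu hut => ?_⟩
  have hu1 : MemL2Loc u := hu.1.1
  have hum := hu1.aestronglyMeasurable
  set I := ∫⁻ x in Ω, ‖u x‖ₑ ^ 2 with hI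
  set D := ∫⁻ x in Ω, gradSq u x with hD
  have hI' : ∫⁻ x in S, ‖u x‖ₑ ^ 2 ≤ ENNReal.ofReal C₁ * I := by
    refine hper₁ _ ?_
    filter_upwards [hu.2] with x hx
    rw [hx, enorm_mul, mul_pow, enorm_sq_eq_ofReal]
  have hD' : ∫⁻ x in S, gradSq u x ≤ ENNReal.ofReal C₂ * D := by
    refine hper₂ _ ?_
    filter_upwards [ae_all_iff.2 fun j => weakDeriv_dilation hT0 hu j] with x hx
    simp only [gradSq, hx, Finset.mul_sum]
    refine Finset.sum_congr rfl fun j _ => ?_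
    rw [enorm_mul, mul_pow, enorm_sq_eq_ofReal]
  -- The mollification is small on `Ω`, as it vanishes at the points of `t`.
  have hmoll : ∀ x ∈ Ω, ‖mollify s u S x‖ₑ ^ 2 ≤
      ENNReal.ofReal (η ^ 2) * (ENNReal.ofReal VS * (ENNReal.ofReal C₁ * I)) := by
    intro x hx
    obtain ⟨x', hx', hxx'⟩ := ht x hx
    have e : mollify s u S x = ∫ y in S, (bump s (hmul (-x) y) - bump s (hmul (-x') y)) * u y := by
      have h := integral_sub (integrableOn_bump_mul hu1 s hS hS0 x)
        (integrableOn_bump_mul hu1 s hS hS0 x')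
      have h' := hut x' hx'
      rw [mollify] at h' ⊢
      rw [h', sub_zero] at h
      rw [← h]
      exact integral_congr_ae (Eventually.of_forall fun y => by simp only; ring)
    have e1 : ‖mollify s u S x‖ₑ ≤ ENNReal.ofReal η * ∫⁻ y in S, ‖u y‖ₑ := by
      rw [e, ← lintegral_const_mul' _ _ ENNReal.ofReal_ne_top]
      refine (enorm_integral_le_lintegral_enorm _).trans ?_
      refine lintegral_mono_ae ((ae_restrict_iff' hS.measurableSet).2
        (Eventually.of_forall fun y hy => ?_))
      rw [enorm_mul, ← ofReal_norm]
      exact mul_le_mul_left (ENNReal.ofReal_le_ofReal (hxx' y hy)) _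
    have e2 := sq_lintegral_le (volume.restrict S) hum.restrict.enorm
    rw [Measure.restrict_apply_univ, hVS'] at e2
    calc ‖mollify s u S x‖ₑ ^ 2 ≤ (ENNReal.ofReal η * ∫⁻ y in S, ‖u y‖ₑ) ^ 2 :=
          pow_le_pow_left' e1 2
      _ = ENNReal.ofReal (η ^ 2) * (∫⁻ y in S, ‖u y‖ₑ) ^ 2 := by
          rw [mul_pow, ENNReal.ofReal_pow hη0.le]
      _ ≤ _ := by gcongr; exact e2.trans (by gcongr)
  have hstay : ∀ x ∈ Ω, ∀ v, koranyi v < s → hmul x v ∈ S := by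
    intro x hx v hv
    refine shell_mono ?_ ?_ (hmul_mem_shell hx hv.le)
    · linarith
    · linarith
  have hslice : ∀ x, AEStronglyMeasurable (fun v => u (hmul x v) - u x) volume := fun x =>
    (hum.comp_quasiMeasurePreserving (measurePreserving_hmul_left x).quasiMeasurePreserving).sub
      aestronglyMeasurable_const
  have hpt : ∀ x ∈ Ω, ENNReal.ofReal (m ^ 2) * ‖u x‖ₑ ^ 2 ≤
      2 * (ENNReal.ofReal m * ∫⁻ v, ENNReal.ofReal (bump s v) * ‖u (hmul x v) - u x‖ₑ ^ 2) +
      2 * (ENNReal.ofReal (η ^ 2) * (ENNReal.ofReal VS * (ENNReal.ofReal C₁ * I))) := by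
    intro x hx
    have h1 := enorm_sub_mollify_sq_le hu1 hS hS0 (hstay x hx) (hslice x)
    have h2 := enorm_add_sq_le (m * u x - mollify s u S x) (mollify s u S x)
    rw [sub_add_cancel, enorm_mul, mul_pow, enorm_sq_eq_ofReal m] at h2
    refine h2.trans ?_
    gcongr
    exact hmoll x hx
  have hint : ENNReal.ofReal (m ^ 2) * I ≤
      2 * (ENNReal.ofReal m * (ENNReal.ofReal m * (4 ^ 5 * (ENNReal.ofReal (s ^ 2) *
        (ENNReal.ofReal C₂ * D))))) +
      2 * (ENNReal.ofReal (η ^ 2) * (ENNReal.ofReal VS * (ENNReal.ofReal C₁ * I))) *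
        ENNReal.ofReal VΩ := by
    rw [hI, ← lintegral_const_mul' _ _ ENNReal.ofReal_ne_top]
    refine (lintegral_mono_ae ((ae_restrict_iff' hΩ.measurableSet).2
      (Eventually.of_forall hpt))).trans ?_
    rw [lintegral_add_right' _ aemeasurable_const, lintegral_const_mul' _ _ (by simp),
      lintegral_const_mul' _ _ ENNReal.ofReal_ne_top, lintegral_const,
      Measure.restrict_apply_univ, hVΩ']
    gcongr
    refine (lintegral_bump_increment_le hn hu.1 hs1).trans ?_
    gcongr
    refine le_trans (lintegral_mono_set (shell_mono ?_ ?_)) hD'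
    · linarith
    · linarith
  -- By the choice of `η`, the term of the mollification is absorbed into the left hand side.
  have hIfin : I ≠ ⊤ := (hu1.lintegral_lt_top hΩ hΩ0).ne
  have hDfin : D ≠ ⊤ := (hu.1.lintegral_gradSq_lt_top hΩ hΩ0).ne
  rw [← ENNReal.ofReal_toReal hIfin, ← ENNReal.ofReal_toReal hDfin] at hint ⊢
  set i := I.toReal
  set d := D.toReal
  have hi0 : 0 ≤ i := ENNReal.toReal_nonneg
  have hd0 : 0 ≤ d := ENNReal.toReal_nonneg
  rw [show (2 : ENNReal) = ENNReal.ofReal 2 by norm_num,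
    show (4 : ENNReal) ^ 5 = ENNReal.ofReal (4 ^ 5) by norm_num] at hint
  rw [← ENNReal.ofReal_mul hθ.le]
  refine ENNReal.ofReal_le_ofReal ?_
  simp only [← ENNReal.ofReal_mul (show (0:ℝ) ≤ 2 by norm_num),
    ← ENNReal.ofReal_mul (show (0:ℝ) ≤ 4 ^ 5 by norm_num), ← ENNReal.ofReal_mul (sq_nonneg η),
    ← ENNReal.ofReal_mul (sq_nonneg s), ← ENNReal.ofReal_mul (sq_nonneg m),
    ← ENNReal.ofReal_mul hm0.le, ← ENNReal.ofReal_mul hC₁.le, ← ENNReal.ofReal_mul hC₂.le,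
    ← ENNReal.ofReal_mul hVS0] at hint
  rw [← ENNReal.ofReal_mul (by positivity), ← ENNReal.ofReal_add (by positivity) (by positivity),
    ENNReal.ofReal_le_ofReal_iff (by positivity)] at hint
  have k1 : 2 * (m * (m * (4 ^ 5 * (s ^ 2 * (C₂ * d))))) ≤ m ^ 2 * (θ / 2) * d := by
    have := mul_le_mul_of_nonneg_right hsθ (by positivity : 0 ≤ m ^ 2 * d)
    nlinarith
  have k2 : 2 * (η ^ 2 * (VS * (C₁ * i))) * VΩ ≤ m ^ 2 / 2 * i := by
    have := mul_le_mul_of_nonneg_right hη hi0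
    nlinarith
  have k3 : m ^ 2 * i ≤ m ^ 2 * (θ * d) := by nlinarith
  exact le_of_mul_le_mul_left k3 (by positivity)

/-! ### The second variation -/

theorem hasDerivAt_abs_rpow_mul_self {q : ℝ} (hq : 0 < q) (r : ℝ) :
    HasDerivAt (fun r : ℝ => |r| ^ q * r) ((q + 1) * |r| ^ q) r := by
  rcases eq_or_ne r 0 with rfl | hr
  · rw [hasDerivAt_iff_tendsto_slope_zero]
    simp only [zero_add, abs_zero, mul_zero, sub_zero, smul_eq_mul, Real.zero_rpow hq.ne']
    have h1 : Tendsto (fun t : ℝ => |t| ^ q) (𝓝[≠] 0) (𝓝 0) := by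
      have : Continuous fun t : ℝ => |t| ^ q := continuous_abs.rpow_const fun _ => Or.inr hq.le
      have h2 := this.tendsto 0
      simp only [abs_zero, Real.zero_rpow hq.ne'] at h2
      exact h2.mono_left nhdsWithin_le_nhds
    refine h1.congr' ?_
    filter_upwards [self_mem_nhdsWithin] with t (ht : t ≠ 0)
    field_simp
  · have h1 := ((hasDerivAt_abs hr).rpow_const (p := q) (Or.inl (abs_ne_zero.2 hr))).mul
      (hasDerivAt_id r)
    refine h1.congr_deriv ?_
    have h2 : |r| ^ q = |r| ^ (q - 1) * |r| := by
      rw [← Real.rpow_add_one (abs_ne_zero.2 hr)]; ring_nf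
    have h3 : (SignType.sign r : ℝ) * r = |r| := sign_mul_self r
    simp only [id, mul_one]
    calc _ = q * |r| ^ (q - 1) * ((SignType.sign r : ℝ) * r) + |r| ^ q := by ring
      _ = _ := by rw [h3, h2]; ring

section Power

variable {X : Type*} [MeasurableSpace X] {μ : Measure X} {f u : X → ℝ} {p : ℝ}

theorem memLp_iff_integrable_abs_rpow (hp : 0 < p) (hf : AEStronglyMeasurable f μ) :
    MemLp f (ENNReal.ofReal p) μ ↔ Integrable (fun x => |f x| ^ p) μ := by
  have h := integrable_norm_rpow_iff hf (p := ENNReal.ofReal p) (by simpa using hp)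
    ENNReal.ofReal_ne_top
  rw [ENNReal.toReal_ofReal hp.le] at h
  exact h.symm

/-- The domination used for differentiating under the integral sign. -/
theorem abs_rpow_mul_le {M a b c : ℝ} (hp : 2 < p) (ha : |a| ≤ M) (hb : |b| ≤ M) (hc : |c| ≤ M) :
    |a| ^ (p - 2) * |b| * |c| ≤ M ^ p := by
  have hM : 0 ≤ M := (abs_nonneg a).trans ha
  have h1 : |a| ^ (p - 2) ≤ M ^ (p - 2) := Real.rpow_le_rpow (abs_nonneg a) ha (by linarith)
  have h2 : M ^ p = M ^ (p - 2) * M * M := by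
    rcases hM.eq_or_lt with rfl | hM'
    · simp [Real.zero_rpow (by linarith : p ≠ 0)]
    · rw [← Real.rpow_add_one hM'.ne', ← Real.rpow_add_one hM'.ne']; ring_nf
  rw [h2]
  have h3 : 0 ≤ |a| ^ (p - 2) := Real.rpow_nonneg (abs_nonneg a) _
  exact mul_le_mul (mul_le_mul h1 hb (abs_nonneg b) (h3.trans h1)) hc (abs_nonneg c)
    (mul_nonneg (h3.trans h1) hM)

/-- First and second derivatives of the `p`-th power integral along a line. -/
theorem hasDerivAt_integral_abs_rpow (hp : 2 < p) (hf : MemLp f (ENNReal.ofReal p) μ)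
    (hu : MemLp u (ENNReal.ofReal p) μ) (s₀ : ℝ) :
    HasDerivAt (fun s => ∫ x, |f x + s * u x| ^ p ∂μ)
      (∫ x, p * (|f x + s₀ * u x| ^ (p - 2) * (f x + s₀ * u x) * u x) ∂μ) s₀ ∧
    HasDerivAt (fun s => ∫ x, p * (|f x + s * u x| ^ (p - 2) * (f x + s * u x) * u x) ∂μ)
      (∫ x, p * ((p - 1) * (|f x + s₀ * u x| ^ (p - 2) * u x * u x)) ∂μ) s₀ := by
  have hp0 : 0 < p := by linarith
  set R := |s₀| + 1 with hR
  set M : X → ℝ := fun x => |f x| + R * |u x| with hM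
  have hMint : Integrable (fun x => M x ^ p) μ := by
    have h1 : MemLp M (ENNReal.ofReal p) μ := hf.abs.add (hu.abs.const_mul R)
    refine ((memLp_iff_integrable_abs_rpow hp0 h1.1).1 h1).congr (Eventually.of_forall fun x => ?_)
    simp only [hM]
    rw [abs_of_nonneg (by positivity)]
  have hball : ∀ s ∈ Metric.ball s₀ 1, |s| ≤ R := by
    intro s hs
    rw [Metric.mem_ball, Real.dist_eq] at hs
    have := abs_sub_abs_le_abs_sub s s₀
    linarith
  have b1 : ∀ s ∈ Metric.ball s₀ 1, ∀ x, |f x + s * u x| ≤ M x := by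
    intro s hs x
    refine (abs_add_le _ _).trans ?_
    rw [abs_mul]
    have := mul_le_mul_of_nonneg_right (hball s hs) (abs_nonneg (u x))
    simp only [hM]; linarith
  have b2 : ∀ x, |u x| ≤ M x := by
    intro x
    have : 1 * |u x| ≤ R * |u x| :=
      mul_le_mul_of_nonneg_right (by rw [hR]; linarith [abs_nonneg s₀]) (abs_nonneg _)
    simp only [hM]; linarith [abs_nonneg (f x)]
  have ml : ∀ s : ℝ, AEStronglyMeasurable (fun x => f x + s * u x) μ := fun s =>
    hf.1.add (hu.1.const_mul s)
  have mr : ∀ (s q : ℝ), 0 ≤ q → AEStronglyMeasurable (fun x => |f x + s * u x| ^ q) μ := fun s q hq =>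
    (continuous_abs.rpow_const fun _ => Or.inr hq).comp_aestronglyMeasurable (ml s)
  have m1 : ∀ s, AEStronglyMeasurable
      (fun x => p * (|f x + s * u x| ^ (p - 2) * (f x + s * u x) * u x)) μ := fun s =>
    (((mr s (p - 2) (by linarith)).mul (ml s)).mul hu.1).const_mul p
  have m2 : ∀ s, AEStronglyMeasurable
      (fun x => p * ((p - 1) * (|f x + s * u x| ^ (p - 2) * u x * u x))) μ := fun s =>
    ((((mr s (p - 2) (by linarith)).mul hu.1).mul hu.1).const_mul (p - 1)).const_mul p
  have bd1 : ∀ s ∈ Metric.ball s₀ 1, ∀ x,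
      ‖p * (|f x + s * u x| ^ (p - 2) * (f x + s * u x) * u x)‖ ≤ p * M x ^ p := by
    intro s hs x
    rw [Real.norm_eq_abs, abs_mul, abs_mul, abs_mul, abs_of_pos hp0,
      abs_of_nonneg (Real.rpow_nonneg (abs_nonneg _) _)]
    exact mul_le_mul_of_nonneg_left (abs_rpow_mul_le hp (b1 s hs x) (b1 s hs x) (b2 x)) hp0.le
  have bd2 : ∀ s ∈ Metric.ball s₀ 1, ∀ x,
      ‖p * ((p - 1) * (|f x + s * u x| ^ (p - 2) * u x * u x))‖ ≤ p * ((p - 1) * M x ^ p) := by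
    intro s hs x
    rw [Real.norm_eq_abs, abs_mul, abs_mul, abs_mul, abs_mul, abs_of_pos hp0,
      abs_of_pos (by linarith : 0 < p - 1), abs_of_nonneg (Real.rpow_nonneg (abs_nonneg _) _)]
    exact mul_le_mul_of_nonneg_left (mul_le_mul_of_nonneg_left
      (abs_rpow_mul_le hp (b1 s hs x) (b2 x) (b2 x)) (by linarith)) hp0.le
  have hlin : ∀ (s : ℝ) x, HasDerivAt (fun s => f x + s * u x) (u x) s := fun s x => by
    simpa using ((hasDerivAt_id s).mul_const (u x)).const_add (f x)
  have hmem := Metric.ball_mem_nhds s₀ one_pos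
  have hs₀ : s₀ ∈ Metric.ball s₀ 1 := Metric.mem_ball_self one_pos
  constructor
  · refine (hasDerivAt_integral_of_dominated_loc_of_deriv_le
      (F := fun s x => |f x + s * u x| ^ p)
      (F' := fun s x => p * (|f x + s * u x| ^ (p - 2) * (f x + s * u x) * u x))
      (bound := fun x => p * M x ^ p) hmem (Eventually.of_forall fun s => mr s p hp0.le) ?_ (m1 s₀)
      (Eventually.of_forall fun x s hs => bd1 s hs x) (hMint.const_mul p)
      (Eventually.of_forall fun x s _ => ?_)).2
    · exact (memLp_iff_integrable_abs_rpow hp0 (ml s₀)).1 (hf.add (hu.const_mul s₀))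
    · refine ((hasDerivAt_abs_rpow (f x + s * u x) (by linarith : 1 < p)).comp s
        (hlin s x)).congr_deriv ?_
      ring
  · refine (hasDerivAt_integral_of_dominated_loc_of_deriv_le
      (F := fun s x => p * (|f x + s * u x| ^ (p - 2) * (f x + s * u x) * u x))
      (F' := fun s x => p * ((p - 1) * (|f x + s * u x| ^ (p - 2) * u x * u x)))
      (bound := fun x => p * ((p - 1) * M x ^ p)) hmem (Eventually.of_forall fun s => m1 s) ?_ (m2 s₀)
      (Eventually.of_forall fun x s hs => bd2 s hs x) ((hMint.const_mul _).const_mul p)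
      (Eventually.of_forall fun x s _ => ?_)).2
    · exact (hMint.const_mul p).mono' (m1 s₀) (Eventually.of_forall fun x => bd1 s₀ hs₀ x)
    · refine (((((hasDerivAt_abs_rpow_mul_self (by linarith : 0 < p - 2)
        (f x + s * u x)).comp s (hlin s x))).mul_const (u x)).const_mul p).congr_deriv ?_
      ring

end Power

theorem iteratedDeriv_two_eq {F F' : ℝ → ℝ} {c : ℝ} (h : ∀ s, HasDerivAt F (F' s) s)
    (h' : HasDerivAt F' c 0) : iteratedDeriv 2 F 0 = c := by
  have e : deriv F = F' := funext fun s => (h s).deriv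
  rw [iteratedDeriv_succ, iteratedDeriv_one, e, h'.deriv]

/-- A function that vanishes off the origin has vanishing `iteratedDeriv 2` there, whether or not it
is continuous. -/
theorem iteratedDeriv_two_eq_zero_of_ne {F : ℝ → ℝ} (h : ∀ s ≠ 0, F s = 0) :
    iteratedDeriv 2 F 0 = 0 := by
  have e : deriv F = fun _ => 0 := by
    funext s
    by_cases hd : DifferentiableAt ℝ F 0
    · have h0 : F 0 = 0 := by
        have h1 : Tendsto F (𝓝[≠] 0) (𝓝 (F 0)) := hd.continuousAt.continuousWithinAt
        have h2 : Tendsto F (𝓝[≠] 0) (𝓝 0) := tendsto_const_nhds.congr' (by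
          filter_upwards [self_mem_nhdsWithin] with t ht
          exact (h t ht).symm)
        exact tendsto_nhds_unique h1 h2
      have hF : F = fun _ => 0 := funext fun t => by
        rcases eq_or_ne t 0 with rfl | ht
        · exact h0
        · exact h t ht
      rw [hF]; simp
    · rcases eq_or_ne s 0 with rfl | hs
      · exact deriv_zero_of_not_differentiableAt hd
      · have : F =ᶠ[𝓝 s] fun _ => 0 := by
          filter_upwards [isOpen_ne.mem_nhds hs] with t ht
          exact h t ht
        rw [this.deriv_eq]; simp
  rw [iteratedDeriv_succ, iteratedDeriv_one, e]; simp

theorem two_lt_critExp (hn : 1 ≤ n) : 2 < critExp n := by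
  have h : (1 : ℝ) ≤ n := by exact_mod_cast hn
  rw [critExp, homDim, lt_div_iff₀ (by linarith)]
  linarith

theorem annulus_eq_shell (T : ℝ) : annulus n T = shell n 1 T := rfl

theorem MemS1Loc.memLp_weakDeriv {u : Heis n → ℝ} (hu : MemS1Loc u) (j : Fin n ⊕ Fin n) (T : ℝ) :
    MemLp (weakDeriv j u) 2 (volume.restrict (annulus n T)) :=
  (hu.weakDeriv_spec j).1 _ (isCompact_shell 1 T) (shell_subset one_pos)

/-- The energy along a line is a quadratic polynomial minus a power integral. -/
theorem energy_line_ae {v u : Heis n → ℝ} (hv : MemS1Loc v) (hu : MemS1Loc u) (T s : ℝ) :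
    energy n T (v + s • u) = ∫ x in annulus n T,
      ((1 / 2) * ∑ j, (weakDeriv j v x + s * weakDeriv j u x) ^ 2
        - (1 / critExp n) * |v x + s * u x| ^ critExp n) := by
  refine integral_congr_ae (ae_restrict_of_ae ?_)
  filter_upwards [ae_all_iff.2 fun j => weakDeriv_add_smul hv hu s j] with x hx
  simp only [hx, Pi.add_apply, Pi.smul_apply, smul_eq_mul]

theorem integrableOn_sum_sq {v u : Heis n → ℝ} (hv : MemS1Loc v) (hu : MemS1Loc u) (T s : ℝ) :
    IntegrableOn (fun x => ∑ j, (weakDeriv j v x + s * weakDeriv j u x) ^ 2) (annulus n T) :=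
  integrable_finsetSum _ fun j _ =>
    ((hv.memLp_weakDeriv j T).add ((hu.memLp_weakDeriv j T).const_mul s)).integrable_sq

/-- The second variation as a quadratic form. -/
theorem secondVariation_eq (hn : 1 ≤ n) {T : ℝ} {v u : Heis n → ℝ} (hv : MemS1Loc v)
    (hu : MemS1Loc u)
    (hvp : MemLp v (ENNReal.ofReal (critExp n)) (volume.restrict (annulus n T)))
    (hup : MemLp u (ENNReal.ofReal (critExp n)) (volume.restrict (annulus n T))) :
    secondVariation (energy n T) v u = (∫ x in annulus n T, ∑ j, weakDeriv j u x ^ 2) -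
      (critExp n - 1) * ∫ x in annulus n T, |v x| ^ (critExp n - 2) * u x ^ 2 := by
  set p := critExp n with hp
  have hp2 : 2 < p := two_lt_critExp hn
  set μ := (volume : Measure (Heis n)).restrict (annulus n T)
  set A := ∫ x, ∑ j, weakDeriv j v x ^ 2 ∂μ
  set B := ∫ x, ∑ j, weakDeriv j v x * weakDeriv j u x ∂μ
  set C := ∫ x, ∑ j, weakDeriv j u x ^ 2 ∂μ with hC
  have iA : Integrable (fun x => ∑ j, weakDeriv j v x ^ 2) μ :=
    integrable_finsetSum _ fun j _ => (hv.memLp_weakDeriv j T).integrable_sq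
  have iB : Integrable (fun x => ∑ j, weakDeriv j v x * weakDeriv j u x) μ :=
    integrable_finsetSum _ fun j _ => (hv.memLp_weakDeriv j T).integrable_mul (hu.memLp_weakDeriv j T)
  have iC : Integrable (fun x => ∑ j, weakDeriv j u x ^ 2) μ :=
    integrable_finsetSum _ fun j _ => (hu.memLp_weakDeriv j T).integrable_sq
  have hquad : ∀ s, ∫ x, ∑ j, (weakDeriv j v x + s * weakDeriv j u x) ^ 2 ∂μ =
      A + 2 * s * B + s ^ 2 * C := by
    intro s
    have e : ∀ x, ∑ j, (weakDeriv j v x + s * weakDeriv j u x) ^ 2 = (∑ j, weakDeriv j v x ^ 2 +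
        2 * s * ∑ j, weakDeriv j v x * weakDeriv j u x) + s ^ 2 * ∑ j, weakDeriv j u x ^ 2 := by
      intro x
      rw [Finset.mul_sum, Finset.mul_sum, ← Finset.sum_add_distrib, ← Finset.sum_add_distrib]
      exact Finset.sum_congr rfl fun j _ => by ring
    simp_rw [e]
    have i1 : Integrable (fun x => ∑ j, weakDeriv j v x ^ 2 +
        2 * s * ∑ j, weakDeriv j v x * weakDeriv j u x) μ := iA.add (iB.const_mul _)
    rw [integral_add i1 (iC.const_mul _), integral_add iA (iB.const_mul _), integral_const_mul,
      integral_const_mul]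
  have hline : (fun s : ℝ => energy n T (v + s • u)) = fun s =>
      (1 / 2) * (A + 2 * s * B + s ^ 2 * C) - (1 / p) * ∫ x, |v x + s * u x| ^ p ∂μ := by
    funext s
    rw [energy_line_ae hv hu, integral_sub, integral_const_mul, integral_const_mul, hquad]
    · exact (integrableOn_sum_sq hv hu T s).const_mul _
    · have h : MemLp (fun x => v x + s * u x) (ENNReal.ofReal p) μ := hvp.add (hup.const_mul s)
      exact ((memLp_iff_integrable_abs_rpow (by linarith) h.1).1 h).const_mul _
  have hD := hasDerivAt_integral_abs_rpow hp2 hvp hup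
  have d1 : ∀ s, HasDerivAt (fun s : ℝ => (1 / 2) * (A + 2 * s * B + s ^ 2 * C) -
      (1 / p) * ∫ x, |v x + s * u x| ^ p ∂μ) ((B + s * C) - (1 / p) *
      ∫ x, p * (|v x + s * u x| ^ (p - 2) * (v x + s * u x) * u x) ∂μ) s := by
    intro s
    refine HasDerivAt.sub ?_ ((hD s).1.const_mul _)
    have h1 : HasDerivAt (fun s : ℝ => 2 * s * B) (2 * 1 * B) s :=
      ((hasDerivAt_id s).const_mul 2).mul_const B
    have h2 : HasDerivAt (fun s : ℝ => s ^ 2 * C) ((2 : ℕ) * s ^ (2 - 1) * C) s :=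
      (hasDerivAt_pow 2 s).mul_const C
    refine (((h1.const_add A).add h2).const_mul (1 / 2)).congr_deriv ?_
    norm_num; ring
  have d2 : HasDerivAt (fun s : ℝ => (B + s * C) - (1 / p) *
      ∫ x, p * (|v x + s * u x| ^ (p - 2) * (v x + s * u x) * u x) ∂μ) (C - (1 / p) *
      ∫ x, p * ((p - 1) * (|v x + 0 * u x| ^ (p - 2) * u x * u x)) ∂μ) 0 := by
    refine HasDerivAt.sub ?_ ((hD 0).2.const_mul _)
    simpa using ((hasDerivAt_id (0:ℝ)).mul_const C).const_add B
  rw [secondVariation, hline, iteratedDeriv_two_eq d1 d2, integral_const_mul, integral_const_mul]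
  have e : ∀ x, |v x + 0 * u x| ^ (p - 2) * u x * u x = |v x| ^ (p - 2) * u x ^ 2 := fun x => by
    rw [zero_mul, add_zero]; ring
  simp_rw [e]
  have hp0 : p ≠ 0 := by linarith
  field_simp

/-- If `|u|^{2*}` is not integrable over `Ω_T`, then neither is the energy density of `v + s u` for
`s ≠ 0`, so the energy along this line carries no second order information and such a `u` is not a
negative direction. By the Folland-Stein embedding of `S¹_loc` into `L^{2*}_loc` there are no such `u`
in `S¹_loc`; treating the case directly makes the embedding unnecessary. -/
theorem secondVariation_eq_zero (hn : 1 ≤ n) {T : ℝ} {v u : Heis n → ℝ} (hv : MemS1Loc v)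
    (hu : MemS1Loc u)
    (hvp : MemLp v (ENNReal.ofReal (critExp n)) (volume.restrict (annulus n T)))
    (hup : ¬ MemLp u (ENNReal.ofReal (critExp n)) (volume.restrict (annulus n T))) :
    secondVariation (energy n T) v u = 0 := by
  set p := critExp n with hp
  have hp2 : 2 < p := two_lt_critExp hn
  refine iteratedDeriv_two_eq_zero_of_ne fun s hs => ?_
  rw [energy_line_ae hv hu]
  refine integral_undef fun hint => hup ?_
  have h1 := ((integrableOn_sum_sq hv hu T s).const_mul (1 / 2)).sub hint
  have h2 : Integrable (fun x => |v x + s * u x| ^ p) (volume.restrict (annulus n T)) := by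
    refine (h1.const_mul p).congr (Eventually.of_forall fun x => ?_)
    have hp0 : p ≠ 0 := by linarith
    simp only [Pi.sub_apply]
    rw [← hp, sub_sub_cancel, ← mul_assoc, mul_one_div_cancel hp0, one_mul]
  have h3 : AEStronglyMeasurable (fun x => v x + s * u x) (volume.restrict (annulus n T)) :=
    (hv.1.aestronglyMeasurable.add (hu.1.aestronglyMeasurable.const_mul s)).restrict
  have h4 := (((memLp_iff_integrable_abs_rpow (by linarith) h3).2 h2).sub hvp).const_mul s⁻¹
  refine h4.ae_eq (Eventually.of_forall fun x => ?_)
  simp only [Pi.sub_apply]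
  field_simp
  ring

/-! ### Finiteness of the Morse index -/

theorem IsHomogeneousSolution.memS1Loc {Ψ : Heis n → ℝ} (hΨ : IsHomogeneousSolution Ψ) :
    MemS1Loc Ψ := memS1Loc_of_contDiffOn (hΨ.contDiffOn.of_le (by norm_num))

theorem IsHomogeneousSolution.mem_periodicSpace {Ψ : Heis n → ℝ} (hΨ : IsHomogeneousSolution Ψ)
    {T : ℝ} (hT : 0 < T) : Ψ ∈ periodicSpace n T := by
  refine ⟨hΨ.memS1Loc, ?_⟩
  filter_upwards [ae_ne_zero] with x hx
  exact hΨ.homogeneous T hT x hx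

theorem IsHomogeneousSolution.memLp {Ψ : Heis n → ℝ} (hΨ : IsHomogeneousSolution Ψ) (T : ℝ)
    (q : ENNReal) : MemLp Ψ q (volume.restrict (annulus n T)) :=
  memLp_restrict_of_continuousOn hΨ.contDiffOn.continuousOn q (isCompact_shell 1 T)
    (shell_subset one_pos)

/-- The mollified evaluation at `x` as a linear functional on `X_T`. -/
def mollifyL (n : ℕ) (T s : ℝ) {S : Set (Heis n)} (hS : IsCompact S) (hS0 : S ⊆ {0}ᶜ) (x : Heis n) :
    periodicSpace n T →ₗ[ℝ] ℝ where
  toFun u := mollify s u S x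
  map_add' u v := by
    have h := integral_add (integrableOn_bump_mul u.2.1.1 s hS hS0 x)
      (integrableOn_bump_mul v.2.1.1 s hS hS0 x)
    simp only [mollify, Submodule.coe_add, Pi.add_apply, mul_add]
    exact h
  map_smul' c u := by
    simp only [mollify, Submodule.coe_smul, Pi.smul_apply, smul_eq_mul, RingHom.id_apply]
    rw [← integral_const_mul]
    exact integral_congr_ae (Eventually.of_forall fun y => by ring)

/-- A negative definite subspace embeds into the values of the finitely many mollified evaluations of
the Poincaré inequality. -/
theorem IsHomogeneousSolution.morseIndex_lt_top (hn : 1 ≤ n) {Ψ : Heis n → ℝ}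
    (hΨ : IsHomogeneousSolution Ψ) {T : ℝ} (hT : 1 < T) :
    morseIndex (periodicSpace n T) (energy n T) Ψ < ⊤ := by
  have hT0 : 0 < T := by linarith
  set p := critExp n with hp
  have hp2 : 2 < p := two_lt_critExp hn
  have hΩ : IsCompact (annulus n T) := isCompact_shell 1 T
  have hΩ0 : annulus n T ⊆ {0}ᶜ := shell_subset one_pos
  have hcont : ContinuousOn (fun x => |Ψ x| ^ (p - 2)) (annulus n T) :=
    ((hΨ.contDiffOn.continuousOn.mono hΩ0).abs).rpow_const fun _ _ => Or.inr (by linarith)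
  obtain ⟨M₀, hM₀⟩ := hΩ.exists_bound_of_continuousOn hcont
  set M := |M₀| + 1 with hM
  have hM1 : 0 < M := by positivity
  have hMb : ∀ x ∈ annulus n T, |Ψ x| ^ (p - 2) ≤ M := fun x hx =>
    (le_abs_self _).trans ((hM₀ x hx).trans ((le_abs_self _).trans (by simp [hM])))
  -- With this Poincaré constant the gradient term dominates `(p - 1) M ∫ u²`.
  have hθ : 0 < 1 / ((p - 1) * M) := by
    have : 0 < p - 1 := by linarith
    positivity
  obtain ⟨s, t, ht⟩ := exists_finset_poincare hn hT hθ
  refine lt_of_le_of_lt (b := (t.card : ℕ∞)) ?_ (ENat.natCast_lt_top _)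
  refine iSup₂_le fun V hV => ?_
  obtain ⟨hVX, hVfin, hneg⟩ := hV
  rw [Nat.cast_le]
  by_contra hcard
  have hS : IsCompact (shell n T⁻¹ (T ^ 2)) := isCompact_shell _ _
  have hS0 : shell n T⁻¹ (T ^ 2) ⊆ {0}ᶜ := shell_subset (inv_pos.2 hT0)
  let ℓ : V →ₗ[ℝ] (t → ℝ) := LinearMap.pi fun x =>
    (mollifyL n T s hS hS0 x.1).comp (Submodule.inclusion hVX)
  have hker : LinearMap.ker ℓ ≠ ⊥ := LinearMap.ker_ne_bot_of_finrank_lt (by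
    simpa using hcard)
  obtain ⟨⟨u, huV⟩, huℓ, hu0⟩ := (Submodule.ne_bot_iff _).1 hker
  have hu0' : u ≠ 0 := fun h => hu0 (Subtype.ext h)
  have huX := hVX huV
  have hpoin := ht u huX fun x hx => congrFun (LinearMap.mem_ker.1 huℓ) ⟨x, hx⟩
  have hvar := hneg u huV hu0'
  have hΨp := hΨ.memLp T (ENNReal.ofReal p)
  by_cases hup : MemLp u (ENNReal.ofReal p) (volume.restrict (annulus n T))
  · rw [secondVariation_eq hn hΨ.memS1Loc huX.1 hΨp hup, ← hp] at hvar
    have iu : Integrable (fun x => u x ^ 2) (volume.restrict (annulus n T)) :=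
      (huX.1.1 _ hΩ hΩ0).integrable_sq
    have ig : Integrable (fun x => ∑ j, weakDeriv j u x ^ 2) (volume.restrict (annulus n T)) :=
      integrable_finsetSum _ fun j _ => (huX.1.memLp_weakDeriv j T).integrable_sq
    have h1 : ∫ x in annulus n T, |Ψ x| ^ (p - 2) * u x ^ 2 ≤ M * ∫ x in annulus n T, u x ^ 2 := by
      rw [← integral_const_mul]
      refine integral_mono_of_nonneg (Eventually.of_forall fun x => by positivity)
        (iu.const_mul M) ((ae_restrict_iff' hΩ.measurableSet).2 (Eventually.of_forall fun x hx => ?_))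
      exact mul_le_mul_of_nonneg_right (hMb x hx) (sq_nonneg _)
    have h2 : ∫ x in annulus n T, u x ^ 2 ≤
        1 / ((p - 1) * M) * ∫ x in annulus n T, ∑ j, weakDeriv j u x ^ 2 := by
      rw [← ENNReal.ofReal_le_ofReal_iff (mul_nonneg hθ.le (integral_nonneg fun x =>
        Finset.sum_nonneg fun j _ => sq_nonneg _)), ENNReal.ofReal_mul hθ.le,
        ofReal_integral_eq_lintegral_ofReal iu (Eventually.of_forall fun x => sq_nonneg _),
        ofReal_integral_eq_lintegral_ofReal ig (Eventually.of_forall fun x =>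
          Finset.sum_nonneg fun j _ => sq_nonneg _)]
      simp only [enorm_sq_eq_ofReal, gradSq] at hpoin
      simp only [ENNReal.ofReal_sum_of_nonneg fun (j : Fin n ⊕ Fin n) _ => sq_nonneg _]
      exact hpoin
    have hp1 : 0 < p - 1 := by linarith
    have h3 := mul_le_mul_of_nonneg_left (h1.trans (mul_le_mul_of_nonneg_left h2 hM1.le)) hp1.le
    have h4 : (p - 1) * (M * (1 / ((p - 1) * M) * ∫ x in annulus n T, ∑ j, weakDeriv j u x ^ 2)) =
        ∫ x in annulus n T, ∑ j, weakDeriv j u x ^ 2 := by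
      field_simp
    linarith
  · rw [secondVariation_eq_zero hn hΨ.memS1Loc huX.1 hΨp hup] at hvar
    exact lt_irrefl _ hvar

/-! ### Integration in logarithmic polar coordinates -/

/-- The logarithmic radius `log |x|`. At the origin it takes the junk value `0`. -/
def logRadius (x : Heis n) : ℝ := Real.log (koranyi x)

theorem measurable_logRadius : Measurable (logRadius : Heis n → ℝ) :=
  Real.measurable_log.comp continuous_koranyi.measurable

theorem logRadius_dilation {r : ℝ} (hr : 0 < r) {x : Heis n} (hx : x ≠ 0) :
    logRadius (dilation r x) = Real.log r + logRadius x := by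
  rw [logRadius, koranyi_dilation hr, Real.log_mul hr.ne' (koranyi_pos hx).ne', logRadius]

theorem mem_shell_exp_iff {x : Heis n} (hx : x ≠ 0) (a b : ℝ) :
    x ∈ shell n (Real.exp a) (Real.exp b) ↔ logRadius x ∈ Set.Icc a b := by
  rw [Set.mem_Icc, logRadius, Real.le_log_iff_exp_le (koranyi_pos hx),
    Real.log_le_iff_le_exp (koranyi_pos hx)]
  rfl

theorem contDiffOn_logRadius : ContDiffOn ℝ ∞ (logRadius : Heis n → ℝ) {0}ᶜ := by
  have h : ∀ x ∈ ({0}ᶜ : Set (Heis n)), logRadius x = (1 / 4) * Real.log (gauge4 x) := by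
    intro x hx
    rw [logRadius, koranyi_eq, Real.log_rpow (gauge4_pos hx)]
  refine ContDiffOn.congr ?_ h
  exact contDiffOn_const.mul (contDiff_gauge4.contDiffOn.log fun x hx => (gauge4_pos hx).ne')

/-- Continuous functions on the punctured group that are homogeneous of degree `-Q`, the degree at
which densities are invariant under dilations. -/
def IsCritHomogeneous (F : Heis n → ℝ) : Prop :=
  ContinuousOn F {0}ᶜ ∧ ∀ r : ℝ, 0 < r → ∀ x, x ≠ 0 → F (dilation r x) = r ^ (-homDim n) * F x

theorem aemeasurable_of_continuousOn {F : Heis n → ℝ} (hF : ContinuousOn F {0}ᶜ) :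
    AEMeasurable F volume :=
  (memL2Loc_of_continuousOn hF).aestronglyMeasurable.aemeasurable

/-- A density of degree `-Q` is pushed forward by the logarithmic radius to a translation invariant
measure, that is, to a multiple of Lebesgue measure. -/
theorem IsCritHomogeneous.exists_map_eq {F : Heis n → ℝ} (hF : IsCritHomogeneous F) :
    ∃ c : NNReal, Measure.map logRadius (volume.withDensity fun x => ENNReal.ofReal (F x)) =
      c • (volume : Measure ℝ) := by
  set ν : Measure (Heis n) := volume.withDensity fun x => ENNReal.ofReal (F x) with hν
  set μ : Measure ℝ := Measure.map logRadius ν with hμ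
  have happ : ∀ B : Set ℝ, MeasurableSet B →
      μ B = ∫⁻ x, (logRadius ⁻¹' B).indicator (fun x => ENNReal.ofReal (F x)) x := by
    intro B hB
    rw [hμ, Measure.map_apply measurable_logRadius hB, hν,
      withDensity_apply _ (measurable_logRadius hB), lintegral_indicator (measurable_logRadius hB)]
  have hinv : Measure.IsAddLeftInvariant μ := by
    refine ⟨fun s => Measure.ext fun B hB => ?_⟩
    have hB' : MeasurableSet ((fun x => s + x) ⁻¹' B) := (measurable_const_add s) hB
    rw [Measure.map_apply (measurable_const_add s) hB, happ _ hB', happ _ hB]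
    set r := Real.exp s
    have hr : 0 < r := Real.exp_pos s
    have h := lintegral_dilation (n := n) hr
      ((logRadius ⁻¹' B).indicator fun x => ENNReal.ofReal (F x))
    have e : ∫⁻ x, (logRadius ⁻¹' B).indicator (fun x => ENNReal.ofReal (F x)) (dilation r x) =
        ∫⁻ x : Heis n, ENNReal.ofReal (r ^ (-homDim n)) *
          (logRadius ⁻¹' ((fun x => s + x) ⁻¹' B)).indicator (fun x => ENNReal.ofReal (F x)) x := by
      refine lintegral_congr_ae ?_
      filter_upwards [ae_ne_zero] with x hx
      have hrho : logRadius (dilation r x) = s + logRadius x := by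
        rw [logRadius_dilation hr hx, Real.log_exp]
      by_cases hxB : s + logRadius x ∈ B
      · rw [Set.indicator_of_mem (by rw [Set.mem_preimage, hrho]; exact hxB),
          Set.indicator_of_mem (by exact hxB), hF.2 r hr x hx, ENNReal.ofReal_mul (by positivity)]
      · rw [Set.indicator_of_notMem (by rw [Set.mem_preimage, hrho]; exact hxB),
          Set.indicator_of_notMem (by exact hxB), mul_zero]
    rw [e, lintegral_const_mul' _ _ ENNReal.ofReal_ne_top] at h
    exact (ENNReal.mul_right_inj (by simpa using Real.rpow_pos_of_pos hr _)
      ENNReal.ofReal_ne_top).1 h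
  have hfin : IsFiniteMeasureOnCompacts μ := by
    refine ⟨fun K hK => ?_⟩
    obtain ⟨R, hR⟩ := hK.isBounded.subset_closedBall 0
    rw [Real.closedBall_eq_Icc, zero_sub, zero_add] at hR
    refine (measure_mono hR).trans_lt ?_
    rw [happ _ measurableSet_Icc]
    set A := shell n (Real.exp (-R)) (Real.exp R)
    have hA : IsCompact A := isCompact_shell _ _
    have hint : IntegrableOn F A := memLp_one_iff_integrable.1
      (memLp_restrict_of_continuousOn hF.1 1 hA (shell_subset (Real.exp_pos _)))
    refine lt_of_le_of_lt ?_ hint.2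
    rw [← lintegral_indicator hA.measurableSet]
    refine lintegral_mono_ae ?_
    filter_upwards [ae_ne_zero] with x hx
    by_cases hxA : x ∈ A
    · rw [Set.indicator_of_mem hxA]
      refine (Set.indicator_le_self _ _ x).trans ?_
      exact Real.ofReal_le_enorm (F x)
    · rw [Set.indicator_of_notMem hxA, Set.indicator_of_notMem
        (show x ∉ logRadius ⁻¹' Set.Icc (-R) R from
        fun h => hxA ((mem_shell_exp_iff hx _ _).2 h))]
  exact ⟨_, Measure.isAddLeftInvariant_eq_smul μ volume⟩

/-- Integration in logarithmic polar coordinates against the positive part of a critical density. -/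
theorem setIntegral_shell_eq {F : Heis n → ℝ} (hF : IsCritHomogeneous F) {c : NNReal}
    (hc : Measure.map logRadius (volume.withDensity fun x => ENNReal.ofReal (F x)) =
      c • (volume : Measure ℝ)) {a b : ℝ} (hab : a ≤ b) {g : ℝ → ℝ} (hg : Continuous g) :
    ∫ x in shell n (Real.exp a) (Real.exp b), max (F x) 0 * g (logRadius x) =
      c * ∫ s in a..b, g s := by
  have hm : AEMeasurable (fun x => ENNReal.ofReal (F x)) (volume : Measure (Heis n)) :=
    (aemeasurable_of_continuousOn hF.1).ennreal_ofReal
  have h1 : ∫ x, (Set.Icc a b).indicator g (logRadius x)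
      ∂(volume.withDensity fun x : Heis n => ENNReal.ofReal (F x)) = c * ∫ s in a..b, g s := by
    rw [← integral_map (φ := logRadius) measurable_logRadius.aemeasurable
      (hg.measurable.indicator measurableSet_Icc).aestronglyMeasurable, hc,
      integral_smul_nnreal_measure, integral_indicator measurableSet_Icc,
      intervalIntegral.integral_of_le hab, ← integral_Icc_eq_integral_Ioc]
    rfl
  rw [← h1, integral_withDensity_eq_integral_toReal_smul₀ hm
    (Eventually.of_forall fun x => ENNReal.ofReal_lt_top),
    ← integral_indicator (isCompact_shell _ _).measurableSet]
  refine integral_congr_ae ?_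
  filter_upwards [ae_ne_zero] with x hx
  by_cases hxs : x ∈ shell n (Real.exp a) (Real.exp b)
  · rw [Set.indicator_of_mem hxs, Set.indicator_of_mem ((mem_shell_exp_iff hx a b).1 hxs),
      ENNReal.toReal_ofReal', smul_eq_mul]
  · rw [Set.indicator_of_notMem hxs, Set.indicator_of_notMem
      (fun h => hxs ((mem_shell_exp_iff hx a b).2 h)), smul_zero]

theorem IsCritHomogeneous.neg {F : Heis n → ℝ} (hF : IsCritHomogeneous F) :
    IsCritHomogeneous fun x => -F x :=
  ⟨hF.1.neg, fun r hr x hx => by simp only [hF.2 r hr x hx]; ring⟩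

theorem IsCritHomogeneous.integrableOn {F : Heis n → ℝ} (hF : IsCritHomogeneous F) (a b : ℝ)
    {g : ℝ → ℝ} (hg : Continuous g) :
    IntegrableOn (fun x => F x * g (logRadius x)) (shell n (Real.exp a) (Real.exp b)) := by
  have h : ContinuousOn (fun x => F x * g (logRadius x)) {0}ᶜ :=
    hF.1.mul (hg.comp_continuousOn contDiffOn_logRadius.continuousOn)
  exact memLp_one_iff_integrable.1 (memLp_restrict_of_continuousOn h 1 (isCompact_shell _ _)
    (shell_subset (Real.exp_pos _)))

/-- Integration in logarithmic polar coordinates; the constant is the integral of `F` over a unit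
logarithmic length. -/
theorem IsCritHomogeneous.exists_integral_eq {F : Heis n → ℝ} (hF : IsCritHomogeneous F) :
    ∃ c : ℝ, ∀ (a b : ℝ), a ≤ b → ∀ g : ℝ → ℝ, Continuous g →
      ∫ x in shell n (Real.exp a) (Real.exp b), F x * g (logRadius x) = c * ∫ s in a..b, g s := by
  obtain ⟨c, hc⟩ := hF.exists_map_eq
  obtain ⟨c', hc'⟩ := hF.neg.exists_map_eq
  refine ⟨c - c', fun a b hab g hg => ?_⟩
  have h1 := setIntegral_shell_eq hF hc hab hg
  have h2 := setIntegral_shell_eq hF.neg hc' hab hg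
  have hpos : IsCritHomogeneous fun x => max (F x) 0 :=
    ⟨(continuous_id.max continuous_const).comp_continuousOn hF.1, fun r hr x hx => by
      simp only
      rw [hF.2 r hr x hx, mul_max_of_nonneg _ _ (by positivity), mul_zero]⟩
  have hneg : IsCritHomogeneous fun x => max (-F x) 0 :=
    ⟨(continuous_id.max continuous_const).comp_continuousOn hF.1.neg, fun r hr x hx => by
      simp only
      rw [hF.2 r hr x hx, mul_max_of_nonneg _ _ (by positivity), mul_zero, mul_neg]⟩
  rw [sub_mul, ← h1, ← h2, ← integral_sub (hpos.integrableOn a b hg) (hneg.integrableOn a b hg)]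
  refine integral_congr_ae (Eventually.of_forall fun x => ?_)
  have : F x = max (F x) 0 - max (-F x) 0 := by
    rcases le_total (F x) 0 with h | h
    · rw [max_eq_right h, max_eq_left (by linarith)]; ring
    · rw [max_eq_left h, max_eq_right (by linarith)]; ring
  simp only
  rw [← sub_mul, ← this]

theorem IsCritHomogeneous.exists_integral_eq_of_pos {F : Heis n → ℝ} (hF : IsCritHomogeneous F)
    (hpos : ∀ x, x ≠ 0 → 0 < F x) :
    ∃ c : ℝ, 0 < c ∧ ∀ (a b : ℝ), a ≤ b → ∀ g : ℝ → ℝ, Continuous g →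
      ∫ x in shell n (Real.exp a) (Real.exp b), F x * g (logRadius x) = c * ∫ s in a..b, g s := by
  obtain ⟨c, hc⟩ := hF.exists_map_eq
  refine ⟨c, ?_, fun a b hab g hg => ?_⟩
  · refine lt_of_le_of_ne c.2 fun h0 => ?_
    have h0' : c = 0 := NNReal.eq h0.symm
    rw [h0', zero_smul, Measure.map_eq_zero_iff measurable_logRadius.aemeasurable,
      withDensity_eq_zero_iff (aemeasurable_of_continuousOn hF.1).ennreal_ofReal] at hc
    have : ∀ᵐ x : Heis n, False := by
      filter_upwards [hc, ae_ne_zero] with x h1 h2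
      have := hpos x h2
      simp only [Pi.zero_apply, ENNReal.ofReal_eq_zero] at h1
      linarith
    rw [eventually_false_iff_eq_bot, ae_eq_bot] at this
    exact (NeZero.ne (volume : Measure (Heis n))) this
  · rw [← setIntegral_shell_eq hF hc hab hg]
    refine setIntegral_congr_fun (isCompact_shell _ _).measurableSet fun x hx => ?_
    rw [max_eq_left (hpos x (shell_subset (Real.exp_pos _) hx)).le]

/-! ### The second variation at `Ψ` in directions `h(log |x|) Ψ` -/

theorem homDim_sub_two_pos (hn : 1 ≤ n) : 0 < homDim n - 2 := by
  have h : (1 : ℝ) ≤ n := by exact_mod_cast hn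
  rw [homDim]; linarith

/-- Horizontal derivatives lower the degree of homogeneity by one. -/
theorem hDeriv_dilation_of_eq {f : Heis n → ℝ} {r c d : ℝ} (hr : 0 < r)
    (hf : DifferentiableOn ℝ f {0}ᶜ) (h : ∀ x, x ≠ 0 → f (dilation r x) = c * f x + d)
    (j : Fin n ⊕ Fin n) {x : Heis n} (hx : x ≠ 0) :
    hDeriv j f (dilation r x) = c * r⁻¹ * hDeriv j f x := by
  have hd : ∀ x, x ≠ 0 → DifferentiableAt ℝ f x := fun x hx =>
    hf.differentiableAt (isOpen_punctured.mem_nhds hx)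
  have h1 := hDeriv_dilation (hd _ (dilation_ne_zero hr hx)) j
  have h2 : (fun y => f (dilation r y)) =ᶠ[𝓝 x] fun y => c * f y + d := by
    filter_upwards [isOpen_punctured.mem_nhds hx] with y hy
    exact h y hy
  have h3 : hDeriv j (fun y => f (dilation r y)) x = c * hDeriv j f x := by
    rw [hDeriv, h2.fderiv_eq, fderiv_add_const, fderiv_const_mul (hd x hx)]
    rfl
  rw [h3] at h1
  field_simp
  linarith

section Solution

variable {Ψ : Heis n → ℝ}

theorem hDeriv_logRadius_dilation {r : ℝ} (hr : 0 < r) (j : Fin n ⊕ Fin n) {x : Heis n}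
    (hx : x ≠ 0) : hDeriv j logRadius (dilation r x) = r⁻¹ * hDeriv j logRadius x := by
  have h := hDeriv_dilation_of_eq (f := logRadius) (c := 1) (d := Real.log r) hr
    (contDiffOn_logRadius.differentiableOn (by simp))
    (fun x hx => by rw [logRadius_dilation hr hx]; ring) j hx
  rwa [one_mul] at h

theorem continuousOn_hDeriv_logRadius (j : Fin n ⊕ Fin n) :
    ContinuousOn (hDeriv j (logRadius : Heis n → ℝ)) {0}ᶜ :=
  (contDiffOn_hDeriv (m := 0) contDiffOn_logRadius (by simp) j).continuousOn

theorem IsHomogeneousSolution.differentiableOn (hΨ : IsHomogeneousSolution Ψ) :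
    DifferentiableOn ℝ Ψ {0}ᶜ := hΨ.contDiffOn.differentiableOn (by simp)

theorem IsHomogeneousSolution.hDeriv_dilation (hΨ : IsHomogeneousSolution Ψ) {r : ℝ} (hr : 0 < r)
    (j : Fin n ⊕ Fin n) {x : Heis n} (hx : x ≠ 0) :
    hDeriv j Ψ (dilation r x) = r ^ (-((homDim n - 2) / 2)) * r⁻¹ * hDeriv j Ψ x :=
  hDeriv_dilation_of_eq (d := 0) hr hΨ.differentiableOn
    (fun x hx => by rw [hΨ.homogeneous r hr x hx, add_zero]) j hx

theorem IsHomogeneousSolution.contDiffOn_hDeriv (hΨ : IsHomogeneousSolution Ψ) (j : Fin n ⊕ Fin n) :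
    ContDiffOn ℝ 1 (hDeriv j Ψ) {0}ᶜ :=
  Heisenberg.contDiffOn_hDeriv hΨ.contDiffOn (by norm_num) j

theorem rpow_sq_mul_inv_sq {r : ℝ} (hr : 0 < r) (n : ℕ) :
    (r ^ (-((homDim n - 2) / 2)) * r⁻¹) ^ 2 = r ^ (-homDim n) := by
  rw [← Real.rpow_neg_one, ← Real.rpow_add hr, ← Real.rpow_natCast, ← Real.rpow_mul hr.le]
  congr 1
  push_cast; ring

theorem IsHomogeneousSolution.isCritHomogeneous_power (hn : 1 ≤ n) (hΨ : IsHomogeneousSolution Ψ) :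
    IsCritHomogeneous fun x => Ψ x ^ critExp n := by
  refine ⟨hΨ.contDiffOn.continuousOn.rpow_const fun x hx => Or.inl (hΨ.pos x hx).ne',
    fun r hr x hx => ?_⟩
  have hQ := homDim_sub_two_pos hn
  simp only
  rw [hΨ.homogeneous r hr x hx, Real.mul_rpow (by positivity) (hΨ.pos x hx).le,
    ← Real.rpow_mul hr.le]
  congr 2
  rw [critExp]
  field_simp

theorem IsHomogeneousSolution.isCritHomogeneous_grad (hΨ : IsHomogeneousSolution Ψ) :
    IsCritHomogeneous fun x => ∑ j, hDeriv j Ψ x ^ 2 := by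
  refine ⟨continuousOn_finsetSum _ fun j _ => (hΨ.contDiffOn_hDeriv j).continuousOn.pow 2,
    fun r hr x hx => ?_⟩
  simp only
  rw [Finset.mul_sum, ← rpow_sq_mul_inv_sq hr]
  refine Finset.sum_congr rfl fun j _ => ?_
  rw [hΨ.hDeriv_dilation hr j hx]; ring

theorem IsHomogeneousSolution.isCritHomogeneous_cross (hΨ : IsHomogeneousSolution Ψ) :
    IsCritHomogeneous fun x => Ψ x * ∑ j, hDeriv j Ψ x * hDeriv j logRadius x := by
  refine ⟨hΨ.contDiffOn.continuousOn.mul (continuousOn_finsetSum _ fun j _ =>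
    (hΨ.contDiffOn_hDeriv j).continuousOn.mul (continuousOn_hDeriv_logRadius j)),
    fun r hr x hx => ?_⟩
  simp only
  rw [Finset.mul_sum, Finset.mul_sum, Finset.mul_sum, ← rpow_sq_mul_inv_sq hr]
  refine Finset.sum_congr rfl fun j _ => ?_
  rw [hΨ.hDeriv_dilation hr j hx, hDeriv_logRadius_dilation hr j hx, hΨ.homogeneous r hr x hx]; ring

theorem IsHomogeneousSolution.isCritHomogeneous_weight (hΨ : IsHomogeneousSolution Ψ) :
    IsCritHomogeneous fun x => Ψ x ^ 2 * ∑ j, hDeriv j logRadius x ^ 2 := by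
  refine ⟨(hΨ.contDiffOn.continuousOn.pow 2).mul (continuousOn_finsetSum _ fun j _ =>
    (continuousOn_hDeriv_logRadius j).pow 2), fun r hr x hx => ?_⟩
  simp only
  rw [Finset.mul_sum, Finset.mul_sum, Finset.mul_sum, ← rpow_sq_mul_inv_sq hr]
  refine Finset.sum_congr rfl fun j _ => ?_
  rw [hDeriv_logRadius_dilation hr j hx, hΨ.homogeneous r hr x hx]; ring

/-- The product of a radial factor, in logarithmic coordinates, with a function. -/
def radialMul (h : ℝ → ℝ) (f : Heis n → ℝ) (x : Heis n) : ℝ := h (logRadius x) * f x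

theorem contDiffOn_radialMul (hΨ : IsHomogeneousSolution Ψ) {h : ℝ → ℝ} (hh : ContDiff ℝ 1 h) :
    ContDiffOn ℝ 1 (radialMul h Ψ) {0}ᶜ :=
  (hh.comp_contDiffOn (contDiffOn_logRadius.of_le (by simp))).mul
    (hΨ.contDiffOn.of_le (by norm_num))

theorem hDeriv_radialMul (hΨ : IsHomogeneousSolution Ψ) {h : ℝ → ℝ} (hh : ContDiff ℝ 1 h)
    (j : Fin n ⊕ Fin n) {x : Heis n} (hx : x ≠ 0) :
    hDeriv j (radialMul h Ψ) x =
      h (logRadius x) * hDeriv j Ψ x + deriv h (logRadius x) * (Ψ x * hDeriv j logRadius x) := by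
  have hΨd : DifferentiableAt ℝ Ψ x :=
    hΨ.differentiableOn.differentiableAt (isOpen_punctured.mem_nhds hx)
  have hρ : DifferentiableAt ℝ (logRadius : Heis n → ℝ) x :=
    (contDiffOn_logRadius.differentiableOn (by simp)).differentiableAt
      (isOpen_punctured.mem_nhds hx)
  have hhd : HasDerivAt h (deriv h (logRadius x)) (logRadius x) :=
    (hh.differentiable (by simp) _).hasDerivAt
  have hc := hhd.comp_hasFDerivAt x hρ.hasFDerivAt
  have e : hDeriv j (fun y => h (logRadius y)) x = deriv h (logRadius x) * hDeriv j logRadius x := by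
    have : fderiv ℝ (fun y => h (logRadius y)) x = _ := hc.fderiv
    rw [hDeriv, this]; rfl
  have h1 := hDeriv_mul (f := fun y => h (logRadius y)) (g := Ψ) hc.differentiableAt hΨd j
  have h2 : (radialMul h Ψ) = fun y => h (logRadius y) * Ψ y := rfl
  rw [h2, h1, e]; ring

/-- Testing the equation with a compactly supported radial multiple of `Ψ`: in logarithmic polar
coordinates the densities `|∇Ψ|²` and `Ψ^{2*}` have the same mass. -/
theorem IsHomogeneousSolution.grad_const_eq (hn : 1 ≤ n) (hΨ : IsHomogeneousSolution Ψ)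
    {c₀ c₁ c₂ : ℝ}
    (h₀ : ∀ (a b : ℝ), a ≤ b → ∀ g : ℝ → ℝ, Continuous g →
      ∫ x in shell n (Real.exp a) (Real.exp b), Ψ x ^ critExp n * g (logRadius x) =
        c₀ * ∫ s in a..b, g s)
    (h₁ : ∀ (a b : ℝ), a ≤ b → ∀ g : ℝ → ℝ, Continuous g →
      ∫ x in shell n (Real.exp a) (Real.exp b), (∑ j, hDeriv j Ψ x ^ 2) * g (logRadius x) =
        c₁ * ∫ s in a..b, g s)
    (h₂ : ∀ (a b : ℝ), a ≤ b → ∀ g : ℝ → ℝ, Continuous g →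
      ∫ x in shell n (Real.exp a) (Real.exp b),
        (Ψ x * ∑ j, hDeriv j Ψ x * hDeriv j logRadius x) * g (logRadius x) =
        c₂ * ∫ s in a..b, g s) : c₁ = c₀ := by
  -- The bump is supported away from `0`, the junk value of `logRadius` at the origin.
  let g : ContDiffBump (3 : ℝ) := ⟨1, 2, one_pos, by norm_num⟩
  have hg1 : ContDiff ℝ 1 g := g.contDiff
  have hgs : ∀ s ∉ Set.Icc (1:ℝ) 5, g s = 0 := by
    intro s hs
    refine g.zero_of_le_dist ?_
    rw [Real.dist_eq]
    by_contra hlt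
    have := abs_lt.1 (not_le.1 hlt)
    simp only [g] at this
    exact hs ⟨by linarith, by linarith⟩
  have hint0 : ∫ s in (0:ℝ)..6, g s ≠ 0 := by
    have hpos : 0 < ∫ s, g s := g.integral_pos
    have e : ∫ s in (0:ℝ)..6, g s = ∫ s, g s := by
      rw [intervalIntegral.integral_of_le (by norm_num), ← integral_Icc_eq_integral_Ioc]
      exact setIntegral_eq_integral_of_forall_compl_eq_zero fun s hs => hgs s fun h =>
        hs ⟨by linarith [h.1], by linarith [h.2]⟩
    rw [e]; exact hpos.ne'
  have hderiv0 : ∫ s in (0:ℝ)..6, deriv g s = 0 := by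
    rw [intervalIntegral.integral_deriv_eq_sub (fun s _ => hg1.differentiable (by simp) s)
      ((hg1.continuous_deriv (by simp)).intervalIntegrable _ _), hgs 6 (by norm_num),
      hgs 0 (by norm_num), sub_zero]
  set φ : Heis n → ℝ := radialMul g Ψ with hφ
  set K := shell n (Real.exp 1) (Real.exp 5) with hK
  set A := shell n (Real.exp 0) (Real.exp 6) with hA
  have hAm : MeasurableSet A := (isCompact_shell _ _).measurableSet
  have hA0 : A ⊆ {0}ᶜ := shell_subset (Real.exp_pos _)
  have hKA : K ⊆ A := shell_mono (Real.exp_le_exp.2 (by norm_num)) (Real.exp_le_exp.2 (by norm_num))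
  have hφ0 : ∀ x ∉ K, φ x = 0 := by
    intro x hx
    rcases eq_or_ne x 0 with rfl | hx0
    · simp [hφ, radialMul, logRadius, hgs 0 (by norm_num)]
    · rw [hφ, radialMul, hgs _ fun h => hx ((mem_shell_exp_iff hx0 1 5).2 h), zero_mul]
  have hts : tsupport φ ⊆ K := closure_minimal (fun x hx => by
    by_contra h
    exact hx (hφ0 x h)) (isCompact_shell _ _).isClosed
  have hts0 : tsupport φ ⊆ {0}ᶜ := hts.trans (hKA.trans hA0)
  have hφc : HasCompactSupport φ :=
    (isCompact_shell _ _).of_isClosed_subset (isClosed_tsupport _) hts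
  have hφ1 : ContDiff ℝ 1 φ := by
    refine contDiff_iff_contDiffAt.2 fun x => ?_
    by_cases hx : x ∈ tsupport φ
    · exact (contDiffOn_radialMul hΨ hg1).contDiffAt (isOpen_punctured.mem_nhds (hts0 hx))
    · refine (contDiffAt_const (c := (0:ℝ))).congr_of_eventuallyEq ?_
      filter_upwards [(isClosed_tsupport φ).isOpen_compl.mem_nhds hx] with y hy
      exact image_eq_zero_of_notMem_tsupport hy
  have hib : ∀ j, ∫ x, hDeriv j Ψ x * hDeriv j φ x = -∫ x, hDeriv j (hDeriv j Ψ) x * φ x :=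
    fun j => integral_mul_hDeriv_eq_neg (hΨ.contDiffOn_hDeriv j) hφ1 hφc hts0 j
  have i1 : ∀ j, Integrable fun x => hDeriv j Ψ x * hDeriv j φ x := fun j =>
    (memL2Loc_of_continuousOn (hΨ.contDiffOn_hDeriv j).continuousOn).integrable_mul
      (continuous_hDeriv hφ1 j)
      (hφc.of_isClosed_subset (isClosed_tsupport _) (tsupport_hDeriv_subset j φ))
      ((tsupport_hDeriv_subset j φ).trans hts0)
  have i2 : ∀ j, Integrable fun x => hDeriv j (hDeriv j Ψ) x * φ x := fun j =>
    (memL2Loc_of_continuousOn (Heisenberg.contDiffOn_hDeriv (m := 0) (hΨ.contDiffOn_hDeriv j)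
      (by simp) j).continuousOn).integrable_mul hφ1.continuous hφc hts0
  have hsum : ∫ x, ∑ j, hDeriv j Ψ x * hDeriv j φ x =
      ∫ x, -∑ j, hDeriv j (hDeriv j Ψ) x * φ x := by
    rw [integral_neg, integral_finsetSum _ fun j _ => i1 j, integral_finsetSum _ fun j _ => i2 j,
      ← Finset.sum_neg_distrib]
    exact Finset.sum_congr rfl fun j _ => hib j
  have hR : ∫ x, -∑ j, hDeriv j (hDeriv j Ψ) x * φ x = c₀ * ∫ s in (0:ℝ)..6, g s := by
    rw [← h₀ 0 6 (by norm_num) g g.continuous,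
      ← setIntegral_eq_integral_of_forall_compl_eq_zero (s := A) fun x hx => by
        simp [hφ0 x fun h => hx (hKA h)]]
    refine setIntegral_congr_fun hAm fun x hx => ?_
    have hx0 : x ≠ 0 := hA0 hx
    have heq := hΨ.equation x hx0
    have hQ := homDim_sub_two_pos hn
    have hexp : Ψ x ^ critExp n = Ψ x ^ ((homDim n + 2) / (homDim n - 2)) * Ψ x := by
      rw [← Real.rpow_add_one (hΨ.pos x hx0).ne', critExp]
      congr 1
      field_simp
      ring
    rw [hexp, ← heq, subLaplacian, ← Finset.sum_mul, hφ, radialMul]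
    ring
  have hL : ∫ x, ∑ j, hDeriv j Ψ x * hDeriv j φ x = c₁ * ∫ s in (0:ℝ)..6, g s := by
    have e : ∫ x, ∑ j, hDeriv j Ψ x * hDeriv j φ x =
        ∫ x in A, ((∑ j, hDeriv j Ψ x ^ 2) * g (logRadius x) +
          (Ψ x * ∑ j, hDeriv j Ψ x * hDeriv j logRadius x) * deriv g (logRadius x)) := by
      rw [← setIntegral_eq_integral_of_forall_compl_eq_zero (s := A) fun x hx => by
        refine Finset.sum_eq_zero fun j _ => ?_
        have : hDeriv j φ x = 0 := by
          by_contra h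
          exact hx (hKA (hts (tsupport_hDeriv_subset j φ (subset_tsupport _ h))))
        rw [this, mul_zero]]
      refine setIntegral_congr_fun hAm fun x hx => ?_
      rw [Finset.mul_sum, Finset.sum_mul, Finset.sum_mul, ← Finset.sum_add_distrib]
      refine Finset.sum_congr rfl fun j _ => ?_
      rw [hφ, hDeriv_radialMul hΨ hg1 j (hA0 hx)]
      ring
    rw [e, integral_add (hΨ.isCritHomogeneous_grad.integrableOn 0 6 g.continuous)
      (hΨ.isCritHomogeneous_cross.integrableOn 0 6 (hg1.continuous_deriv (by simp))),
      h₁ 0 6 (by norm_num) g g.continuous,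
      h₂ 0 6 (by norm_num) _ (hg1.continuous_deriv (by simp)), hderiv0, mul_zero, add_zero]
  rw [hL, hR] at hsum
  exact mul_right_cancel₀ hint0 hsum

theorem IsHomogeneousSolution.radialMul_mem_periodicSpace (hΨ : IsHomogeneousSolution Ψ) {T : ℝ}
    (hT : 0 < T) {h : ℝ → ℝ} (hh : ContDiff ℝ 1 h) (hper : ∀ s, h (Real.log T + s) = h s) :
    radialMul h Ψ ∈ periodicSpace n T := by
  refine ⟨memS1Loc_of_contDiffOn (contDiffOn_radialMul hΨ hh), ?_⟩
  filter_upwards [ae_ne_zero] with x hx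
  rw [radialMul, radialMul, logRadius_dilation hT hx, hper, hΨ.homogeneous T hT x hx]
  ring

/-- The second variation in radial directions is a one dimensional quadratic form with constant
coefficients that do not depend on `T`. -/
theorem IsHomogeneousSolution.exists_secondVariation_radialMul (hn : 1 ≤ n)
    (hΨ : IsHomogeneousSolution Ψ) : ∃ A B : ℝ, 0 < A ∧ ∀ T : ℝ, 1 < T → ∀ h : ℝ → ℝ,
      ContDiff ℝ 1 h → (∀ s, h (Real.log T + s) = h s) →
      secondVariation (energy n T) Ψ (radialMul h Ψ) =
        B * (∫ s in (0:ℝ)..Real.log T, deriv h s ^ 2) - A * ∫ s in (0:ℝ)..Real.log T, h s ^ 2 := by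
  obtain ⟨c₀, hc₀, h₀⟩ := (hΨ.isCritHomogeneous_power hn).exists_integral_eq_of_pos
    fun x hx => Real.rpow_pos_of_pos (hΨ.pos x hx) _
  obtain ⟨c₁, h₁⟩ := hΨ.isCritHomogeneous_grad.exists_integral_eq
  obtain ⟨c₂, h₂⟩ := hΨ.isCritHomogeneous_cross.exists_integral_eq
  obtain ⟨c₃, h₃⟩ := hΨ.isCritHomogeneous_weight.exists_integral_eq
  have hc : c₁ = c₀ := hΨ.grad_const_eq hn h₀ h₁ h₂
  set p := critExp n with hp
  have hp2 : 2 < p := two_lt_critExp hn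
  refine ⟨(p - 2) * c₀, c₃, mul_pos (by linarith) hc₀, fun T hT h hh hper => ?_⟩
  have hT0 : 0 < T := by linarith
  set L := Real.log T with hL
  have hL0 : 0 ≤ L := Real.log_nonneg hT.le
  have hann : annulus n T = shell n (Real.exp 0) (Real.exp L) := by
    rw [annulus_eq_shell, Real.exp_zero, hL, Real.exp_log hT0]
  have hAm : MeasurableSet (annulus n T) := (isCompact_shell 1 T).measurableSet
  have hA0 : annulus n T ⊆ {0}ᶜ := shell_subset one_pos
  have hhc := hh.continuous
  have hhd := hh.continuous_deriv (by simp)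
  have hcd := contDiffOn_radialMul hΨ hh
  have hup : MemLp (radialMul h Ψ) (ENNReal.ofReal p) (volume.restrict (annulus n T)) :=
    memLp_restrict_of_continuousOn hcd.continuousOn _ (isCompact_shell 1 T) hA0
  rw [secondVariation_eq hn hΨ.memS1Loc (memS1Loc_of_contDiffOn hcd) (hΨ.memLp T _) hup, ← hp]
  have e1 : ∫ x in annulus n T, ∑ j, weakDeriv j (radialMul h Ψ) x ^ 2 =
      ∫ x in annulus n T, (((∑ j, hDeriv j Ψ x ^ 2) * h (logRadius x) ^ 2 +
        (Ψ x * ∑ j, hDeriv j Ψ x * hDeriv j logRadius x) *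
          (2 * h (logRadius x) * deriv h (logRadius x))) +
        (Ψ x ^ 2 * ∑ j, hDeriv j logRadius x ^ 2) * deriv h (logRadius x) ^ 2) := by
    refine integral_congr_ae (ae_restrict_of_ae ?_)
    filter_upwards [ae_all_iff.2 fun j => weakDeriv_ae_eq_hDeriv hcd j, ae_ne_zero] with x hx hx0
    simp only [hx]
    rw [Finset.mul_sum, Finset.mul_sum, Finset.sum_mul, Finset.sum_mul, Finset.sum_mul,
      ← Finset.sum_add_distrib, ← Finset.sum_add_distrib]
    refine Finset.sum_congr rfl fun j _ => ?_
    rw [hDeriv_radialMul hΨ hh j hx0]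
    ring
  have e2 : ∫ x in annulus n T, |Ψ x| ^ (p - 2) * radialMul h Ψ x ^ 2 =
      ∫ x in annulus n T, Ψ x ^ p * h (logRadius x) ^ 2 := by
    refine setIntegral_congr_fun hAm fun x hx => ?_
    have hpos := hΨ.pos x (hA0 hx)
    have : Ψ x ^ p = Ψ x ^ (p - 2) * Ψ x ^ 2 := by
      rw [← Real.rpow_natCast, ← Real.rpow_add hpos]
      norm_num
    rw [this, abs_of_pos hpos, radialMul]; ring
  -- The cross term is a total derivative, so it integrates to zero over a period.
  have hper0 : ∫ s in (0:ℝ)..L, 2 * h s * deriv h s = 0 := by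
    have hd : ∀ s ∈ Set.uIcc 0 L, HasDerivAt (fun s => h s ^ 2) (2 * h s * deriv h s) s := by
      intro s _
      have h1 : HasDerivAt (fun s => h s ^ 2) ((2 : ℕ) * h s ^ (2 - 1) * deriv h s) s :=
        ((hh.differentiable (by simp) s).hasDerivAt).pow 2
      simpa using h1
    rw [intervalIntegral.integral_eq_sub_of_hasDerivAt hd
      (((continuous_const.mul hhc).mul hhd).intervalIntegrable _ _)]
    have := hper 0
    rw [add_zero] at this
    rw [this, sub_self]
  have k1 : Continuous fun s => h s ^ 2 := hhc.pow 2
  have k2 : Continuous fun s => 2 * h s * deriv h s := (continuous_const.mul hhc).mul hhd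
  have k3 : Continuous fun s => deriv h s ^ 2 := hhd.pow 2
  have i1 := hΨ.isCritHomogeneous_grad.integrableOn 0 L k1
  have i2 := hΨ.isCritHomogeneous_cross.integrableOn 0 L k2
  have i3 := hΨ.isCritHomogeneous_weight.integrableOn 0 L k3
  have i12 : IntegrableOn (fun x => (∑ j, hDeriv j Ψ x ^ 2) * h (logRadius x) ^ 2 +
      (Ψ x * ∑ j, hDeriv j Ψ x * hDeriv j logRadius x) *
        (2 * h (logRadius x) * deriv h (logRadius x))) (shell n (Real.exp 0) (Real.exp L)) :=
    i1.add i2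
  rw [e1, e2, hann, h₀ 0 L hL0 _ k1, integral_add i12 i3, integral_add i1 i2, h₁ 0 L hL0 _ k1, h₂ 0 L hL0 _ k2, h₃ 0 L hL0 _ k3, hper0, hc]
  ring

end Solution

/-! ### Sine polynomials and growth of the Morse index -/

theorem integral_cos_int_mul {L : ℝ} (hL : 0 < L) (m : ℤ) :
    ∫ s in (0:ℝ)..L, Real.cos (m * (2 * Real.pi / L) * s) = if m = 0 then L else 0 := by
  by_cases hm : m = 0
  · simp [hm]
  · rw [if_neg hm]
    have hc : (m : ℝ) * (2 * Real.pi / L) ≠ 0 :=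
      mul_ne_zero (by exact_mod_cast hm) (by positivity)
    rw [intervalIntegral.integral_comp_mul_left (fun s => Real.cos s) hc, integral_cos]
    have : (m : ℝ) * (2 * Real.pi / L) * L = (m : ℝ) * (2 * Real.pi) := by field_simp
    rw [this, mul_zero, Real.sin_zero, sub_zero]
    have h2 : Real.sin ((m : ℝ) * (2 * Real.pi)) = 0 := by
      have := Real.sin_int_mul_pi (2 * m)
      push_cast at this
      rw [← this]; congr 1; ring
    rw [h2, smul_zero]

/-- The sine polynomial of period `L` without constant term, with coefficient `c k` at frequency
`k + 1`. -/
def sinePoly (N : ℕ) (L : ℝ) (c : Fin N → ℝ) (s : ℝ) : ℝ :=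
  ∑ k, c k * Real.sin (((k : ℕ) + 1 : ℝ) * (2 * Real.pi / L) * s)

theorem contDiff_sinePoly (N : ℕ) (L : ℝ) (c : Fin N → ℝ) : ContDiff ℝ 1 (sinePoly N L c) := by
  unfold sinePoly
  exact ContDiff.sum fun k _ =>
    contDiff_const.mul (Real.contDiff_sin.comp (contDiff_const.mul contDiff_id))

theorem sinePoly_add_period {L : ℝ} (hL : 0 < L) (N : ℕ) (c : Fin N → ℝ) (s : ℝ) :
    sinePoly N L c (L + s) = sinePoly N L c s := by
  refine Finset.sum_congr rfl fun k _ => ?_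
  congr 1
  have : ((k : ℕ) + 1 : ℝ) * (2 * Real.pi / L) * (L + s) =
      ((k : ℕ) + 1 : ℝ) * (2 * Real.pi / L) * s + ((k + 1 : ℕ) : ℝ) * (2 * Real.pi) := by
    push_cast; field_simp; ring
  rw [this, Real.sin_add_nat_mul_two_pi]

theorem deriv_sinePoly (N : ℕ) (L : ℝ) (c : Fin N → ℝ) (s : ℝ) :
    deriv (sinePoly N L c) s = ∑ k : Fin N, (c k * (((k : ℕ) + 1 : ℝ) * (2 * Real.pi / L))) *
      Real.cos (((k : ℕ) + 1 : ℝ) * (2 * Real.pi / L) * s) := by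
  refine HasDerivAt.deriv ?_
  unfold sinePoly
  refine HasDerivAt.fun_sum fun k _ => ?_
  have h1 : HasDerivAt (fun s : ℝ => ((k : ℕ) + 1 : ℝ) * (2 * Real.pi / L) * s)
      (((k : ℕ) + 1 : ℝ) * (2 * Real.pi / L)) s := by
    simpa using (hasDerivAt_id s).const_mul (((k : ℕ) + 1 : ℝ) * (2 * Real.pi / L))
  refine ((h1.sin).const_mul (c k)).congr_deriv ?_
  ring

theorem integral_sum_sq_of_orthogonal {N : ℕ} {L : ℝ} {e : Fin N → ℝ → ℝ}
    (he : ∀ k, Continuous (e k))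
    (h : ∀ k l, ∫ s in (0:ℝ)..L, e k s * e l s = if k = l then L / 2 else 0) (c : Fin N → ℝ) :
    ∫ s in (0:ℝ)..L, (∑ k, c k * e k s) ^ 2 = L / 2 * ∑ k, c k ^ 2 := by
  have e1 : ∀ s, (∑ k, c k * e k s) ^ 2 = ∑ k, ∑ l, c k * c l * (e k s * e l s) := by
    intro s
    rw [sq, Finset.sum_mul_sum]
    exact Finset.sum_congr rfl fun k _ => Finset.sum_congr rfl fun l _ => by ring
  simp_rw [e1]
  have hkl : ∀ k l, Continuous fun s => c k * c l * (e k s * e l s) := fun k l =>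
    continuous_const.mul ((he k).mul (he l))
  rw [intervalIntegral.integral_finsetSum fun k _ =>
    (continuous_finsetSum _ fun l _ => hkl k l).intervalIntegrable _ _, Finset.mul_sum]
  refine Finset.sum_congr rfl fun k _ => ?_
  rw [intervalIntegral.integral_finsetSum fun l _ => (hkl k l).intervalIntegrable _ _]
  simp_rw [intervalIntegral.integral_const_mul, h]
  simp
  ring

theorem integral_sin_mul_sin_period {L : ℝ} (hL : 0 < L) {N : ℕ} (k l : Fin N) :
    ∫ s in (0:ℝ)..L, Real.sin (((k : ℕ) + 1 : ℝ) * (2 * Real.pi / L) * s) *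
      Real.sin (((l : ℕ) + 1 : ℝ) * (2 * Real.pi / L) * s) = if k = l then L / 2 else 0 := by
  have e : ∀ s : ℝ, Real.sin (((k : ℕ) + 1 : ℝ) * (2 * Real.pi / L) * s) *
      Real.sin (((l : ℕ) + 1 : ℝ) * (2 * Real.pi / L) * s) =
      1 / 2 * Real.cos ((((k : ℤ) - (l : ℤ) : ℤ) : ℝ) * (2 * Real.pi / L) * s) -
      1 / 2 * Real.cos ((((k : ℤ) + (l : ℤ) + 2 : ℤ) : ℝ) * (2 * Real.pi / L) * s) := by
    intro s
    set α := ((k : ℕ) + 1 : ℝ) * (2 * Real.pi / L) * s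
    set β := ((l : ℕ) + 1 : ℝ) * (2 * Real.pi / L) * s
    have h1 : (((k : ℤ) - (l : ℤ) : ℤ) : ℝ) * (2 * Real.pi / L) * s = α - β := by
      simp only [α, β]; push_cast; ring
    have h2 : (((k : ℤ) + (l : ℤ) + 2 : ℤ) : ℝ) * (2 * Real.pi / L) * s = α + β := by
      simp only [α, β]; push_cast; ring
    rw [h1, h2, Real.cos_sub, Real.cos_add]; ring
  have hc : ∀ m : ℤ, IntervalIntegrable (fun s => 1 / 2 * Real.cos ((m : ℝ) * (2 * Real.pi / L) * s))
      volume 0 L := fun m => Continuous.intervalIntegrable (by fun_prop) _ _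
  simp_rw [e]
  rw [intervalIntegral.integral_sub (hc _) (hc _), intervalIntegral.integral_const_mul,
    intervalIntegral.integral_const_mul, integral_cos_int_mul hL, integral_cos_int_mul hL]
  have h0 : ¬ ((k : ℤ) + (l : ℤ) + 2 = 0) := by omega
  have h1 : ((k : ℤ) - (l : ℤ) = 0) ↔ k = l := by rw [Fin.ext_iff]; omega
  rw [if_neg h0]
  by_cases hkl : k = l
  · rw [if_pos (h1.2 hkl), if_pos hkl]; ring
  · rw [if_neg (fun h => hkl (h1.1 h)), if_neg hkl]; ring

theorem integral_cos_mul_cos_period {L : ℝ} (hL : 0 < L) {N : ℕ} (k l : Fin N) :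
    ∫ s in (0:ℝ)..L, Real.cos (((k : ℕ) + 1 : ℝ) * (2 * Real.pi / L) * s) *
      Real.cos (((l : ℕ) + 1 : ℝ) * (2 * Real.pi / L) * s) = if k = l then L / 2 else 0 := by
  have e : ∀ s : ℝ, Real.cos (((k : ℕ) + 1 : ℝ) * (2 * Real.pi / L) * s) *
      Real.cos (((l : ℕ) + 1 : ℝ) * (2 * Real.pi / L) * s) =
      1 / 2 * Real.cos ((((k : ℤ) - (l : ℤ) : ℤ) : ℝ) * (2 * Real.pi / L) * s) +
      1 / 2 * Real.cos ((((k : ℤ) + (l : ℤ) + 2 : ℤ) : ℝ) * (2 * Real.pi / L) * s) := by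
    intro s
    set α := ((k : ℕ) + 1 : ℝ) * (2 * Real.pi / L) * s
    set β := ((l : ℕ) + 1 : ℝ) * (2 * Real.pi / L) * s
    have h1 : (((k : ℤ) - (l : ℤ) : ℤ) : ℝ) * (2 * Real.pi / L) * s = α - β := by
      simp only [α, β]; push_cast; ring
    have h2 : (((k : ℤ) + (l : ℤ) + 2 : ℤ) : ℝ) * (2 * Real.pi / L) * s = α + β := by
      simp only [α, β]; push_cast; ring
    rw [h1, h2, Real.cos_sub, Real.cos_add]; ring
  have hc : ∀ m : ℤ, IntervalIntegrable (fun s => 1 / 2 * Real.cos ((m : ℝ) * (2 * Real.pi / L) * s))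
      volume 0 L := fun m => Continuous.intervalIntegrable (by fun_prop) _ _
  simp_rw [e]
  rw [intervalIntegral.integral_add (hc _) (hc _), intervalIntegral.integral_const_mul,
    intervalIntegral.integral_const_mul, integral_cos_int_mul hL, integral_cos_int_mul hL]
  have h0 : ¬ ((k : ℤ) + (l : ℤ) + 2 = 0) := by omega
  have h1 : ((k : ℤ) - (l : ℤ) = 0) ↔ k = l := by rw [Fin.ext_iff]; omega
  rw [if_neg h0]
  by_cases hkl : k = l
  · rw [if_pos (h1.2 hkl), if_pos hkl]; ring
  · rw [if_neg (fun h => hkl (h1.1 h)), if_neg hkl]; ring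

theorem integral_sinePoly_sq {L : ℝ} (hL : 0 < L) {N : ℕ} (c : Fin N → ℝ) :
    ∫ s in (0:ℝ)..L, sinePoly N L c s ^ 2 = L / 2 * ∑ k, c k ^ 2 :=
  integral_sum_sq_of_orthogonal (fun k => by fun_prop) (integral_sin_mul_sin_period hL) c

theorem integral_deriv_sinePoly_sq_le {L : ℝ} (hL : 0 < L) {N : ℕ} (c : Fin N → ℝ) :
    ∫ s in (0:ℝ)..L, deriv (sinePoly N L c) s ^ 2 ≤
      (N * (2 * Real.pi / L)) ^ 2 * (L / 2 * ∑ k, c k ^ 2) := by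
  simp_rw [deriv_sinePoly]
  rw [integral_sum_sq_of_orthogonal (fun k => by fun_prop) (integral_cos_mul_cos_period hL),
    mul_left_comm]
  refine mul_le_mul_of_nonneg_left ?_ (by positivity)
  rw [Finset.mul_sum]
  refine Finset.sum_le_sum fun k _ => ?_
  rw [mul_pow, mul_comm]
  refine mul_le_mul_of_nonneg_right (pow_le_pow_left₀ (by positivity) ?_ 2) (sq_nonneg _)
  refine mul_le_mul_of_nonneg_right ?_ (by positivity)
  exact_mod_cast k.2

/-- The directions `h(log |x|) Ψ` with `h` a sine polynomial, as a linear map. -/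
def sineDirection (N : ℕ) (L : ℝ) (Ψ : Heis n → ℝ) : (Fin N → ℝ) →ₗ[ℝ] (Heis n → ℝ) where
  toFun c := radialMul (sinePoly N L c) Ψ
  map_add' c d := by
    ext x
    simp only [radialMul, sinePoly, Pi.add_apply, add_mul, Finset.sum_add_distrib]
  map_smul' a c := by
    ext x
    simp only [radialMul, sinePoly, Pi.smul_apply, smul_eq_mul, RingHom.id_apply, Finset.sum_mul,
      Finset.mul_sum, mul_assoc]

theorem secondVariation_zero {E : Type*} [AddCommGroup E] [Module ℝ E] (J : E → ℝ) (v : E) :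
    secondVariation J v 0 = 0 := by
  simp [secondVariation, iteratedDeriv_const]

/-- The sine polynomials of degree at most `N` give `N` negative directions once `T` is large. -/
theorem IsHomogeneousSolution.le_morseIndex (hn : 1 ≤ n) {Ψ : Heis n → ℝ}
    (hΨ : IsHomogeneousSolution Ψ) (N : ℕ) :
    ∀ᶠ T in atTop, (N : ℕ∞) ≤ morseIndex (periodicSpace n T) (energy n T) Ψ := by
  obtain ⟨A, B, hA, hvar⟩ := hΨ.exists_secondVariation_radialMul hn
  have hlim : Tendsto (fun T => |B| * (N * (2 * Real.pi / Real.log T)) ^ 2) atTop (𝓝 0) := by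
    have h1 : Tendsto (fun T => 2 * Real.pi / Real.log T) atTop (𝓝 0) :=
      Real.tendsto_log_atTop.const_div_atTop _
    simpa using ((h1.const_mul (N : ℝ)).pow 2).const_mul |B|
  filter_upwards [hlim.eventually (gt_mem_nhds hA), eventually_gt_atTop 1] with T hTA hT
  have hT0 : 0 < T := by linarith
  set L := Real.log T with hL
  have hL0 : 0 < L := Real.log_pos hT
  have hneg : ∀ c : Fin N → ℝ, c ≠ 0 →
      secondVariation (energy n T) Ψ (sineDirection N L Ψ c) < 0 := by
    intro c hc
    have h1 : secondVariation (energy n T) Ψ (sineDirection N L Ψ c) = _ :=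
      hvar T hT (sinePoly N L c) (contDiff_sinePoly N L c) (sinePoly_add_period hL0 N c)
    have hpos : 0 < L / 2 * ∑ k, c k ^ 2 := by
      refine mul_pos (by positivity) ?_
      obtain ⟨k, hk⟩ := Function.ne_iff.1 hc
      exact Finset.sum_pos' (fun i _ => sq_nonneg _) ⟨k, Finset.mem_univ k, by
        have : c k ≠ 0 := hk
        positivity⟩
    have h2 := integral_deriv_sinePoly_sq_le hL0 c
    have h3 : 0 ≤ ∫ s in (0:ℝ)..L, deriv (sinePoly N L c) s ^ 2 :=
      intervalIntegral.integral_nonneg hL0.le fun s _ => sq_nonneg _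
    have h4 : B * (∫ s in (0:ℝ)..L, deriv (sinePoly N L c) s ^ 2) ≤
        |B| * ((N * (2 * Real.pi / L)) ^ 2 * (L / 2 * ∑ k, c k ^ 2)) :=
      (mul_le_mul_of_nonneg_right (le_abs_self B) h3).trans
        (mul_le_mul_of_nonneg_left h2 (abs_nonneg B))
    have h5 := mul_lt_mul_of_pos_right hTA hpos
    rw [h1, ← hL, integral_sinePoly_sq hL0]
    linarith
  -- A nonzero combination has negative second variation, so it is a nonzero function.
  have hinj : Function.Injective (sineDirection N L Ψ) := by
    rw [injective_iff_map_eq_zero]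
    intro c hc
    by_contra hc0
    have := hneg c hc0
    rw [hc, secondVariation_zero] at this
    exact lt_irrefl _ this
  have hfr : Module.finrank ℝ (LinearMap.range (sineDirection N L Ψ)) = N := by
    rw [LinearMap.finrank_range_of_inj hinj]; simp
  have hmem : LinearMap.range (sineDirection N L Ψ) ∈ {V : Submodule ℝ (Heis n → ℝ) |
      V ≤ periodicSpace n T ∧ FiniteDimensional ℝ V ∧
        ∀ u ∈ V, u ≠ 0 → secondVariation (energy n T) Ψ u < 0} := by
    refine ⟨?_, inferInstance, ?_⟩
    · rintro _ ⟨c, rfl⟩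
      exact hΨ.radialMul_mem_periodicSpace hT0 (contDiff_sinePoly N L c)
        (sinePoly_add_period hL0 N c)
    · rintro _ ⟨c, rfl⟩ hc
      exact hneg c fun h => hc (by rw [h, map_zero])
  have := le_iSup₂ (f := fun (V : Submodule ℝ (Heis n → ℝ)) (_ : V ∈ {V : Submodule ℝ (Heis n → ℝ) |
      V ≤ periodicSpace n T ∧ FiniteDimensional ℝ V ∧
        ∀ u ∈ V, u ≠ 0 → secondVariation (energy n T) Ψ u < 0}) =>
      (Module.finrank ℝ V : ℕ∞)) _ hmem
  rw [hfr] at this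
  exact this

end Heisenberg
end

theorem mainTheorem7 (n : ℕ) (hn : 1 ≤ n) (Ψ : Heisenberg.Heis n → ℝ)
    (hΨ : Heisenberg.IsHomogeneousSolution Ψ) :
    (∀ T : ℝ, 1 < T →
      Ψ ∈ Heisenberg.periodicSpace n T ∧
      Heisenberg.morseIndex (Heisenberg.periodicSpace n T) (Heisenberg.energy n T) Ψ < ⊤) ∧
    Tendsto
      (fun T : ℝ =>
        Heisenberg.morseIndex (Heisenberg.periodicSpace n T) (Heisenberg.energy n T) Ψ)
      atTop (𝓝 ⊤) := by
  refine ⟨fun T hT => ⟨hΨ.mem_periodicSpace (by linarith), hΨ.morseIndex_lt_top hn hT⟩, ?_⟩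
  refine ENat.tendsto_nhds_top_iff_natCast_lt.2 fun N => ?_
  filter_upwards [hΨ.le_morseIndex hn (N + 1)] with T hT
  exact lt_of_lt_of_le (by exact_mod_cast Nat.lt_succ_self N) hT
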